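/- Let $\mathcal H$ and $\mathcal K$ be complex Hilbert spaces (for instance $\mathcal K=\mathcal H$), with inner products linear in the first argument. Let $T$ be a closed densely defined operator in $\mathcal H$ with purely continuous spectrum $\sigma(T)\subset\mathbb R$, that is, for every $\lambda\in\sigma(T)$ the operator $T-\lambda I$ is injective with dense range. Put $R_0(\lambda)=(T-\lambda I)^{-1}$ and $R_0^*(\lambda)=(T^*-\lambda I)^{-1}$. A bounded operator $A:\mathcal H\to\mathcal K$ is called smooth relative to an operator $S$ whose spectrum is real if, for every $\varphi\in\mathcal H$, the function $A(S-\lambda I)^{-1}\varphi$ belongs to the Hardy classes $\mathrm H_2^\pm$ of the half-planes $\mathbb C_\pm=\{\pm\operatorname{Im}\lambda>0\}$, i.e. it is analytic there and $\sup_{\varepsilon>0}\int_{\mathbb R}\|A(S-(k\pm i\varepsilon)I)^{-1}\varphi\|^2\,dk<\infty$. Let $V=B^*A$, where $A,B:\mathcal H\to\mathcal K$ are bounded, $A$ is smooth relative to $T$ and $B$ is smooth relative to $T^*$, and suppose that $Q_0(\lambda)=AR_0(\lambda)B^*$ is bounded in $\mathbb C_+\cup\mathbb C_-$. Let $L=T+V$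 with $D(L)=D(T)$, $R_V(\lambda)=(L-\lambda I)^{-1}$, $R_V^*(\lambda)=(L^*-\lambda I)^{-1}$. Let $\sigma_d(L)$ be the discrete spectrum of $L$ (the isolated points of the spectrum of finite algebraic multiplicity) and $\sigma_c(L)=\sigma(L)\setminus\sigma_d(L)$. Assume: (i) $R_V(\lambda)$ is meromorphic in $\mathbb C\setminus\sigma(T)$, its poles there are exactly the eigenvalues of $L$ in this set, and the multiplicity of each pole (the rank of the residue) is finite and equal to the algebraic multiplicity of the eigenvalue; (ii) $\sigma_d(L)$ is finite and $\sigma_c(L)=\sigma(T)$; (iii) for every $\delta>0$ the operator function $Q_V(\lambda)=AR_V(\lambda)B^*$ is bounded on the set of non-real $\lambda$ whose distance to every point of $\sigma_d(L)$ is at least $\delta$. Let $P=-\frac1{2\pi i}\oint_\Gamma R_V(\lambda)\,d\lambda$, where $\Gamma$ consists of small positively oriented circles about the points of $\sigma_d(L)$, and put $\mathcal H_d=P\mathcal H$, $\mathcal H_c=(I-P)\mathcal H$. Let $\mathcal H_d^*$, $\mathcal H_c^*$ be the subspaces obtained in the same way from $L^*$ and its discrete spectrum. Then the boundary values (limits as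 $\varepsilon\downarrow0$ of the values at $k+i\varepsilon$) $AR_0(k+i0)\varphi$ and $BR_0^*(k+i0)\psi$ for $\varphi,\psi\in\mathcal H$, and $AR_V(k+i0)\varphi$ for $\varphi\in\mathcal H_c$, $BR_V^*(k+i0)\psi$ for $\psi\in\mathcal H_c^*$, exist for almost all $k\in\mathbb R$; the integrals below converge absolutely; and there are unique bounded operators $W$ and $Z$ in $\mathcal H$ such that $$(W\varphi,\psi)=(\varphi,\psi)-\frac1{2\pi i}\int_{\mathbb R}\big(AR_0(k+i0)\varphi,BR_V^*(k+i0)\psi\big)\,dk\qquad(\varphi\in\mathcal H,\ \psi\in\mathcal H_c^*),\tag{1}$$ $(W\varphi,\psi)=0$ for $\varphi\in\mathcal H$, $\psi\in\mathcal H_d^*$, and $$(Z\varphi,\psi)=(\varphi,\psi)+\frac1{2\pi i}\int_{\mathbb R}\big(AR_V(s+i0)\varphi,BR_0^*(s+i0)\psi\big)\,ds\qquad(\varphi\in\mathcal H_c,\ \psi\in\mathcal H),\tag{2}$$ $(Z\varphi,\psi)=0$ for $\varphi\in\mathcal H_d$, $\psi\in\mathcal H$. Moreover $ZW=I$ and $WZ=I-P$,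 where $P$ is a projection ($P^2=P$), $\ker Z=\mathcal H_d=P\mathcal H$ and $W\mathcal H=\mathcal H_c=(I-P)\mathcal H$. -/

import Mathlib

open MeasureTheory Filter Topology
open scoped NNReal ENNReal

noncomputable section

namespace KatoModel

section Abstract

variable {H : Type*} [NormedAddCommGroup H] [InnerProductSpace ℂ H] [CompleteSpace H]
variable {E : Type*} [NormedAddCommGroup E] [NormedSpace ℂ E]

/-- The bounded operator `R` is the inverse of `S - z` (as a map from the domain of `S` onto the
whole space). -/
def IsResolventAt (S : H →ₗ.[ℂ] H) (z : ℂ) (R : H →L[ℂ] H) : Prop :=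
  (∀ x : H, ∃ h : R x ∈ S.domain, S ⟨R x, h⟩ - z • R x = x) ∧
    ∀ x : S.domain, R (S x - z • (x : H)) = (x : H)

/-- The resolvent set of a (possibly unbounded) operator. -/
def opResolventSet (S : H →ₗ.[ℂ] H) : Set ℂ := {z | ∃ R : H →L[ℂ] H, IsResolventAt S z R}

/-- The spectrum of a (possibly unbounded) operator. -/
def opSpectrum (S : H →ₗ.[ℂ] H) : Set ℂ := (opResolventSet S)ᶜ

open Classical in
/-- The resolvent `(S - z)⁻¹`; it has the value `0` at the points of the spectrum. -/
def opResolvent (S : H →ₗ.[ℂ] H) (z : ℂ) : H →L[ℂ] H :=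
  if h : ∃ R : H →L[ℂ] H, IsResolventAt S z R then h.choose else 0

/-- `z` is an eigenvalue of `S`. -/
def IsEigenvalue (S : H →ₗ.[ℂ] H) (z : ℂ) : Prop :=
  ∃ x : S.domain, (x : H) ≠ 0 ∧ S x = z • (x : H)

/-- The continuous spectrum: the points `z` of the spectrum at which `S - z` is injective and has
dense range (so `z` belongs neither to the point spectrum nor to the residual spectrum). -/
def continuousSpectrum (S : H →ₗ.[ℂ] H) : Set ℂ :=
  {z | z ∈ opSpectrum S ∧ Function.Injective (fun x : S.domain => S x - z • (x : H)) ∧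
    DenseRange (fun x : S.domain => S x - z • (x : H))}

/-- The vectors `x` with `(S - z) ^ n x = 0` (all intermediate vectors being in the domain). -/
def rootVectors (S : H →ₗ.[ℂ] H) (z : ℂ) : ℕ → Submodule ℂ H
  | 0 => ⊥
  | n + 1 => ((rootVectors S z n).comap (S.toFun - z • S.domain.subtype)).map S.domain.subtype

/-- The root subspace of `S` at `z`: eigenvectors and associated vectors.  Its dimension is the
algebraic multiplicity. -/
def rootSubspace (S : H →ₗ.[ℂ] H) (z : ℂ) : Submodule ℂ H := ⨆ n, rootVectors S z n

/-- The Riesz projection at an isolated point `μ` of the spectrum,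
`-(2πi)⁻¹ ∮ (S - z)⁻¹ dz` over a small positively oriented circle about `μ`.  At an isolated point
of the spectrum the integral does not depend on the radius `r` once `r` is small. -/
def rieszAt (S : H →ₗ.[ℂ] H) (μ : ℂ) : H →L[ℂ] H :=
  limUnder (𝓝[>] (0 : ℝ))
    (fun r : ℝ => -((2 * (Real.pi : ℂ) * Complex.I)⁻¹ • ∮ z in C(μ, r), opResolvent S z))

/-- The discrete spectrum: isolated points of the spectrum of finite algebraic multiplicity. -/
def discreteSpectrum (S : H →ₗ.[ℂ] H) : Set ℂ :=
  {μ | μ ∈ opSpectrum S ∧ (∀ᶠ z in 𝓝[≠] μ, z ∈ opResolventSet S) ∧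
    FiniteDimensional ℂ (LinearMap.range (rieszAt S μ : H →ₗ[ℂ] H))}

/-- The component of the spectrum complementary to the discrete spectrum. -/
def complementarySpectrum (S : H →ₗ.[ℂ] H) : Set ℂ := opSpectrum S \ discreteSpectrum S

/-- The Riesz projection of the whole (finite) discrete spectrum: the contour consists of small
positively oriented circles about the points of the discrete spectrum. -/
def rieszProjection (S : H →ₗ.[ℂ] H) : H →L[ℂ] H :=
  ∑ᶠ μ ∈ discreteSpectrum S, rieszAt S μ

/-- The invariant subspace belonging to the discrete spectrum, the range of `P`. -/
def discreteSubspace (S : H →ₗ.[ℂ] H) : Submodule ℂ H :=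
  LinearMap.range (rieszProjection S : H →ₗ[ℂ] H)

/-- The invariant subspace belonging to the rest of the spectrum, the range of `1 - P`. -/
def continuousSubspace (S : H →ₗ.[ℂ] H) : Submodule ℂ H :=
  LinearMap.range ((1 - rieszProjection S : H →L[ℂ] H) : H →ₗ[ℂ] H)

/-- The Hardy class `H₂` of the upper half-plane. -/
def MemHardyUpper (F : ℂ → E) : Prop :=
  DifferentiableOn ℂ F {z | 0 < z.im} ∧
    ∃ C : ℝ≥0, ∀ ε : ℝ, 0 < ε →
      ∫⁻ k : ℝ, ‖F ((k : ℂ) + (ε : ℂ) * Complex.I)‖ₑ ^ 2 ≤ (C : ℝ≥0∞)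

/-- The Hardy class `H₂` of the lower half-plane. -/
def MemHardyLower (F : ℂ → E) : Prop :=
  DifferentiableOn ℂ F {z | z.im < 0} ∧
    ∃ C : ℝ≥0, ∀ ε : ℝ, 0 < ε →
      ∫⁻ k : ℝ, ‖F ((k : ℂ) - (ε : ℂ) * Complex.I)‖ₑ ^ 2 ≤ (C : ℝ≥0∞)

/-- The function `F` on the upper half-plane has a limit at the real point `k` along the vertical
ray. -/
def HasUpperLimit (F : ℂ → E) (k : ℝ) : Prop :=
  ∃ y : E, Tendsto (fun ε : ℝ => F ((k : ℂ) + (ε : ℂ) * Complex.I)) (𝓝[>] (0 : ℝ)) (𝓝 y)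

/-- The boundary value `F (k + i0)`, the limit of `F (k + iε)` as `ε ↓ 0`. -/
def upperLimit (F : ℂ → E) (k : ℝ) : E :=
  limUnder (𝓝[>] (0 : ℝ)) (fun ε : ℝ => F ((k : ℂ) + (ε : ℂ) * Complex.I))

end Abstract

section Model

variable {H : Type*} [NormedAddCommGroup H] [InnerProductSpace ℂ H] [CompleteSpace H]
variable {K : Type*} [NormedAddCommGroup K] [InnerProductSpace ℂ K] [CompleteSpace K]

/-- The bounded operator `A` is smooth relative to `S`. -/
def IsSmoothRel (A : H →L[ℂ] K) (S : H →ₗ.[ℂ] H) : Prop :=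
  ∀ φ : H, MemHardyUpper (fun z => A (opResolvent S z φ)) ∧
    MemHardyLower (fun z => A (opResolvent S z φ))

/-- The perturbed operator `T + B* A`, with the domain of `T`. -/
def perturbed (T : H →ₗ.[ℂ] H) (A B : H →L[ℂ] K) : H →ₗ.[ℂ] H :=
  (((ContinuousLinearMap.adjoint B).comp A : H →L[ℂ] H) : H →ₗ[ℂ] H) +ᵥ T

/-- The sandwiched resolvent `A (S - z)⁻¹ B*`. -/
def sandwich (S : H →ₗ.[ℂ] H) (A B : H →L[ℂ] K) (z : ℂ) : K →L[ℂ] K :=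
  A.comp ((opResolvent S z).comp (ContinuousLinearMap.adjoint B))

/-- The resolvent of `L` is meromorphic outside the spectrum of `T` (in particular it is defined in
a punctured neighbourhood of every point there), its poles are the eigenvalues of `L`, and the
multiplicity of a pole (the rank of the residue) is finite and is the algebraic multiplicity of
the eigenvalue. -/
def MeromorphicResolvent (T L : H →ₗ.[ℂ] H) : Prop :=
  MeromorphicOn (opResolvent L) (opSpectrum T)ᶜ ∧
    ∀ μ ∈ (opSpectrum T)ᶜ,
      (∀ᶠ z in 𝓝[≠] μ, z ∈ opResolventSet L) ∧
      (meromorphicOrderAt (opResolvent L) μ < 0 ↔ IsEigenvalue L μ) ∧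
      FiniteDimensional ℂ (LinearMap.range (rieszAt L μ : H →ₗ[ℂ] H)) ∧
      Module.finrank ℂ (LinearMap.range (rieszAt L μ : H →ₗ[ℂ] H)) =
        Module.finrank ℂ (rootSubspace L μ)

/-- The discrete spectrum of `L` is finite and the rest of its spectrum is the spectrum of `T`. -/
def FiniteDiscreteSpectrum (T L : H →ₗ.[ℂ] H) : Prop :=
  (discreteSpectrum L).Finite ∧ complementarySpectrum L = opSpectrum T

/-- `A (L - z)⁻¹ B*` is bounded on the non-real `z` that stay at distance at least `δ` from the
discrete spectrum of `L`, for every `δ > 0`. -/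
def BoundedAwayFromDiscrete (L : H →ₗ.[ℂ] H) (A B : H →L[ℂ] K) : Prop :=
  ∀ δ : ℝ, 0 < δ → ∃ C : ℝ, ∀ z : ℂ, z.im ≠ 0 → (∀ μ ∈ discreteSpectrum L, δ ≤ ‖z - μ‖) →
    ‖sandwich L A B z‖ ≤ C

/-- The integrand `(A R₀(k + i0) φ, B R_V*(k + i0) ψ)`, where `R_V*` is the resolvent of the adjoint
of `L`.  Mathlib's inner product is linear in its second argument, so the arguments are swapped. -/
def directIntegrand (T : H →ₗ.[ℂ] H) (A B : H →L[ℂ] K) (φ ψ : H) (k : ℝ) : ℂ :=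
  inner ℂ (upperLimit (fun z => B (opResolvent (perturbed T A B).adjoint z ψ)) k)
    (upperLimit (fun z => A (opResolvent T z φ)) k)

/-- The integrand `(A R_V(s + i0) φ, B R₀*(s + i0) ψ)`. -/
def inverseIntegrand (T : H →ₗ.[ℂ] H) (A B : H →L[ℂ] K) (φ ψ : H) (s : ℝ) : ℂ :=
  inner ℂ (upperLimit (fun z => B (opResolvent T.adjoint z ψ)) s)
    (upperLimit (fun z => A (opResolvent (perturbed T A B) z φ)) s)

/-- The ingredients of the form of the direct wave operator make sense: boundary values exist
almost everywhere and the integrand is integrable. -/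
def DirectFormWellDefined (T : H →ₗ.[ℂ] H) (A B : H →L[ℂ] K) : Prop :=
  (∀ φ : H, ∀ᵐ k : ℝ, HasUpperLimit (fun z => A (opResolvent T z φ)) k) ∧
  (∀ ψ ∈ continuousSubspace (perturbed T A B).adjoint,
    ∀ᵐ k : ℝ, HasUpperLimit (fun z => B (opResolvent (perturbed T A B).adjoint z ψ)) k) ∧
  ∀ φ : H, ∀ ψ ∈ continuousSubspace (perturbed T A B).adjoint,
    Integrable (directIntegrand T A B φ ψ)

/-- The ingredients of the form of the inverse wave operator make sense. -/
def InverseFormWellDefined (T : H →ₗ.[ℂ] H) (A B : H →L[ℂ] K) : Prop :=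
  (∀ φ ∈ continuousSubspace (perturbed T A B),
    ∀ᵐ s : ℝ, HasUpperLimit (fun z => A (opResolvent (perturbed T A B) z φ)) s) ∧
  (∀ ψ : H, ∀ᵐ s : ℝ, HasUpperLimit (fun z => B (opResolvent T.adjoint z ψ)) s) ∧
  ∀ φ ∈ continuousSubspace (perturbed T A B), ∀ ψ : H,
    Integrable (inverseIntegrand T A B φ ψ)

/-- `W` is the bounded operator with the form of the direct stationary wave operator. -/
def IsDirectWaveOperator (T : H →ₗ.[ℂ] H) (A B : H →L[ℂ] K) (W : H →L[ℂ] H) : Prop :=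
  (∀ φ : H, ∀ ψ ∈ continuousSubspace (perturbed T A B).adjoint,
    inner ℂ ψ (W φ) = inner ℂ ψ φ -
      1 / (2 * (Real.pi : ℂ) * Complex.I) * ∫ k : ℝ, directIntegrand T A B φ ψ k) ∧
  ∀ φ : H, ∀ ψ ∈ discreteSubspace (perturbed T A B).adjoint, inner ℂ ψ (W φ) = 0

/-- `Z` is the bounded operator with the form of the inverse stationary wave operator. -/
def IsInverseWaveOperator (T : H →ₗ.[ℂ] H) (A B : H →L[ℂ] K) (Z : H →L[ℂ] H) : Prop :=
  (∀ φ ∈ continuousSubspace (perturbed T A B), ∀ ψ : H,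
    inner ℂ ψ (Z φ) = inner ℂ ψ φ +
      1 / (2 * (Real.pi : ℂ) * Complex.I) * ∫ s : ℝ, inverseIntegrand T A B φ ψ s) ∧
  ∀ φ ∈ discreteSubspace (perturbed T A B), ∀ ψ : H, inner ℂ ψ (Z φ) = 0

end Model

end KatoModel

end

/-! A function of class H₂ in the upper half-plane has a boundary function in L²(ℝ) whose Cauchy
integral reproduces it above the axis and vanishes below (`MemHardyUpper.exists_boundary`). By the
closed graph theorem φ ↦ AR₀(k+i0)φ is therefore a bounded operator from H to L²(ℝ; K). The
integrals in (1) and (2) are inner products in L², and W, Z have the form J − (2πi)⁻¹Ψ*Φ with J = 1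
− P.

For L, the resolvent is replaced by its regular part (1 − P)R_V, which continues analytically
through the discrete spectrum and still satisfies the resolvent identity. Since AR_V = (1 − Q_V)AR₀,
smoothness passes from T to L away from the discrete spectrum; near it the regular part is bounded
(`isHardyFamily_regular`).

Products are computed by a chain rule, `waveOperator_comp`. If JR₁ − R₂J = R₂X*YR₁ and J'R₂ − R₃J' =
R₃X'*Y'R₂, then J'J intertwines R₁ and R₃ with perturbation J'X*Y + X'*Y'J, and the product of the
two wave operators is the wave operator of this composite. Let Q = Y'R₂X*, let Ω be the first wave
operator and let g be a weak limit of Q(k − iε)Φ₁φ, which exists because Q is bounded. The resolvent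
identity shows that Φ₂Ωφ and Y'JR₁(k+i0)φ − g have the same Cauchy integral above the axis. Their
difference is thus orthogonal to all Hardy boundary functions
(`IsHardyBoundary.integral_inner_eq_zero`), while the pairing of g with a boundary function is
evaluated by the second intertwining relation.

In WZ the correction terms cancel and J'J = 1 − P remains. In ZW they leave an operator which has to
be P. This says that the wave operator of T relative to itself with identification P vanishes
(`boundary_commutator`). It holds because PR₀ is itself of Hardy class: PR₀ = PR_V + PR_V V R₀, and
PR_V decays like 1/|z| away from the discrete spectrum (`isHardyFamily_projection_free`). -/

noncomputable section

namespace KatoModel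

/-! ### Cauchy's theorem in a half-plane -/

section LineIntegrals

variable {E : Type*} [NormedAddCommGroup E] [NormedSpace ℂ E]

theorem enorm_intervalIntegral_le {f : ℝ → E} {a b : ℝ} (h : a ≤ b) :
    ‖∫ x in a..b, f x‖ₑ ≤ ∫⁻ x in Set.Ioc a b, ‖f x‖ₑ := by
  rw [intervalIntegral.integral_of_le h]
  exact enorm_integral_le_lintegral_enorm _

/-- An averaging argument: if all distant pairs of vertical sides were larger than δ, integrating
over their position would give ∞, whereas Tonelli bounds the double integral by 2BM. No pointwise
decay is needed, and the bound for |s| ≥ R₀ alone leaves room for a singular kernel over a bounded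
set of s. -/
theorem exists_vertical_small {G : ℝ → ℝ → ℝ≥0∞} (hG : Continuous (Function.uncurry G))
    {R₀ : ℝ} {B : ℝ≥0} (hB : ∀ y, ∫⁻ s in {s : ℝ | R₀ ≤ |s|}, G s y ≤ B) (M R₁ : ℝ)
    {δ : ℝ≥0∞} (hδ : δ ≠ 0) :
    ∃ R, R₁ ≤ R ∧ ∫⁻ y in Set.Ioc 0 M, (G R y + G (-R) y) ≤ δ := by
  by_contra! hcon
  set S := max R₁ (max R₀ 0)
  have hmeas : Measurable (Function.uncurry G) := hG.measurable
  have hmeas' : Measurable (fun p : ℝ × ℝ => G (-p.1) p.2) := by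
    exact hmeas.comp (by fun_prop : Measurable fun p : ℝ × ℝ => (-p.1, p.2))
  have h1 : ∫⁻ R in Set.Ici S, ∫⁻ y in Set.Ioc 0 M, (G R y + G (-R) y) =
      ∫⁻ y in Set.Ioc 0 M, ∫⁻ R in Set.Ici S, (G R y + G (-R) y) :=
    lintegral_lintegral_swap ((hmeas.add hmeas').aemeasurable)
  have h2 : ∀ y, ∫⁻ R in Set.Ici S, (G R y + G (-R) y) ≤ B + B := by
    intro y
    have hm : Measurable (fun s => G s y) := hmeas.comp (by fun_prop : Measurable fun s : ℝ => (s, y))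
    rw [lintegral_add_left hm]
    gcongr
    · refine le_trans (lintegral_mono_set ?_) (hB y)
      intro s hs
      have : S ≤ s := hs
      simp only [Set.mem_ofPred_eq]
      exact ((le_max_left _ _).trans (le_max_right _ _)).trans (this.trans (le_abs_self s))
    · have : ∫⁻ R in Set.Ici S, G (-R) y = ∫⁻ R in Set.Iic (-S), G R y := by
        rw [← (Measure.measurePreserving_neg (volume : Measure ℝ)).setLIntegral_comp_preimage
          measurableSet_Iic hm]
        congr 2
        ext x
        simp
      rw [this]
      refine le_trans (lintegral_mono_set ?_) (hB y)
      intro s hs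
      have hs' : s ≤ -S := hs
      simp only [Set.mem_ofPred_eq]
      have : R₀ ≤ S := (le_max_left _ _).trans (le_max_right _ _)
      have := neg_le_abs s
      linarith
  have h3 : ∫⁻ R in Set.Ici S, ∫⁻ y in Set.Ioc 0 M, (G R y + G (-R) y) = ∞ := by
    refine top_le_iff.1 ?_
    calc (∞ : ℝ≥0∞) = ∫⁻ R in Set.Ici S, δ := by
          simp [hδ]
      _ ≤ _ := by
          refine setLIntegral_mono' measurableSet_Ici fun R hR => ?_
          exact (hcon R ((le_max_left _ _).trans hR)).le
  have h4 : ∫⁻ y in Set.Ioc 0 M, ∫⁻ R in Set.Ici S, (G R y + G (-R) y) ≤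
      ∫⁻ y in Set.Ioc 0 M, ((B : ℝ≥0∞) + B) := lintegral_mono fun y => h2 y
  rw [← h1, h3] at h4
  have h5 : ∫⁻ y in Set.Ioc 0 M, ((B : ℝ≥0∞) + B) < ∞ := by
    simp only [lintegral_const, Measure.restrict_apply_univ, Real.volume_Ioc]
    exact ENNReal.mul_lt_top (by simp) (by simp)
  exact absurd h4 (not_le.2 h5)

/-- Cauchy's theorem for a function analytic in the upper half-plane whose integrals over
horizontal lines are controlled. -/
theorem integral_line_eq_zero [CompleteSpace E] {G : ℂ → E} (hc : ContinuousOn G {z | 0 ≤ z.im})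
    (hd : DifferentiableOn ℂ G {z | 0 < z.im}) (hint : Integrable (fun s : ℝ => G s))
    {R₀ : ℝ} {B : ℝ≥0}
    (hB : ∀ y : ℝ, 0 ≤ y → ∫⁻ s in {s : ℝ | R₀ ≤ |s|}, ‖G (s + y * Complex.I)‖ₑ ≤ B)
    (htop : Tendsto (fun y : ℝ => ∫⁻ s : ℝ, ‖G (s + y * Complex.I)‖ₑ) atTop (𝓝 0)) :
    ∫ s : ℝ, G s = 0 := by
  rw [← enorm_eq_zero]
  refine le_antisymm (le_of_forall_pos_le_add fun δ hδ => ?_) zero_le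
  -- Four errors share δ: the tail of the integral over the real line, the top side of the rectangle
  -- and its two vertical sides.
  have hδ2 : 0 < δ / 4 := by
    refine ENNReal.div_pos hδ.ne' (by simp)
  obtain ⟨M, hM, hM0⟩ := ((htop.eventually (gt_mem_nhds hδ2)).and (eventually_ge_atTop 0)).exists
  have hlim : Tendsto (fun R : ℝ => ∫ s in (-R)..R, G s) atTop (𝓝 (∫ s : ℝ, G s)) :=
    intervalIntegral_tendsto_integral hint tendsto_neg_atTop_atBot tendsto_id
  have hlim2 : Tendsto (fun R : ℝ => ‖(∫ s : ℝ, G s) - ∫ s in (-R)..R, G s‖ₑ) atTop (𝓝 0) := by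
    have := (tendsto_const_nhds (x := ∫ s : ℝ, G s)).sub hlim
    simpa using this.enorm
  obtain ⟨R₁, hR₁⟩ := eventually_atTop.1 (hlim2.eventually (gt_mem_nhds hδ2))
  -- Replacing y by max y 0 extends the function continuously below the axis, where G is not
  -- controlled.
  have hcont : Continuous (Function.uncurry fun s y : ℝ =>
      ‖G (s + (max y 0 : ℝ) * Complex.I)‖ₑ) := by
    refine continuous_enorm.comp (hc.comp_continuous (by fun_prop) ?_)
    rintro ⟨s, y⟩
    simp
  obtain ⟨R, hR, hRv⟩ := exists_vertical_small hcont (R₀ := R₀) (B := B)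
    (fun y => hB _ (le_max_right _ _)) M (max R₁ 0) hδ2.ne'
  have hR0 : 0 ≤ R := (le_max_right _ _).trans hR
  have hrect := Complex.integral_boundary_rect_eq_zero_of_continuousOn_of_differentiableOn G
    (-R : ℂ) ((R : ℂ) + M * Complex.I) (hc.mono ?_) (hd.mono ?_)
  rotate_left
  · intro z hz
    have := hz.2
    simp [hM0] at this
    exact this.1
  · intro z hz
    have := hz.2
    simp [hM0] at this
    exact this.1
  simp only [Complex.neg_re, Complex.ofReal_re, Complex.neg_im, Complex.ofReal_im, neg_zero,
    Complex.add_re, Complex.mul_re, Complex.I_re, mul_zero, Complex.I_im, mul_one, sub_self,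
    add_zero, Complex.add_im, Complex.mul_im, zero_add, Complex.ofReal_zero, zero_mul] at hrect
  have hkey : ∫ x in (-R)..R, G x = (∫ x in (-R)..R, G (x + M * Complex.I)) -
      Complex.I • (∫ y in (0:ℝ)..M, G (R + y * Complex.I)) +
      Complex.I • ∫ y in (0:ℝ)..M, G ((-R : ℝ) + y * Complex.I) := by
    have h := sub_eq_zero.1 hrect
    rw [← h]; abel
  have hv : ∀ r : ℝ, ∫⁻ y in Set.Ioc 0 M, ‖G (r + y * Complex.I)‖ₑ =
      ∫⁻ y in Set.Ioc 0 M, ‖G (r + (max y 0 : ℝ) * Complex.I)‖ₑ := by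
    intro r
    refine setLIntegral_congr_fun measurableSet_Ioc fun y hy => ?_
    simp only [max_eq_left hy.1.le]
  have hb1 : ‖∫ y in (0:ℝ)..M, G (R + y * Complex.I)‖ₑ ≤ δ / 4 := by
    refine (enorm_intervalIntegral_le hM0).trans ?_
    rw [hv]
    exact (lintegral_mono fun y => le_self_add).trans hRv
  have hb2 : ‖∫ y in (0:ℝ)..M, G ((-R : ℝ) + y * Complex.I)‖ₑ ≤ δ / 4 := by
    refine (enorm_intervalIntegral_le hM0).trans ?_
    rw [hv]
    exact (lintegral_mono fun y => le_add_self).trans hRv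
  have hb3 : ‖∫ x in (-R)..R, G (x + M * Complex.I)‖ₑ ≤ δ / 4 := by
    refine (enorm_intervalIntegral_le (by linarith)).trans ?_
    exact (setLIntegral_le_lintegral _ _).trans hM.le
  have hb4 := (hR₁ R ((le_max_left _ _).trans hR)).le
  have hI : ∀ v : E, ‖Complex.I • v‖ₑ = ‖v‖ₑ := by
    intro v
    rw [enorm_smul]; simp [enorm_eq_nnnorm]
  calc ‖∫ s : ℝ, G s‖ₑ = ‖((∫ s : ℝ, G s) - ∫ s in (-R)..R, G s) +
        ((∫ x in (-R)..R, G (x + M * Complex.I)) -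
      Complex.I • (∫ y in (0:ℝ)..M, G (R + y * Complex.I)) +
      Complex.I • ∫ y in (0:ℝ)..M, G ((-R : ℝ) + y * Complex.I))‖ₑ := by
        rw [← hkey]; simp
    _ ≤ δ / 4 + ((δ / 4 + δ / 4) + δ / 4) := by
        refine (enorm_add_le _ _).trans (add_le_add hb4 ?_)
        refine (enorm_add_le _ _).trans (add_le_add ?_ ?_)
        · refine enorm_sub_le.trans (add_le_add hb3 ?_)
          rw [hI]; exact hb1
        · rw [hI]; exact hb2
    _ = 0 + δ := by
        rw [zero_add]
        have : (4 : ℝ≥0∞) ≠ 0 := by norm_num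
        rw [show δ / 4 + ((δ / 4 + δ / 4) + δ / 4) = 4 * (δ / 4) by ring]
        exact ENNReal.mul_div_cancel this (by simp)

end LineIntegrals

/-! ### L² estimates for the Cauchy kernel -/

section CauchyKernel

theorem ofReal_sub_ne_zero {z : ℂ} (hz : z.im ≠ 0) (s : ℝ) : (s : ℂ) - z ≠ 0 := by
  intro h
  apply hz
  rw [← sub_eq_zero.1 h]
  simp

theorem norm_kernel_sq (z : ℂ) (s : ℝ) :
    ‖((s : ℂ) - z)⁻¹‖ ^ 2 = ((s - z.re) ^ 2 + z.im ^ 2)⁻¹ := by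
  rw [norm_inv, inv_pow, Complex.sq_norm, Complex.normSq_apply]
  simp [sq]

theorem norm_kernel_sq' {z : ℂ} (hz : z.im ≠ 0) (s : ℝ) :
    ‖((s : ℂ) - z)⁻¹‖ ^ 2 = (z.im ^ 2)⁻¹ * (1 + ((s - z.re) / z.im) ^ 2)⁻¹ := by
  rw [norm_kernel_sq, ← mul_inv]
  congr 1
  field_simp
  ring

theorem integrable_kernel_sq {z : ℂ} (hz : z.im ≠ 0) :
    Integrable (fun s : ℝ => ‖((s : ℂ) - z)⁻¹‖ ^ 2) := by
  simp_rw [norm_kernel_sq' hz]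
  exact ((integrable_inv_one_add_sq.comp_div hz).comp_sub_right z.re).const_mul _

theorem integral_kernel_sq {z : ℂ} (hz : z.im ≠ 0) :
    ∫ s : ℝ, ‖((s : ℂ) - z)⁻¹‖ ^ 2 = Real.pi / |z.im| := by
  simp_rw [norm_kernel_sq' hz]
  rw [integral_const_mul, integral_sub_right_eq_self (fun s => (1 + (s / z.im) ^ 2)⁻¹) z.re,
    Measure.integral_comp_div (fun s => (1 + s ^ 2)⁻¹), integral_univ_inv_one_add_sq, smul_eq_mul,
    ← sq_abs z.im]
  have : |z.im| ≠ 0 := abs_ne_zero.2 hz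
  field_simp

theorem continuous_kernel {z : ℂ} (hz : z.im ≠ 0) : Continuous fun s : ℝ => ((s : ℂ) - z)⁻¹ :=
  (by fun_prop : Continuous fun s : ℝ => (s : ℂ) - z).inv₀ (ofReal_sub_ne_zero hz)

theorem memLp_kernel {z : ℂ} (hz : z.im ≠ 0) :
    MemLp (fun s : ℝ => ((s : ℂ) - z)⁻¹) 2 volume :=
  (memLp_two_iff_integrable_sq_norm (continuous_kernel hz).aestronglyMeasurable).2
    (integrable_kernel_sq hz)

theorem lintegral_kernel_sq {z : ℂ} (hz : z.im ≠ 0) :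
    ∫⁻ s : ℝ, ‖((s : ℂ) - z)⁻¹‖ₑ ^ 2 = ENNReal.ofReal (Real.pi / |z.im|) := by
  rw [← integral_kernel_sq hz, ofReal_integral_eq_lintegral_ofReal (integrable_kernel_sq hz)
    (ae_of_all _ fun s => by positivity)]
  refine lintegral_congr fun s => ?_
  rw [ENNReal.ofReal_pow (norm_nonneg _), ofReal_norm]

theorem norm_kernel_le {z : ℂ} (hz : z.im ≠ 0) (s : ℝ) : ‖((s : ℂ) - z)⁻¹‖ ≤ |z.im|⁻¹ := by
  rw [norm_inv]
  refine inv_anti₀ (abs_pos.2 hz) ?_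
  have := Complex.abs_im_le_norm ((s : ℂ) - z)
  simpa using this

theorem conj_kernel (z : ℂ) (s : ℝ) :
    (starRingEnd ℂ) (((s : ℂ) - z)⁻¹) = ((s : ℂ) - (starRingEnd ℂ) z)⁻¹ := by
  simp

theorem kernel_mul_conj (z : ℂ) (s : ℝ) :
    ((s : ℂ) - (starRingEnd ℂ) z)⁻¹ * ((s : ℂ) - z)⁻¹ = ((‖((s : ℂ) - z)⁻¹‖ ^ 2 : ℝ) : ℂ) := by
  rw [← conj_kernel, ← Complex.normSq_eq_conj_mul_self, Complex.normSq_eq_norm_sq]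

/-- The product of the conjugate kernels is a multiple of the Poisson kernel. This evaluation plays
the role of the residue in the Cauchy formula. -/
theorem integral_kernel_mul_conj {z : ℂ} (hz : 0 < z.im) :
    (z - (starRingEnd ℂ) z) * ∫ s : ℝ, ((s : ℂ) - (starRingEnd ℂ) z)⁻¹ * ((s : ℂ) - z)⁻¹ =
      2 * Real.pi * Complex.I := by
  simp_rw [kernel_mul_conj]
  rw [integral_complex_ofReal, integral_kernel_sq hz.ne', abs_of_pos hz, Complex.sub_conj]
  have : (z.im : ℂ) ≠ 0 := by exact_mod_cast hz.ne'
  push_cast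
  field_simp

theorem lintegral_enorm_smul_le {α E : Type*} [NormedAddCommGroup E] [NormedSpace ℂ E]
    [MeasurableSpace α] {μ : Measure α} {a : α → ℂ} {f : α → E}
    (ha : AEStronglyMeasurable a μ) (hf : AEStronglyMeasurable f μ) :
    ∫⁻ s, ‖a s • f s‖ₑ ∂μ ≤
      (∫⁻ s, ‖a s‖ₑ ^ 2 ∂μ) ^ (1 / 2 : ℝ) * (∫⁻ s, ‖f s‖ₑ ^ 2 ∂μ) ^ (1 / 2 : ℝ) := by
  have := ENNReal.lintegral_mul_le_Lp_mul_Lq μ Real.HolderConjugate.two_two ha.enorm hf.enorm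
  simpa [enorm_smul, ENNReal.rpow_two] using this

theorem lintegral_enorm_add_sq_le {α E : Type*} [NormedAddCommGroup E] [MeasurableSpace α] {μ : Measure α} {f g : α → E}
    (hf : AEStronglyMeasurable f μ) :
    ∫⁻ s, ‖f s + g s‖ₑ ^ 2 ∂μ ≤ 2 * ∫⁻ s, ‖f s‖ₑ ^ 2 ∂μ + 2 * ∫⁻ s, ‖g s‖ₑ ^ 2 ∂μ := by
  rw [← lintegral_const_mul' _ _ (by simp), ← lintegral_const_mul' _ _ (by simp),
    ← lintegral_add_left' ((hf.enorm.pow_const 2).const_mul 2)]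
  refine lintegral_mono fun s => ?_
  calc ‖f s + g s‖ₑ ^ 2 ≤ (‖f s‖ₑ + ‖g s‖ₑ) ^ 2 := by gcongr; exact enorm_add_le _ _
    _ ≤ _ := by
      have := ENNReal.rpow_add_le_mul_rpow_add_rpow ‖f s‖ₑ ‖g s‖ₑ (p := 2) (by norm_num)
      norm_num at this
      simpa [mul_add, ENNReal.rpow_two] using this

end CauchyKernel

/-! ### Cauchy's formula for functions bounded in L² on horizontal lines -/

section CauchyFormula

variable {E : Type*} [NormedAddCommGroup E] [NormedSpace ℂ E]

/-- By Cauchy–Schwarz: on the line at height y the kernel has L² norm (π/|Im z − y|)^(1/2), which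
tends to zero, while F stays bounded in L². -/
theorem tendsto_lintegral_kernel_smul {F : ℂ → E} (hc : ContinuousOn F {z | 0 ≤ z.im}) {C : ℝ≥0}
    (hL : ∀ y : ℝ, 0 ≤ y → ∫⁻ s : ℝ, ‖F (s + y * Complex.I)‖ₑ ^ 2 ≤ C) (z : ℂ) :
    Tendsto (fun y : ℝ => ∫⁻ s : ℝ, ‖((s : ℂ) + y * Complex.I - z)⁻¹ • F (s + y * Complex.I)‖ₑ)
      atTop (𝓝 0) := by
  have hb : Tendsto (fun y : ℝ => ENNReal.ofReal (Real.pi / |z.im - y|) ^ (1 / 2 : ℝ) *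
      (C : ℝ≥0∞) ^ (1 / 2 : ℝ)) atTop (𝓝 0) := by
    have h1 : Tendsto (fun y : ℝ => Real.pi / |z.im - y|) atTop (𝓝 0) := by
      refine Tendsto.div_atTop tendsto_const_nhds ?_
      refine tendsto_abs_atBot_atTop.comp ?_
      exact tendsto_atBot_add_const_left _ _ tendsto_neg_atTop_atBot
    have h2 := (ENNReal.tendsto_ofReal h1)
    have h3 := (ENNReal.continuous_rpow_const (y := (1 / 2 : ℝ))).tendsto 0
    rw [ENNReal.ofReal_zero] at h2
    have h4 := ENNReal.Tendsto.mul_const (b := (C : ℝ≥0∞) ^ (1 / 2 : ℝ)) (h3.comp h2)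
      (Or.inr (ENNReal.rpow_ne_top_of_nonneg (by norm_num) (by simp)))
    simpa using h4
  refine tendsto_of_tendsto_of_tendsto_of_le_of_le' tendsto_const_nhds hb
    (Eventually.of_forall fun _ => zero_le) ?_
  filter_upwards [eventually_ge_atTop 0, eventually_gt_atTop z.im] with y hy0 hy
  have him : (z - y * Complex.I).im ≠ 0 := by simp [sub_eq_zero]; linarith
  have heq : ∀ s : ℝ, (s : ℂ) + y * Complex.I - z = s - (z - y * Complex.I) := fun s => by ring
  simp_rw [heq]
  refine (lintegral_enorm_smul_le (continuous_kernel him).aestronglyMeasurable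
    (hc.comp_continuous (by fun_prop) (by simp [hy0])).aestronglyMeasurable).trans ?_
  rw [lintegral_kernel_sq him]
  have him' : (z - y * Complex.I).im = z.im - y := by simp
  rw [him']
  exact mul_le_mul_right (ENNReal.rpow_le_rpow (hL y hy0) (by norm_num)) _

/-- For z below the axis the kernel is analytic in the closed upper half-plane, and every line at
height y ≥ 0 stays at distance at least |Im z| from z, so Cauchy–Schwarz gives uniform L¹ bounds. -/
theorem integral_kernel_smul_eq_zero [CompleteSpace E] {F : ℂ → E}
    (hc : ContinuousOn F {z | 0 ≤ z.im})
    (hd : DifferentiableOn ℂ F {z | 0 < z.im}) {C : ℝ≥0}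
    (hL : ∀ y : ℝ, 0 ≤ y → ∫⁻ s : ℝ, ‖F (s + y * Complex.I)‖ₑ ^ 2 ≤ C) {z : ℂ} (hz : z.im < 0) :
    ∫ s : ℝ, ((s : ℂ) - z)⁻¹ • F s = 0 := by
  have hbd : ∀ y : ℝ, 0 ≤ y →
      ∫⁻ s : ℝ, ‖((s : ℂ) + y * Complex.I - z)⁻¹ • F (s + y * Complex.I)‖ₑ ≤
        ENNReal.ofReal (Real.pi / |z.im|) ^ (1 / 2 : ℝ) * (C : ℝ≥0∞) ^ (1 / 2 : ℝ) := by
    intro y hy0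
    have him : (z - y * Complex.I).im < 0 := by simp; linarith
    have heq : ∀ s : ℝ, (s : ℂ) + y * Complex.I - z = s - (z - y * Complex.I) := fun s => by ring
    simp_rw [heq]
    refine (lintegral_enorm_smul_le (continuous_kernel him.ne).aestronglyMeasurable
      (hc.comp_continuous (by fun_prop) (by simp [hy0])).aestronglyMeasurable).trans ?_
    rw [lintegral_kernel_sq him.ne]
    gcongr ENNReal.ofReal ?_ ^ _ * ?_ ^ _
    · refine div_le_div_of_nonneg_left Real.pi_pos.le (abs_pos.2 hz.ne) ?_
      rw [abs_of_neg hz, abs_of_neg him]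
      simp [hy0]
    · exact hL y hy0
  have hfin : ENNReal.ofReal (Real.pi / |z.im|) ^ (1 / 2 : ℝ) * (C : ℝ≥0∞) ^ (1 / 2 : ℝ) ≠ ∞ :=
    ENNReal.mul_ne_top (ENNReal.rpow_ne_top_of_nonneg (by norm_num) (by simp))
      (ENNReal.rpow_ne_top_of_nonneg (by norm_num) (by simp))
  have hne : ∀ w : ℂ, 0 ≤ w.im → w - z ≠ 0 := by
    intro w hw h
    rw [sub_eq_zero.1 h] at hw
    linarith
  have hGc : ContinuousOn (fun w => (w - z)⁻¹ • F w) {w | 0 ≤ w.im} :=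
    ContinuousOn.smul (ContinuousOn.inv₀ (by fun_prop) fun w hw => hne w hw) hc
  refine integral_line_eq_zero (G := fun w => (w - z)⁻¹ • F w) hGc ?_ ⟨?_, ?_⟩ (R₀ := 0)
    (B := (ENNReal.ofReal (Real.pi / |z.im|) ^ (1 / 2 : ℝ) * (C : ℝ≥0∞) ^ (1 / 2 : ℝ)).toNNReal)
    ?_ (tendsto_lintegral_kernel_smul hc hL z)
  · exact DifferentiableOn.smul (DifferentiableOn.inv (by fun_prop) fun w hw =>
      hne w (le_of_lt hw)) hd
  · exact (hGc.comp_continuous (by fun_prop) (by simp)).aestronglyMeasurable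
  · have := hbd 0 le_rfl
    simp only [Complex.ofReal_zero, zero_mul, add_zero] at this
    exact this.trans_lt hfin.lt_top
  · intro y hy
    rw [ENNReal.coe_toNNReal hfin]
    exact (setLIntegral_le_lintegral _ _).trans (hbd y hy)

/-- Subtract from F the multiple of (w − z̄)⁻¹ that takes the same value at z. The singularity of
the Cauchy kernel becomes removable, so the integral of the difference is zero without a contour
around z; the subtracted term is integrated explicitly by `integral_kernel_mul_conj`. -/
theorem integral_kernel_smul_eq [CompleteSpace E] {F : ℂ → E} {η : ℝ} (hη : 0 < η)
    (hd : DifferentiableOn ℂ F {z | -η < z.im}) {C : ℝ≥0}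
    (hL : ∀ y : ℝ, 0 ≤ y → ∫⁻ s : ℝ, ‖F (s + y * Complex.I)‖ₑ ^ 2 ≤ C) {z : ℂ} (hz : 0 < z.im) :
    ∫ s : ℝ, ((s : ℂ) - z)⁻¹ • F s = (2 * Real.pi * Complex.I : ℂ) • F z := by
  set zc := (starRingEnd ℂ) z with hzc
  have hzcim : zc.im < 0 := by simp [hzc, hz]
  have hsub : {w : ℂ | 0 ≤ w.im} ⊆ {w : ℂ | -η < w.im} := fun w hw => by
    simp only [Set.mem_ofPred_eq] at *; linarith
  set v := (z - zc) • F z with hv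
  set Φ : ℂ → E := fun w => F w - (w - zc)⁻¹ • v with hΦ
  have hΦz : Φ z = 0 := by
    have : z - zc ≠ 0 := by
      intro h
      rw [← sub_eq_zero.1 h] at hzcim
      linarith
    simp [hΦ, hv, smul_smul, inv_mul_cancel₀ this]
  set U : Set ℂ := {w | max (-η) zc.im < w.im} with hU
  have hUo : IsOpen U := isOpen_lt continuous_const Complex.continuous_im
  have h0U : {w : ℂ | 0 ≤ w.im} ⊆ U := fun w hw => by
    simp only [hU, Set.mem_ofPred_eq] at *
    exact max_lt (by linarith) (by linarith)
  have hΦd : DifferentiableOn ℂ Φ U := by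
    refine DifferentiableOn.sub (hd.mono fun w hw => lt_of_le_of_lt (le_max_left _ _) (Set.mem_ofPred_eq ▸ hw)) ?_
    refine DifferentiableOn.smul_const (DifferentiableOn.inv (by fun_prop) ?_) _
    intro w hw h
    have : zc.im < w.im := (le_max_right _ _).trans_lt hw
    rw [sub_eq_zero.1 h] at this
    exact lt_irrefl _ this
  have hΦc : ContinuousOn Φ {w | 0 ≤ w.im} := hΦd.continuousOn.mono h0U
  have hΦL : ∃ C' : ℝ≥0, ∀ y : ℝ, 0 ≤ y → ∫⁻ s : ℝ, ‖Φ (s + y * Complex.I)‖ₑ ^ 2 ≤ C' := by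
    refine ⟨(2 * (C : ℝ≥0∞) + 2 * (ENNReal.ofReal (Real.pi / |zc.im|) * ‖v‖ₑ ^ 2)).toNNReal, ?_⟩
    intro y hy
    have hfin : ∀ a : ℝ, 2 * (C : ℝ≥0∞) + 2 * (ENNReal.ofReal a * ‖v‖ₑ ^ 2) ≠ ∞ := fun a => by
      finiteness
    rw [ENNReal.coe_toNNReal (hfin _)]
    have him : (zc - y * Complex.I).im < 0 := by
      have : (zc - y * Complex.I).im = zc.im - y := by simp
      rw [this]; linarith
    simp only [hΦ, sub_eq_add_neg (F _)]
    refine (lintegral_enorm_add_sq_le ?_).trans ?_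
    · exact ((hd.continuousOn.mono hsub).comp_continuous (by fun_prop)
        (by simp [hy])).aestronglyMeasurable
    gcongr 2 * ?_ + 2 * ?_
    · exact hL y hy
    have : ∀ s : ℝ, ‖-((s + y * Complex.I - zc)⁻¹ • v)‖ₑ ^ 2 =
        ‖((s : ℂ) - (zc - y * Complex.I))⁻¹‖ₑ ^ 2 * ‖v‖ₑ ^ 2 := fun s => by
      rw [enorm_neg, enorm_smul, mul_pow]
      congr 4
      ring
    simp_rw [this]
    rw [lintegral_mul_const' _ _ (by finiteness), lintegral_kernel_sq him.ne]
    gcongr ENNReal.ofReal ?_ * _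
    refine div_le_div_of_nonneg_left Real.pi_pos.le (abs_pos.2 hzcim.ne) ?_
    rw [abs_of_neg hzcim, abs_of_neg him]
    simp [hy]
  obtain ⟨C', hΦL⟩ := hΦL
  -- Since Φ vanishes at z, the divided difference is Φ(w)/(w − z) with the removable singularity
  -- filled in.
  set G := dslope Φ z with hG
  have hGd : DifferentiableOn ℂ G U :=
    (Complex.differentiableOn_dslope (hUo.mem_nhds (h0U hz.le))).2 hΦd
  have hGv : ∀ w, w ≠ z → G w = (w - z)⁻¹ • Φ w := fun w hw => by
    rw [hG, dslope_of_ne _ hw, slope_def_module, hΦz, sub_zero]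
  have hGc : ContinuousOn G {w | 0 ≤ w.im} := hGd.continuousOn.mono h0U
  have hGreal : ∀ s : ℝ, G s = ((s : ℂ) - z)⁻¹ • Φ s := fun s =>
    hGv _ (sub_ne_zero.1 (ofReal_sub_ne_zero hz.ne' s))
  have hΦ0 : MemLp (fun s : ℝ => Φ s) 2 volume := by
    refine ⟨(hΦc.comp_continuous (by fun_prop) (by simp)).aestronglyMeasurable, ?_⟩
    rw [eLpNorm_lt_top_iff_lintegral_rpow_enorm_lt_top (by simp) (by simp)]
    have := hΦL 0 le_rfl
    simp only [Complex.ofReal_zero, zero_mul, add_zero] at this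
    simpa [ENNReal.rpow_two] using this.trans_lt (by simp)
  have hF0 : MemLp (fun s : ℝ => F s) 2 volume := by
    refine ⟨((hd.continuousOn.mono hsub).comp_continuous (by fun_prop)
      (by simp)).aestronglyMeasurable, ?_⟩
    rw [eLpNorm_lt_top_iff_lintegral_rpow_enorm_lt_top (by simp) (by simp)]
    have := hL 0 le_rfl
    simp only [Complex.ofReal_zero, zero_mul, add_zero] at this
    simpa [ENNReal.rpow_two] using this.trans_lt (by simp)
  have hint : Integrable (fun s : ℝ => ((s : ℂ) - z)⁻¹ • F s) :=
    memLp_one_iff_integrable.1 (hF0.smul (memLp_kernel hz.ne'))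
  have hint2 : Integrable (fun s : ℝ => (((s : ℂ) - zc)⁻¹ * ((s : ℂ) - z)⁻¹) • v) :=
    ((memLp_kernel hzcim.ne).integrable_mul (memLp_kernel hz.ne')).smul_const v
  have hzero : ∫ s : ℝ, G s = 0 := by
    refine integral_line_eq_zero hGc (hGd.mono fun w (hw : 0 < w.im) => h0U hw.le) ?_ (R₀ := ‖z‖ + 1)
      (B := (2 * (ENNReal.ofReal Real.pi ^ (1 / 2 : ℝ) * (C' : ℝ≥0∞) ^ (1 / 2 : ℝ))).toNNReal)
      ?_ ?_
    · simp_rw [hGreal]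
      exact memLp_one_iff_integrable.1 (hΦ0.smul (memLp_kernel hz.ne'))
    · intro y hy
      rw [ENNReal.coe_toNNReal (by finiteness)]
      -- The line may pass through z, so the kernel at z is compared with the kernel at a fixed
      -- point x. For |s| ≥ ‖z‖ + 1 one has |s − Re z| ≥ 1, hence |s − x| ≤ 2|s + iy − z| uniformly
      -- in y.
      set x : ℂ := z.re + Complex.I with hx
      have hxim : x.im = 1 := by simp [hx]
      have hpt : ∀ s ∈ {s : ℝ | ‖z‖ + 1 ≤ |s|}, ‖G (s + y * Complex.I)‖ₑ ≤
          2 * ‖((s : ℂ) - x)⁻¹ • Φ (s + y * Complex.I)‖ₑ := by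
        intro s hs
        have hs' : ‖z‖ + 1 ≤ |s| := hs
        have h1 : 1 ≤ |s - z.re| := by
          have := abs_sub_abs_le_abs_sub s z.re
          have := Complex.abs_re_le_norm z
          linarith
        have h2 : |s - z.re| ≤ ‖(s : ℂ) + y * Complex.I - z‖ := by
          have := Complex.abs_re_le_norm ((s : ℂ) + y * Complex.I - z)
          simpa using this
        have hne : (s : ℂ) + y * Complex.I - z ≠ 0 := by
          rw [← norm_pos_iff]; linarith
        rw [hGv _ (sub_ne_zero.1 hne), enorm_smul, enorm_smul, ← mul_assoc]
        gcongr
        have h3 : ‖((s : ℂ) + y * Complex.I - z)⁻¹‖ ≤ 2 * ‖((s : ℂ) - x)⁻¹‖ := by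
          rw [norm_inv, norm_inv]
          have h4 : ‖(s : ℂ) - x‖ ≤ |s - z.re| + 1 := by
            have : (s : ℂ) - x = ((s - z.re : ℝ) : ℂ) - Complex.I := by
              rw [hx]; push_cast; ring
            rw [this]
            refine (norm_sub_le _ _).trans ?_
            rw [Complex.norm_real, Complex.norm_I, Real.norm_eq_abs]
          have h5 : 0 < ‖(s : ℂ) - x‖ :=
            norm_pos_iff.2 (ofReal_sub_ne_zero (by simp [hxim]) s)
          have h6 : 0 < ‖(s : ℂ) + y * Complex.I - z‖ := norm_pos_iff.2 hne
          rw [inv_le_iff_one_le_mul₀ h6]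
          field_simp
          linarith
        rw [← ofReal_norm, ← ofReal_norm]
        refine (ENNReal.ofReal_le_ofReal h3).trans ?_
        rw [ENNReal.ofReal_mul (by norm_num)]
        simp
      have hms : MeasurableSet {s : ℝ | ‖z‖ + 1 ≤ |s|} :=
        measurableSet_le measurable_const (by fun_prop)
      refine (setLIntegral_mono' hms hpt).trans ((setLIntegral_le_lintegral _ _).trans ?_)
      rw [lintegral_const_mul' _ _ (by simp)]
      gcongr
      refine (lintegral_enorm_smul_le (continuous_kernel (by simp [hxim])).aestronglyMeasurable
        (hΦc.comp_continuous (by fun_prop) (by simp [hy])).aestronglyMeasurable).trans ?_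
      rw [lintegral_kernel_sq (by simp [hxim])]
      gcongr ?_ ^ _ * ?_ ^ _
      · simp [hxim]
      · exact hΦL y hy
    · refine (tendsto_lintegral_kernel_smul hΦc hΦL z).congr' ?_
      filter_upwards [eventually_gt_atTop z.im] with y hy
      refine lintegral_congr fun s => ?_
      rw [hGv]
      intro h
      rw [← h] at hy
      simp at hy
  have h1 : ∀ s : ℝ, G s = ((s : ℂ) - z)⁻¹ • F s - (((s : ℂ) - zc)⁻¹ * ((s : ℂ) - z)⁻¹) • v := by
    intro s
    rw [hGreal, hΦ, smul_sub, smul_smul, mul_comm]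
  simp_rw [h1] at hzero
  rw [integral_sub hint hint2, integral_smul_const, sub_eq_zero] at hzero
  rw [hzero, hv, smul_smul, mul_comm, integral_kernel_mul_conj hz]

theorem MemHardyUpper.integral_kernel_smul_shift [CompleteSpace E] {F : ℂ → E}
    (hF : MemHardyUpper F) {η : ℝ} (hη : 0 < η) :
    (∀ z : ℂ, 0 < z.im → ∫ s : ℝ, ((s : ℂ) - z)⁻¹ • F (s + η * Complex.I) =
      (2 * Real.pi * Complex.I : ℂ) • F (z + η * Complex.I)) ∧
    ∀ z : ℂ, z.im < 0 → ∫ s : ℝ, ((s : ℂ) - z)⁻¹ • F (s + η * Complex.I) = 0 := by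
  obtain ⟨hd, C, hC⟩ := hF
  have hd' : DifferentiableOn ℂ (fun w => F (w + η * Complex.I)) {z | -η < z.im} := by
    refine hd.comp (by fun_prop) ?_
    intro w hw
    have : -η < w.im := hw
    simp
    linarith
  have hL : ∀ y : ℝ, 0 ≤ y →
      ∫⁻ s : ℝ, ‖F ((s : ℂ) + y * Complex.I + η * Complex.I)‖ₑ ^ 2 ≤ C := by
    intro y hy
    convert hC (y + η) (by linarith) using 6
    push_cast; ring
  constructor
  · intro z hz
    exact integral_kernel_smul_eq hη hd' hL hz
  · intro z hz
    refine integral_kernel_smul_eq_zero (hd'.continuousOn.mono ?_) (hd'.mono ?_) hL hz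
    · intro w hw
      have : 0 ≤ w.im := hw
      simp only [Set.mem_ofPred_eq]; linarith
    · intro w hw
      have : 0 < w.im := hw
      simp only [Set.mem_ofPred_eq]; linarith

end CauchyFormula

/-! ### Poisson averages at Lebesgue points -/

section LebesguePoints

variable {E : Type*} [NormedAddCommGroup E]

/-- The mean oscillation of `f` about its value at `x` over the interval of radius `r`. -/
def meanOscillation (f : ℝ → E) (x r : ℝ) : ℝ≥0∞ :=
  (∫⁻ s in Metric.closedBall x r, ‖f s - f x‖ₑ) / volume (Metric.closedBall x r)

theorem ae_tendsto_meanOscillation {f : ℝ → E} (hf : LocallyIntegrable f) :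
    ∀ᵐ x : ℝ, Tendsto (meanOscillation f x) (𝓝[>] 0) (𝓝 0) := by
  filter_upwards [VitaliFamily.ae_tendsto_lintegral_enorm_sub_div
    (IsUnifLocDoublingMeasure.vitaliFamily (volume : Measure ℝ) 1) hf] with x hx
  refine hx.comp (IsUnifLocDoublingMeasure.tendsto_closedBall_filterAt (K := 1) volume
    (fun _ => x) id tendsto_id ?_)
  filter_upwards [self_mem_nhdsWithin] with r hr
  exact Metric.mem_closedBall_self (by simpa using (le_of_lt hr))

/-- Small radii are covered by convergence at the Lebesgue point; for large radii ‖f s‖ ≤ 1 + ‖f s‖²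
and the total L² mass is divided by the length. The bound serves to dominate a dyadic series. -/
theorem exists_meanOscillation_le {f : ℝ → E} (hf : MemLp f 2 volume) {x : ℝ}
    (hx : Tendsto (meanOscillation f x) (𝓝[>] 0) (𝓝 0)) :
    ∃ B : ℝ≥0∞, B ≠ ∞ ∧ ∀ r, 0 < r → meanOscillation f x r ≤ B := by
  have h1 := hx.eventually (gt_mem_nhds (zero_lt_one))
  obtain ⟨r₀, hr₀, h⟩ := mem_nhdsGT_iff_exists_Ioo_subset.1 h1
  have hr₀' : (0 : ℝ) < r₀ := hr₀
  set N : ℝ≥0∞ := ∫⁻ s, ‖f s‖ₑ ^ 2 with hN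
  have hNfin : N ≠ ∞ := by
    have := (eLpNorm_lt_top_iff_lintegral_rpow_enorm_lt_top (by simp) (by simp)).1 hf.2
    simpa [ENNReal.rpow_two] using this.ne
  refine ⟨max 1 (N / ENNReal.ofReal (2 * r₀) + (1 + ‖f x‖ₑ)), ?_, fun r hr => ?_⟩
  · have : N / ENNReal.ofReal (2 * r₀) ≠ ∞ := ENNReal.div_ne_top hNfin (by simpa using hr₀')
    exact (max_lt (by simp) (ENNReal.add_lt_top.2 ⟨this.lt_top, by finiteness⟩)).ne
  · rcases lt_or_ge r r₀ with hlt | hge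
    · exact le_max_of_le_left (h ⟨hr, hlt⟩).le
    · refine le_max_of_le_right ?_
      have hpt : ∀ s, ‖f s - f x‖ₑ ≤ ‖f s‖ₑ ^ 2 + (1 + ‖f x‖ₑ) := by
        intro s
        refine enorm_sub_le.trans ?_
        rw [← add_assoc]
        gcongr
        rcases le_total ‖f s‖ₑ 1 with h1 | h1
        · exact h1.trans le_add_self
        · exact (le_self_pow₀ h1 (by norm_num)).trans le_self_add
      have hv0 : volume (Metric.closedBall x r) ≠ 0 := by
        simp [Real.volume_closedBall, hr]
      have hvt : volume (Metric.closedBall x r) ≠ ∞ := by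
        rw [Real.volume_closedBall]; exact ENNReal.ofReal_ne_top
      calc meanOscillation f x r
          ≤ (N + (1 + ‖f x‖ₑ) * volume (Metric.closedBall x r)) /
            volume (Metric.closedBall x r) := by
            unfold meanOscillation
            gcongr
            refine (lintegral_mono hpt).trans ?_
            rw [lintegral_add_right _ measurable_const, setLIntegral_const]
            gcongr
            exact setLIntegral_le_lintegral _ _
        _ = N / volume (Metric.closedBall x r) + (1 + ‖f x‖ₑ) := by
            rw [ENNReal.add_div, ENNReal.mul_div_cancel_right hv0 hvt]
        _ ≤ _ := by
            gcongr
            rw [Real.volume_closedBall]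
            exact ENNReal.ofReal_le_ofReal (by linarith)

/-- Take the first dyadic ball, of radius 2ⁿε, that contains s. For n ≥ 1 the point lies outside the
previous ball, so (s − x)² + ε² ≥ 4ⁿε²/4; for n = 0 the term ε² suffices. One summand therefore
already dominates the kernel. -/
theorem poisson_kernel_le_tsum {x ε : ℝ} (hε : 0 < ε) (s : ℝ) :
    ENNReal.ofReal (ε / Real.pi * ‖((s : ℂ) - (x + ε * Complex.I))⁻¹‖ ^ 2) ≤
      ∑' n : ℕ, (Metric.closedBall x (2 ^ n * ε)).indicator
        (fun _ => ENNReal.ofReal (4 / (Real.pi * ε * 4 ^ n))) s := by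
  have hk : ‖((s : ℂ) - (x + ε * Complex.I))⁻¹‖ ^ 2 = ((s - x) ^ 2 + ε ^ 2)⁻¹ := by
    rw [norm_kernel_sq]; simp
  rw [hk]
  have hex : ∃ n : ℕ, |s - x| ≤ 2 ^ n * ε := by
    obtain ⟨n, hn⟩ := pow_unbounded_of_one_lt (|s - x| / ε) (one_lt_two : (1 : ℝ) < 2)
    exact ⟨n, ((div_lt_iff₀ hε).1 hn).le⟩
  classical
  set n := Nat.find hex with hn
  have hns : |s - x| ≤ 2 ^ n * ε := Nat.find_spec hex
  refine le_trans ?_ (ENNReal.le_tsum n)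
  rw [Set.indicator_of_mem (by rw [Metric.mem_closedBall, Real.dist_eq]; exact hns)]
  refine ENNReal.ofReal_le_ofReal ?_
  have hpi := Real.pi_pos
  have hlow : 4 ^ n * ε ^ 2 / 4 ≤ (s - x) ^ 2 + ε ^ 2 := by
    rcases Nat.eq_zero_or_pos n with h0 | hpos
    · rw [h0]; nlinarith [sq_nonneg (s - x), sq_nonneg ε]
    · have hlt : 2 ^ (n - 1) * ε < |s - x| := not_le.1 (Nat.find_min hex (by omega : n - 1 < n))
      have h2 : (2 ^ (n - 1) * ε) ^ 2 ≤ (s - x) ^ 2 := by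
        rw [← sq_abs (s - x)]
        exact pow_le_pow_left₀ (by positivity) hlt.le 2
      have h4 : (2 ^ (n - 1) * ε) ^ 2 = 4 ^ n * ε ^ 2 / 4 := by
        have : (4 : ℝ) ^ n = 4 * 4 ^ (n - 1) := by
          rw [← pow_succ']; congr 1; omega
        rw [this, mul_pow, ← pow_mul, mul_comm (n - 1) 2, pow_mul]
        norm_num
        ring
      nlinarith [sq_nonneg ε]
  have hp : 0 < 4 ^ n * ε ^ 2 / 4 := by positivity
  calc ε / Real.pi * ((s - x) ^ 2 + ε ^ 2)⁻¹ ≤ ε / Real.pi * (4 ^ n * ε ^ 2 / 4)⁻¹ := by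
        gcongr
    _ = 4 / (Real.pi * ε * 4 ^ n) := by field_simp

/-- The height 4/(πε4ⁿ) times the length 2·2ⁿε of the n-th ball is (8/π)2⁻ⁿ. The Poisson average is
thus at most a geometric combination of mean oscillations at radii 2ⁿε, and dominated convergence
applies to the series. -/
theorem tendsto_lintegral_poisson {f : ℝ → E} (hf : MemLp f 2 volume) {x : ℝ}
    (hx : Tendsto (meanOscillation f x) (𝓝[>] 0) (𝓝 0)) :
    Tendsto (fun ε : ℝ => ∫⁻ s : ℝ,
      ENNReal.ofReal (ε / Real.pi * ‖((s : ℂ) - (x + ε * Complex.I))⁻¹‖ ^ 2) * ‖f s - f x‖ₑ)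
      (𝓝[>] 0) (𝓝 0) := by
  obtain ⟨B, hB, hBle⟩ := exists_meanOscillation_le hf hx
  have hsum : Tendsto (fun ε : ℝ => ∫⁻ n : ℕ,
      ENNReal.ofReal (8 / Real.pi * (1 / 2) ^ n) * meanOscillation f x (2 ^ n * ε) ∂Measure.count)
      (𝓝[>] 0) (𝓝 (∫⁻ _ : ℕ, (0 : ℝ≥0∞) ∂Measure.count)) := by
    refine tendsto_lintegral_filter_of_dominated_convergence
      (fun n => ENNReal.ofReal (8 / Real.pi * (1 / 2) ^ n) * B)
      (Eventually.of_forall fun _ => measurable_from_nat) ?_ ?_ ?_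
    · filter_upwards [self_mem_nhdsWithin] with ε hε
      refine ae_of_all _ fun n => ?_
      gcongr
      exact hBle _ (mul_pos (by positivity) hε)
    · rw [lintegral_count, ENNReal.tsum_mul_right]
      refine ENNReal.mul_ne_top ?_ hB
      rw [← ENNReal.ofReal_tsum_of_nonneg (fun n => by positivity)
        ((summable_geometric_of_lt_one (by norm_num) (by norm_num)).mul_left _)]
      exact ENNReal.ofReal_ne_top
    · refine ae_of_all _ fun n => ?_
      have : Tendsto (fun ε : ℝ => 2 ^ n * ε) (𝓝[>] 0) (𝓝[>] 0) := by
        refine tendsto_nhdsWithin_iff.2 ⟨?_, ?_⟩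
        · have : Tendsto (fun ε : ℝ => 2 ^ n * ε) (𝓝 0) (𝓝 (2 ^ n * 0)) :=
            (continuous_const.mul continuous_id).tendsto 0
          rw [mul_zero] at this
          exact this.mono_left nhdsWithin_le_nhds
        · filter_upwards [self_mem_nhdsWithin] with ε hε
          exact mul_pos (pow_pos two_pos n) (Set.mem_Ioi.1 hε)
      have h := ENNReal.Tendsto.const_mul (a := ENNReal.ofReal (8 / Real.pi * (1 / 2) ^ n))
        (hx.comp this) (Or.inr ENNReal.ofReal_ne_top)
      simpa using h
  rw [lintegral_zero] at hsum
  refine tendsto_of_tendsto_of_tendsto_of_le_of_le' tendsto_const_nhds hsum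
    (Eventually.of_forall fun _ => zero_le) ?_
  filter_upwards [self_mem_nhdsWithin] with ε hε
  have hε' : 0 < ε := hε
  have hmeas : AEMeasurable (fun s => ‖f s - f x‖ₑ) volume :=
    (hf.1.sub aestronglyMeasurable_const).enorm
  calc _ ≤ ∫⁻ s : ℝ, ∑' n : ℕ, (Metric.closedBall x (2 ^ n * ε)).indicator
        (fun s => ENNReal.ofReal (4 / (Real.pi * ε * 4 ^ n)) * ‖f s - f x‖ₑ) s := by
        refine lintegral_mono fun s => ?_
        refine (mul_le_mul_left (poisson_kernel_le_tsum hε' s) _).trans ?_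
        rw [← ENNReal.tsum_mul_right]
        refine ENNReal.tsum_le_tsum fun n => ?_
        by_cases h : s ∈ Metric.closedBall x (2 ^ n * ε)
        · simp [h]
        · simp [h]
    _ = ∑' n : ℕ, ∫⁻ s : ℝ, (Metric.closedBall x (2 ^ n * ε)).indicator
        (fun s => ENNReal.ofReal (4 / (Real.pi * ε * 4 ^ n)) * ‖f s - f x‖ₑ) s :=
        lintegral_tsum fun n => (hmeas.const_mul _).indicator measurableSet_closedBall
    _ = _ := by
        rw [lintegral_count]
        refine tsum_congr fun n => ?_
        rw [lintegral_indicator measurableSet_closedBall, lintegral_const_mul' _ _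
          ENNReal.ofReal_ne_top, meanOscillation, Real.volume_closedBall,
          ENNReal.div_eq_inv_mul, ← mul_assoc, ← ENNReal.ofReal_inv_of_pos (by positivity),
          ← ENNReal.ofReal_mul (by positivity)]
        congr 2
        have : (4 : ℝ) ^ n = 2 ^ n * 2 ^ n := by rw [← mul_pow]; norm_num
        rw [this, one_div, inv_pow]
        have := Real.pi_pos
        field_simp
        norm_num

end LebesguePoints

/-! ### Boundary functions of the Hardy class -/

section WeakLimit

/-- Along an ultrafilter every bounded scalar family converges. The limits of the inner products
form a bounded functional, which the Riesz representation theorem turns into a vector; separability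
plays no role. -/
theorem exists_weak_limit {X ι : Type*} [NormedAddCommGroup X] [InnerProductSpace ℂ X]
    [CompleteSpace X] (l : Ultrafilter ι) (x : ι → X) {M : ℝ} (hx : ∀ i, ‖x i‖ ≤ M) :
    ∃ g : X, ∀ y, Tendsto (fun i => inner ℂ y (x i)) l (𝓝 (inner ℂ y g)) := by
  have hex : ∀ y, ∃ a ∈ Metric.closedBall (0 : ℂ) (M * ‖y‖),
      Tendsto (fun i => inner ℂ (x i) y) l (𝓝 a) := by
    intro y
    obtain ⟨a, ha, h⟩ := (isCompact_closedBall (0 : ℂ) (M * ‖y‖)).ultrafilter_le_nhds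
      (l.map fun i => inner ℂ (x i) y) (by
        rw [le_principal_iff]
        refine Filter.mem_map.2 (Eventually.of_forall fun i => ?_)
        simp only [mem_closedBall_zero_iff]
        exact (norm_inner_le_norm _ _).trans (by gcongr; exact hx i))
    exact ⟨a, ha, h⟩
  choose L hLm hL using hex
  let Λ : X →ₗ[ℂ] ℂ :=
    { toFun := L
      map_add' := fun y z => tendsto_nhds_unique (hL (y + z)) (by
        simpa only [inner_add_right] using (hL y).add (hL z))
      map_smul' := fun c y => tendsto_nhds_unique (hL (c • y)) (by
        simpa only [inner_smul_right, smul_eq_mul, RingHom.id_apply] using (hL y).const_mul c) }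
  let Λc : StrongDual ℂ X := Λ.mkContinuous M fun y => mem_closedBall_zero_iff.1 (hLm y)
  refine ⟨(InnerProductSpace.toDual ℂ X).symm Λc, fun y => ?_⟩
  have h1 : inner ℂ ((InnerProductSpace.toDual ℂ X).symm Λc) y = L y := by
    rw [InnerProductSpace.toDual_symm_apply]; rfl
  rw [← inner_conj_symm, h1]
  have h2 := (Complex.continuous_conj.tendsto (L y)).comp (hL y)
  refine h2.congr fun i => ?_
  simp

end WeakLimit

theorem norm_toLp_le_sqrt {E : Type*} [NormedAddCommGroup E] {f : ℝ → E} (hf : MemLp f 2 volume) {C : ℝ≥0}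
    (h : ∫⁻ k : ℝ, ‖f k‖ₑ ^ 2 ≤ C) : ‖hf.toLp f‖ ≤ Real.sqrt C := by
  rw [Lp.norm_toLp, eLpNorm_eq_lintegral_rpow_enorm_toReal (by simp) (by simp)]
  refine ENNReal.toReal_le_of_le_ofReal (Real.sqrt_nonneg _) ?_
  rw [Real.sqrt_eq_rpow, ← ENNReal.ofReal_rpow_of_nonneg (by simp) (by norm_num)]
  simp only [ENNReal.toReal_ofNat, ENNReal.rpow_two, ENNReal.ofReal_coe_nnreal]
  gcongr

section HardyBoundary

variable {E : Type*} [NormedAddCommGroup E] [InnerProductSpace ℂ E]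

/-- `f` is the square integrable boundary function of the function `F` on the upper half-plane:
`F` is the Cauchy integral of `f`, which vanishes in the lower half-plane, and `F` tends to `f`
almost everywhere along vertical rays and weakly along horizontal lines. -/
structure IsHardyBoundary (F : ℂ → E) (f : ℝ → E) : Prop where
  memLp : MemLp f 2 volume
  integral_upper : ∀ z : ℂ, 0 < z.im →
    ∫ s : ℝ, ((s : ℂ) - z)⁻¹ • f s = (2 * Real.pi * Complex.I : ℂ) • F z
  integral_lower : ∀ z : ℂ, z.im < 0 → ∫ s : ℝ, ((s : ℂ) - z)⁻¹ • f s = 0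
  ae_tendsto : ∀ᵐ k : ℝ, Tendsto (fun ε : ℝ => F ((k : ℂ) + (ε : ℂ) * Complex.I)) (𝓝[>] (0 : ℝ))
    (𝓝 (f k))
  weak : ∃ l : Filter ℝ, l.NeBot ∧ l ≤ 𝓝[>] (0 : ℝ) ∧ ∀ g : ℝ → E, MemLp g 2 volume →
    Tendsto (fun ε : ℝ => ∫ k : ℝ, inner ℂ (g k) (F ((k : ℂ) + (ε : ℂ) * Complex.I))) l
      (𝓝 (∫ k : ℝ, inner ℂ (g k) (f k)))

theorem integrable_kernel_smul {f : ℝ → E} (hf : MemLp f 2 volume) {z : ℂ} (hz : z.im ≠ 0) :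
    Integrable (fun s : ℝ => ((s : ℂ) - z)⁻¹ • f s) :=
  memLp_one_iff_integrable.1 (hf.smul (memLp_kernel hz))

theorem MemHardyUpper.memLp_shift {F : ℂ → E} (hF : MemHardyUpper F) {ε : ℝ} (hε : 0 < ε) :
    MemLp (fun k : ℝ => F ((k : ℂ) + (ε : ℂ) * Complex.I)) 2 volume := by
  obtain ⟨hd, C, hC⟩ := hF
  refine ⟨(hd.continuousOn.comp_continuous (by fun_prop) (by simp [hε])).aestronglyMeasurable, ?_⟩
  rw [eLpNorm_lt_top_iff_lintegral_rpow_enorm_lt_top (by simp) (by simp)]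
  simpa [ENNReal.rpow_two] using (hC ε hε).trans_lt (by simp)

theorem inner_toLp_eq {f g : ℝ → E} (hf : MemLp f 2 volume) (hg : MemLp g 2 volume) :
    inner ℂ (hg.toLp g) (hf.toLp f) = ∫ k, inner ℂ (g k) (f k) := by
  rw [L2.inner_def]
  refine integral_congr_ae ?_
  filter_upwards [hf.coeFn_toLp, hg.coeFn_toLp] with k h1 h2
  rw [h1, h2]

theorem inner_integral_kernel_smul [CompleteSpace E] {f : ℝ → E} (hf : MemLp f 2 volume) {z : ℂ}
    (hz : z.im ≠ 0) (y : E) :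
    inner ℂ y (∫ s : ℝ, ((s : ℂ) - z)⁻¹ • f s) =
      ∫ s : ℝ, inner ℂ (((s : ℂ) - (starRingEnd ℂ) z)⁻¹ • y) (f s) := by
  rw [← integral_inner (integrable_kernel_smul hf hz)]
  refine integral_congr_ae (ae_of_all _ fun s => ?_)
  simp [inner_smul_right, mul_comm]

theorem memLp_kernel_smul_const {z : ℂ} (hz : z.im ≠ 0) (y : E) :
    MemLp (fun s : ℝ => ((s : ℂ) - z)⁻¹ • y) 2 volume := by
  refine (memLp_two_iff_integrable_sq_norm
    ((continuous_kernel hz).smul continuous_const).aestronglyMeasurable).2 ?_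
  simpa only [Pi.smul_apply', norm_smul, mul_pow] using (integrable_kernel_sq hz).mul_const (‖y‖ ^ 2)

/-- Where the Cauchy integral below the axis is zero, subtracting it costs nothing and turns the
Cauchy integral above into a Poisson integral. -/
theorem poisson_kernel_eq {x ε : ℝ} (hε : 0 < ε) (s : ℝ) :
    ((s : ℂ) - (x + ε * Complex.I))⁻¹ - ((s : ℂ) - (x - ε * Complex.I))⁻¹ =
      (2 * Real.pi * Complex.I : ℂ) *
        ((ε / Real.pi * ‖((s : ℂ) - (x + ε * Complex.I))⁻¹‖ ^ 2 : ℝ) : ℂ) := by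
  have hc : (starRingEnd ℂ) ((x : ℂ) + ε * Complex.I) = x - ε * Complex.I := by
    simp [sub_eq_add_neg]
  have h := kernel_mul_conj ((x : ℂ) + ε * Complex.I) s
  rw [hc] at h
  have h1 : (s : ℂ) - (x + ε * Complex.I) ≠ 0 := ofReal_sub_ne_zero (by simp [hε.ne']) s
  have h2 : (s : ℂ) - (x - ε * Complex.I) ≠ 0 := ofReal_sub_ne_zero (by simp [hε.ne']) s
  rw [Complex.ofReal_mul, ← h]
  have hpi : (Real.pi : ℂ) ≠ 0 := by exact_mod_cast Real.pi_ne_zero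
  push_cast
  field_simp
  ring

theorem integral_poisson {x ε : ℝ} (hε : 0 < ε) :
    ∫ s : ℝ, ε / Real.pi * ‖((s : ℂ) - (x + ε * Complex.I))⁻¹‖ ^ 2 = 1 := by
  rw [integral_const_mul, integral_kernel_sq (by simp [hε.ne'])]
  simp only [Complex.add_im, Complex.ofReal_im, Complex.mul_im, Complex.ofReal_re, Complex.I_im,
    mul_one, Complex.I_re, mul_zero, add_zero, zero_add, abs_of_pos hε]
  have := Real.pi_ne_zero
  field_simp

/-- By `poisson_kernel_eq` the two Cauchy formulas make F(x + iε) the Poisson average of f, so F(x +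
iε) − f(x) is the Poisson average of f − f(x) and tends to zero at every Lebesgue point. -/
theorem tendsto_poisson_integral [CompleteSpace E] {F : ℂ → E} {f : ℝ → E}
    (hf : MemLp f 2 volume)
    (hu : ∀ z : ℂ, 0 < z.im →
      ∫ s : ℝ, ((s : ℂ) - z)⁻¹ • f s = (2 * Real.pi * Complex.I : ℂ) • F z)
    (hl : ∀ z : ℂ, z.im < 0 → ∫ s : ℝ, ((s : ℂ) - z)⁻¹ • f s = 0) :
    ∀ᵐ k : ℝ, Tendsto (fun ε : ℝ => F ((k : ℂ) + (ε : ℂ) * Complex.I)) (𝓝[>] (0 : ℝ))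
      (𝓝 (f k)) := by
  filter_upwards [ae_tendsto_meanOscillation (hf.locallyIntegrable (by norm_num))] with x hx
  rw [tendsto_iff_edist_tendsto_0]
  refine tendsto_of_tendsto_of_tendsto_of_le_of_le' tendsto_const_nhds
    (tendsto_lintegral_poisson hf hx) (Eventually.of_forall fun _ => zero_le) ?_
  filter_upwards [self_mem_nhdsWithin] with ε hε
  have hε' : 0 < ε := hε
  have i1 := integrable_kernel_smul hf (z := (x : ℂ) + ε * Complex.I) (by simp [hε'.ne'])
  have i2 := integrable_kernel_smul hf (z := (x : ℂ) - ε * Complex.I) (by simp [hε'.ne'])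
  have h1 : (2 * Real.pi * Complex.I : ℂ) • F ((x : ℂ) + ε * Complex.I) =
      (2 * Real.pi * Complex.I : ℂ) • ∫ s : ℝ,
        (ε / Real.pi * ‖((s : ℂ) - (x + ε * Complex.I))⁻¹‖ ^ 2) • f s := by
    rw [← hu _ (by simp [hε']), ← sub_zero (∫ s : ℝ, _),
      ← hl ((x : ℂ) - ε * Complex.I) (by simp [hε']), ← integral_sub i1 i2, ← integral_smul]
    refine integral_congr_ae (ae_of_all _ fun s => ?_)
    simp only
    rw [← sub_smul, poisson_kernel_eq hε', ← smul_smul, Complex.coe_smul]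
  have hc : (2 * Real.pi * Complex.I : ℂ) ≠ 0 := by
    simp [Real.pi_ne_zero]
  have h2 := smul_right_injective E hc h1
  have i3 : Integrable fun s : ℝ =>
      (ε / Real.pi * ‖((s : ℂ) - (x + ε * Complex.I))⁻¹‖ ^ 2) • f s := by
    have := (i1.sub i2).smul ((2 * Real.pi * Complex.I : ℂ)⁻¹)
    refine this.congr (ae_of_all _ fun s => ?_)
    simp only [Pi.smul_apply, Pi.sub_apply]
    rw [← sub_smul, poisson_kernel_eq hε', ← smul_smul, smul_smul, inv_mul_cancel₀ hc, one_smul,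
      Complex.coe_smul]
  have i4 : Integrable fun s : ℝ =>
      (ε / Real.pi * ‖((s : ℂ) - (x + ε * Complex.I))⁻¹‖ ^ 2) • f x :=
    ((integrable_kernel_sq (by simp [hε'.ne'])).const_mul _).smul_const _
  have h3 : F ((x : ℂ) + ε * Complex.I) - f x = ∫ s : ℝ,
      (ε / Real.pi * ‖((s : ℂ) - (x + ε * Complex.I))⁻¹‖ ^ 2) • (f s - f x) := by
    simp_rw [smul_sub]
    rw [integral_sub i3 i4, integral_smul_const, integral_poisson hε', one_smul, h2]
  rw [edist_eq_enorm_sub, h3]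
  refine (enorm_integral_le_lintegral_enorm _).trans (le_of_eq ?_)
  refine lintegral_congr fun s => ?_
  rw [enorm_smul, Real.enorm_of_nonneg (by have := Real.pi_pos; positivity)]

/-- Functions of the Hardy class of the upper half-plane have boundary functions. -/
theorem MemHardyUpper.exists_boundary [CompleteSpace E] {F : ℂ → E} (hF : MemHardyUpper F) :
    ∃ f : ℝ → E, IsHardyBoundary F f := by
  classical
  obtain ⟨C, hC⟩ := hF.2
  let l : Ultrafilter ℝ := Ultrafilter.of (𝓝[>] (0 : ℝ))
  have hl : (l : Filter ℝ) ≤ 𝓝[>] (0 : ℝ) := Ultrafilter.of_le _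
  let x : ℝ → Lp E 2 (volume : Measure ℝ) := fun ε =>
    if h : 0 < ε then (hF.memLp_shift h).toLp _ else 0
  have hx : ∀ ε, ‖x ε‖ ≤ Real.sqrt C := by
    intro ε
    by_cases h : 0 < ε
    · simp only [x, dif_pos h]
      exact norm_toLp_le_sqrt _ (hC ε h)
    · simp [x, dif_neg h]
  obtain ⟨g, hg⟩ := exists_weak_limit l x hx
  have hgm : MemLp g 2 volume := Lp.memLp g
  have hweak : ∀ h : ℝ → E, MemLp h 2 volume →
      Tendsto (fun ε : ℝ => ∫ k : ℝ, inner ℂ (h k) (F ((k : ℂ) + (ε : ℂ) * Complex.I))) l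
        (𝓝 (∫ k : ℝ, inner ℂ (h k) (g k))) := by
    intro h hh
    have h1 := hg (hh.toLp h)
    have h2 : inner ℂ (hh.toLp h) g = ∫ k : ℝ, inner ℂ (h k) (g k) := by
      conv_lhs => rw [← Lp.toLp_coeFn g hgm]
      exact inner_toLp_eq hgm hh
    rw [h2] at h1
    refine h1.congr' ?_
    filter_upwards [hl self_mem_nhdsWithin] with ε hε
    simp only [x, dif_pos (Set.mem_Ioi.1 hε)]
    exact inner_toLp_eq _ hh
  -- The Cauchy kernel is square integrable, so the Cauchy formula for the shifted functions F(· +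
  -- iε) passes to the weak limit.
  have hu : ∀ z : ℂ, 0 < z.im →
      ∫ s : ℝ, ((s : ℂ) - z)⁻¹ • g s = (2 * Real.pi * Complex.I : ℂ) • F z := by
    intro z hz
    refine ext_inner_left ℂ fun y => ?_
    rw [inner_integral_kernel_smul hgm hz.ne']
    refine tendsto_nhds_unique (hweak _ (memLp_kernel_smul_const (by simp [hz.ne']) y)) ?_
    have hcont : Tendsto (fun ε : ℝ => F (z + ε * Complex.I)) (𝓝[>] 0) (𝓝 (F z)) := by
      have h1 : ContinuousAt F z := (hF.1.differentiableAt
        ((isOpen_lt continuous_const Complex.continuous_im).mem_nhds hz)).continuousAt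
      have h2 : Tendsto (fun ε : ℝ => z + ε * Complex.I) (𝓝 0) (𝓝 z) := by
        have : Continuous fun ε : ℝ => z + ε * Complex.I := by fun_prop
        simpa using this.tendsto 0
      exact h1.tendsto.comp (h2.mono_left nhdsWithin_le_nhds)
    have h3 := (Tendsto.inner (tendsto_const_nhds (x := y))
      (hcont.const_smul (2 * Real.pi * Complex.I : ℂ)) (𝕜 := ℂ)).mono_left hl
    refine h3.congr' ?_
    filter_upwards [hl self_mem_nhdsWithin] with ε hε
    have hε' : 0 < ε := hε
    rw [← (hF.integral_kernel_smul_shift hε').1 z hz,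
      inner_integral_kernel_smul (hF.memLp_shift hε') hz.ne']
  have hlow : ∀ z : ℂ, z.im < 0 → ∫ s : ℝ, ((s : ℂ) - z)⁻¹ • g s = 0 := by
    intro z hz
    refine ext_inner_left ℂ fun y => ?_
    rw [inner_integral_kernel_smul hgm hz.ne, inner_zero_right]
    refine tendsto_nhds_unique (hweak _ (memLp_kernel_smul_const (by simp [hz.ne]) y)) ?_
    refine tendsto_const_nhds.congr' ?_
    filter_upwards [hl self_mem_nhdsWithin] with ε hε
    have hε' : 0 < ε := hε
    rw [← inner_integral_kernel_smul (hF.memLp_shift hε') hz.ne,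
      (hF.integral_kernel_smul_shift hε').2 z hz, inner_zero_right]
  exact ⟨g, hgm, hu, hlow, tendsto_poisson_integral hgm hu hlow, l, inferInstance, hl, hweak⟩

end HardyBoundary

/-! ### Orthogonality to the Hardy class -/

section HardyOrthogonality

theorem MemHardyUpper.of_le {E E' : Type*} [NormedAddCommGroup E] [NormedSpace ℂ E]
    [NormedAddCommGroup E'] [NormedSpace ℂ E'] {F : ℂ → E} {G : ℂ → E'} (hF : MemHardyUpper F)
    (hd : DifferentiableOn ℂ G {z | 0 < z.im}) (c : ℝ≥0) (h : ∀ z, 0 < z.im → ‖G z‖ ≤ c * ‖F z‖) :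
    MemHardyUpper G := by
  obtain ⟨-, C, hC⟩ := hF
  refine ⟨hd, c ^ 2 * C, fun ε hε => ?_⟩
  calc ∫⁻ k : ℝ, ‖G ((k : ℂ) + (ε : ℂ) * Complex.I)‖ₑ ^ 2
      ≤ ∫⁻ k : ℝ, (c : ℝ≥0∞) ^ 2 * ‖F ((k : ℂ) + (ε : ℂ) * Complex.I)‖ₑ ^ 2 := by
        refine lintegral_mono fun k => ?_
        rw [← mul_pow]
        gcongr
        have := h ((k : ℂ) + (ε : ℂ) * Complex.I) (by simp [hε])
        rw [← ofReal_norm, ← ofReal_norm]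
        refine (ENNReal.ofReal_le_ofReal this).trans ?_
        rw [ENNReal.ofReal_mul (by simp)]
        simp
    _ = (c : ℝ≥0∞) ^ 2 * ∫⁻ k : ℝ, ‖F ((k : ℂ) + (ε : ℂ) * Complex.I)‖ₑ ^ 2 :=
        lintegral_const_mul' _ _ (by simp)
    _ ≤ _ := by
        push_cast
        gcongr
        exact hC ε hε

variable {E : Type*} [NormedAddCommGroup E] [InnerProductSpace ℂ E]

/-- The justification of Fubini: |κ|‖r‖‖f‖ ≤ (|κ|² + ‖r‖²)‖f‖ for the kernel κ, where the first term
is a convolution integrand of two integrable functions and the second is a product in separate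
variables. -/
theorem integrable_kernel_mul_inner {f r : ℝ → E} (hf : Integrable f) (hr : MemLp r 2 volume)
    {ε : ℝ} (hε : 0 < ε) :
    Integrable (Function.uncurry fun k s : ℝ =>
      ((s : ℂ) - (k + ε * Complex.I))⁻¹ * inner ℂ (r k) (f s)) (volume.prod volume) := by
  have hker : Integrable (fun t : ℝ => ‖((t : ℂ) - (-(ε * Complex.I)))⁻¹‖ ^ 2) :=
    integrable_kernel_sq (by simp [hε.ne'])
  have h1 : Integrable (fun p : ℝ × ℝ =>
      ‖f p.2‖ * ‖(((p.1 - p.2 : ℝ) : ℂ) - (-(ε * Complex.I)))⁻¹‖ ^ 2) (volume.prod volume) :=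
    Integrable.convolution_integrand (ContinuousLinearMap.mul ℝ ℝ) hf.norm hker
  have h2 : Integrable (fun p : ℝ × ℝ => ‖r p.1‖ ^ 2 * ‖f p.2‖) (volume.prod volume) :=
    ((memLp_two_iff_integrable_sq_norm hr.1).1 hr).mul_prod hf.norm
  refine Integrable.mono' (h1.add h2) ?_ (ae_of_all _ ?_)
  · refine AEStronglyMeasurable.mul ?_ ?_
    · refine Continuous.aestronglyMeasurable ?_
      refine Continuous.inv₀ (by fun_prop) ?_
      rintro ⟨k, s⟩
      exact ofReal_sub_ne_zero (by simp [hε.ne']) s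
    · exact AEStronglyMeasurable.inner (hr.1.comp_fst) (hf.1.comp_snd)
  · rintro ⟨k, s⟩
    simp only [Function.uncurry, Pi.add_apply, norm_mul]
    have hk : ‖((s : ℂ) - (k + ε * Complex.I))⁻¹‖ =
        ‖(((k - s : ℝ) : ℂ) - (-(ε * Complex.I)))⁻¹‖ := by
      rw [norm_inv, norm_inv, ← norm_neg]
      congr 2
      push_cast
      ring
    rw [hk]
    set a := ‖(((k - s : ℝ) : ℂ) - (-(ε * Complex.I)))⁻¹‖
    have h3 : ‖inner ℂ (r k) (f s)‖ ≤ ‖r k‖ * ‖f s‖ := norm_inner_le_norm _ _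
    have h4 : a * ‖r k‖ ≤ a ^ 2 + ‖r k‖ ^ 2 := by nlinarith [sq_nonneg (a - ‖r k‖)]
    calc a * ‖inner ℂ (r k) (f s)‖ ≤ a * (‖r k‖ * ‖f s‖) := by gcongr
      _ = (a * ‖r k‖) * ‖f s‖ := by ring
      _ ≤ (a ^ 2 + ‖r k‖ ^ 2) * ‖f s‖ := by gcongr
      _ = _ := by ring

variable [CompleteSpace E]

/-- Write F(k + iε) as the Cauchy integral of f and exchange the integrations. Up to sign and
conjugation the inner integral becomes the Cauchy integral of r at s + iε, paired with f(s), which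
is zero; then let ε ↓ 0 weakly. -/
theorem IsHardyBoundary.integral_inner_eq_zero_of_integrable {F : ℂ → E} {f r : ℝ → E}
    (hF : IsHardyBoundary F f) (hf : Integrable f) (hr : MemLp r 2 volume)
    (h0 : ∀ z : ℂ, 0 < z.im → ∫ s : ℝ, ((s : ℂ) - z)⁻¹ • r s = 0) :
    ∫ k : ℝ, inner ℂ (r k) (f k) = 0 := by
  obtain ⟨l, hl, hle, hw⟩ := hF.weak
  refine tendsto_nhds_unique (hw r hr) (tendsto_const_nhds.congr' ?_)
  filter_upwards [hle self_mem_nhdsWithin] with ε hε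
  have hε' : 0 < ε := hε
  have hc : (2 * Real.pi * Complex.I : ℂ) ≠ 0 := by simp [Real.pi_ne_zero]
  have h1 : (2 * Real.pi * Complex.I : ℂ) *
      ∫ k : ℝ, inner ℂ (r k) (F ((k : ℂ) + (ε : ℂ) * Complex.I)) = 0 := by
    rw [← integral_const_mul]
    calc _ = ∫ k : ℝ, ∫ s : ℝ, ((s : ℂ) - (k + ε * Complex.I))⁻¹ * inner ℂ (r k) (f s) := by
          refine integral_congr_ae (ae_of_all _ fun k => ?_)
          simp only
          rw [← inner_smul_right, ← hF.integral_upper _ (by simp [hε']),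
            ← integral_inner (integrable_kernel_smul hF.memLp (by simp [hε'.ne']))]
          simp_rw [inner_smul_right]
      _ = ∫ s : ℝ, ∫ k : ℝ, ((s : ℂ) - (k + ε * Complex.I))⁻¹ * inner ℂ (r k) (f s) :=
          integral_integral_swap (integrable_kernel_mul_inner hf hr hε')
      _ = ∫ s : ℝ, (0 : ℂ) := by
          refine integral_congr_ae (ae_of_all _ fun s => ?_)
          simp only
          have h2 := h0 ((s : ℂ) + ε * Complex.I) (by simp [hε'])
          have h3 : ∀ k : ℝ, ((s : ℂ) - (k + ε * Complex.I))⁻¹ * inner ℂ (r k) (f s) =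
              (starRingEnd ℂ) (-(inner ℂ (f s) (((k : ℂ) - (s + ε * Complex.I))⁻¹ • r k))) := by
            intro k
            rw [inner_smul_right, map_neg, map_mul, inner_conj_symm, conj_kernel, ← neg_mul,
              ← inv_neg]
            congr 2
            simp
            ring
          simp_rw [h3]
          rw [integral_conj, integral_neg, integral_inner
            (integrable_kernel_smul hr (by simp [hε'.ne'])), h2]
          simp
      _ = 0 := by simp
  exact ((mul_eq_zero.1 h1).resolve_left hc).symm

/-- The factor iN/(z + iN) preserves the Hardy class, makes the boundary function integrable by its
decay, and tends to 1 as N → ∞. It reduces the orthogonality relation to integrable boundary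
functions. -/
theorem norm_damping_le {N : ℝ} (hN : 0 < N) {z : ℂ} (hz : 0 ≤ z.im) :
    ‖(N : ℂ) * Complex.I * (z + N * Complex.I)⁻¹‖ ≤ 1 := by
  have h : N ≤ ‖z + N * Complex.I‖ := by
    have := Complex.abs_im_le_norm (z + N * Complex.I)
    refine le_trans ?_ this
    refine le_trans ?_ (le_abs_self _)
    simp [hz]
  rw [norm_mul, norm_mul, Complex.norm_I, mul_one, norm_inv, Complex.norm_real,
    Real.norm_of_nonneg hN.le, ← div_eq_mul_inv]
  exact div_le_one_of_le₀ h (norm_nonneg _)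

/-- A square integrable function whose Cauchy integral vanishes in the upper half-plane is
orthogonal to the boundary functions of the Hardy class. -/
theorem IsHardyBoundary.integral_inner_eq_zero {F : ℂ → E} {f r : ℝ → E}
    (hF : MemHardyUpper F) (hFf : IsHardyBoundary F f) (hr : MemLp r 2 volume)
    (h0 : ∀ z : ℂ, 0 < z.im → ∫ s : ℝ, ((s : ℂ) - z)⁻¹ • r s = 0) :
    ∫ k : ℝ, inner ℂ (r k) (f k) = 0 := by
  set d : ℝ → ℂ → ℂ := fun N z => (N : ℂ) * Complex.I * (z + N * Complex.I)⁻¹ with hd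
  have hne : ∀ (N : ℝ) (z : ℂ), 0 < N → 0 ≤ z.im → z + N * Complex.I ≠ 0 := by
    intro N z hN hz h
    have := congrArg Complex.im h
    simp at this
    linarith
  have hzero : ∀ N : ℝ, 0 < N → ∫ k : ℝ, inner ℂ (r k) (d N k • f k) = 0 := by
    intro N hN
    have hdiff : DifferentiableOn ℂ (fun z => d N z • F z) {z | 0 < z.im} := by
      refine DifferentiableOn.smul ?_ hF.1
      refine DifferentiableOn.const_mul (DifferentiableOn.inv (by fun_prop) ?_) _
      intro z hz
      exact hne N z hN (le_of_lt hz)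
    have hmem : MemHardyUpper (fun z => d N z • F z) := by
      refine hF.of_le hdiff 1 fun z hz => ?_
      rw [norm_smul]
      gcongr
      exact norm_damping_le hN hz.le
    obtain ⟨f', hf'⟩ := hmem.exists_boundary
    have hae : f' =ᵐ[volume] fun k => d N k • f k := by
      filter_upwards [hf'.ae_tendsto, hFf.ae_tendsto] with k h1 h2
      refine tendsto_nhds_unique h1 (Tendsto.smul ?_ h2)
      have hcont : ContinuousAt (fun ε : ℝ => d N ((k : ℂ) + ε * Complex.I)) 0 := by
        refine ContinuousAt.mul (by fun_prop) (ContinuousAt.inv₀ (by fun_prop) ?_)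
        exact hne N _ hN (by simp)
      have := hcont.tendsto.mono_left (nhdsWithin_le_nhds (s := Set.Ioi 0))
      simpa using this
    have hint : Integrable f' := by
      refine Integrable.congr ?_ hae.symm
      have := (integrable_kernel_smul hFf.memLp (z := -(N * Complex.I))
        (by simp [hN.ne'])).smul ((N : ℂ) * Complex.I)
      refine this.congr (ae_of_all _ fun k => ?_)
      simp [hd, smul_smul]
    rw [← hf'.integral_inner_eq_zero_of_integrable hint hr h0]
    refine integral_congr_ae ?_
    filter_upwards [hae] with k hk
    rw [hk]
  have hlim : Tendsto (fun N : ℝ => ∫ k : ℝ, inner ℂ (r k) (d N k • f k)) atTop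
      (𝓝 (∫ k : ℝ, inner ℂ (r k) (f k))) := by
    have hinn : Integrable fun k => inner ℂ (r k) (f k) := by
      have h := L2.integrable_inner (𝕜 := ℂ) (hr.toLp r) (hFf.memLp.toLp f)
      refine h.congr ?_
      filter_upwards [hr.coeFn_toLp, hFf.memLp.coeFn_toLp] with k h1 h2
      rw [h1, h2]
    refine tendsto_integral_filter_of_dominated_convergence (fun k => ‖inner ℂ (r k) (f k)‖)
      ?_ ?_ hinn.norm ?_
    · filter_upwards [eventually_gt_atTop 0] with N hN
      refine hr.1.inner (AEStronglyMeasurable.smul ?_ hFf.memLp.1)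
      refine Continuous.aestronglyMeasurable ?_
      exact continuous_const.mul (Continuous.inv₀ (by fun_prop) fun k => hne N _ hN (by simp))
    · filter_upwards [eventually_gt_atTop 0] with N hN
      refine ae_of_all _ fun k => ?_
      rw [inner_smul_right, norm_mul]
      exact mul_le_of_le_one_left (norm_nonneg _) (norm_damping_le hN (by simp))
    · refine ae_of_all _ fun k => ?_
      have h1 : Tendsto (fun N : ℝ => d N k) atTop (𝓝 1) := by
        have h2 : Tendsto (fun N : ℝ => (1 + (k : ℂ) * ((N : ℂ)⁻¹ * (-Complex.I)))⁻¹) atTop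
            (𝓝 1) := by
          have h3 : Tendsto (fun N : ℝ => ((N : ℂ)⁻¹)) atTop (𝓝 0) := by
            have := (Complex.continuous_ofReal.tendsto 0).comp tendsto_inv_atTop_zero
            simpa [Function.comp_def] using this
          have h4 := ((h3.mul_const (-Complex.I)).const_mul (k : ℂ)).const_add 1
          simp only [zero_mul, mul_zero, add_zero] at h4
          simpa using h4.inv₀ one_ne_zero
        refine h2.congr' ?_
        filter_upwards [eventually_gt_atTop 0] with N hN
        have h5 := hne N k hN (by simp)
        have hN' : (N : ℂ) ≠ 0 := by exact_mod_cast hN.ne'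
        simp only [hd]
        rw [inv_eq_iff_eq_inv, mul_inv, inv_inv, mul_inv, Complex.inv_I]
        field_simp
        ring_nf
        simp
      have := (h1.smul_const (f k))
      rw [one_smul] at this
      exact Tendsto.inner tendsto_const_nhds this
  refine tendsto_nhds_unique hlim (tendsto_const_nhds.congr' ?_)
  filter_upwards [eventually_gt_atTop 0] with N hN
  exact (hzero N hN).symm

end HardyOrthogonality

/-! ### Boundary values as bounded operators into L² -/

section BoundaryOperator

variable {H E : Type*} [NormedAddCommGroup H] [NormedSpace ℂ H]
  [NormedAddCommGroup E] [InnerProductSpace ℂ E]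

/-- `Φ` assigns to each vector the boundary function of the operator family `G` at that vector. -/
def IsBoundaryOperator (G : ℂ → H →L[ℂ] E) (Φ : H →L[ℂ] Lp E 2 (volume : Measure ℝ)) : Prop :=
  ∀ φ, IsHardyBoundary (fun z => G z φ) (Φ φ)

/-- A family of operators whose values at each vector are of the Hardy class. -/
def IsHardyFamily (G : ℂ → H →L[ℂ] E) : Prop := ∀ φ, MemHardyUpper fun z => G z φ

/-- Linearity follows from uniqueness of the almost everywhere limits. Boundedness is the closed
graph theorem: a limit in L² of boundary functions keeps both Cauchy formulas, and by
`tendsto_poisson_integral` these determine it. -/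
theorem IsHardyFamily.exists_boundaryOperator [CompleteSpace H] [CompleteSpace E]
    {G : ℂ → H →L[ℂ] E}
    (hG : IsHardyFamily G) : ∃ Φ : H →L[ℂ] Lp E 2 (volume : Measure ℝ), IsBoundaryOperator G Φ := by
  choose f hf using fun φ => (hG φ).exists_boundary
  have hadd : ∀ φ ψ, f (φ + ψ) =ᵐ[volume] f φ + f ψ := by
    intro φ ψ
    filter_upwards [(hf (φ + ψ)).ae_tendsto, (hf φ).ae_tendsto, (hf ψ).ae_tendsto] with k h h1 h2
    refine tendsto_nhds_unique h ?_
    simpa only [map_add, Pi.add_apply] using h1.add h2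
  have hsmul : ∀ (c : ℂ) φ, f (c • φ) =ᵐ[volume] c • f φ := by
    intro c φ
    filter_upwards [(hf (c • φ)).ae_tendsto, (hf φ).ae_tendsto] with k h h1
    refine tendsto_nhds_unique h ?_
    simpa only [map_smul, Pi.smul_apply] using h1.const_smul c
  let Φ : H →ₗ[ℂ] Lp E 2 (volume : Measure ℝ) :=
    { toFun := fun φ => (hf φ).memLp.toLp (f φ)
      map_add' := fun φ ψ => by
        rw [← MemLp.toLp_add]
        exact MemLp.toLp_congr _ _ (hadd φ ψ)
      map_smul' := fun c φ => by
        rw [RingHom.id_apply, ← MemLp.toLp_const_smul]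
        exact MemLp.toLp_congr _ _ (hsmul c φ) }
  have hΦ : ∀ φ, (Φ φ : ℝ → E) =ᵐ[volume] f φ := fun φ => (hf φ).memLp.coeFn_toLp
  have hΦb : ∀ φ, IsHardyBoundary (fun z => G z φ) (Φ φ) := by
    intro φ
    have hc : ∀ z : ℂ, ∫ s : ℝ, ((s : ℂ) - z)⁻¹ • (Φ φ : ℝ → E) s =
        ∫ s : ℝ, ((s : ℂ) - z)⁻¹ • f φ s := fun z => by
      refine integral_congr_ae ?_
      filter_upwards [hΦ φ] with s hs
      rw [hs]
    obtain ⟨l, h1, h2, h3⟩ := (hf φ).weak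
    refine ⟨Lp.memLp _, fun z hz => (hc z).trans ((hf φ).integral_upper z hz),
      fun z hz => (hc z).trans ((hf φ).integral_lower z hz), ?_, l, h1, h2, fun g hg => ?_⟩
    · filter_upwards [(hf φ).ae_tendsto, hΦ φ] with k hk1 hk2
      rwa [hk2]
    · convert h3 g hg using 2
      refine integral_congr_ae ?_
      filter_upwards [hΦ φ] with s hs
      rw [hs]
  have hcont : Continuous Φ := by
    refine LinearMap.continuous_of_seq_closed_graph Φ fun u x y hu huy => ?_
    have hkey : ∀ z : ℂ, z.im ≠ 0 → ∀ a : E,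
        Tendsto (fun n => inner ℂ a (∫ s : ℝ, ((s : ℂ) - z)⁻¹ • (Φ (u n) : ℝ → E) s)) atTop
          (𝓝 (inner ℂ a (∫ s : ℝ, ((s : ℂ) - z)⁻¹ • (y : ℝ → E) s))) := by
      intro z hz a
      have hz' : ((starRingEnd ℂ) z).im ≠ 0 := by simpa using hz
      have h1 : ∀ v : Lp E 2 (volume : Measure ℝ),
          inner ℂ a (∫ s : ℝ, ((s : ℂ) - z)⁻¹ • (v : ℝ → E) s) =
            inner ℂ ((memLp_kernel_smul_const hz' a).toLp _) v := by
        intro v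
        rw [inner_integral_kernel_smul (Lp.memLp v) hz]
        conv_rhs => rw [← Lp.toLp_coeFn v (Lp.memLp v)]
        rw [inner_toLp_eq]
      simp_rw [h1]
      exact Tendsto.inner tendsto_const_nhds huy
    have hlim : ∀ z : ℂ, Tendsto (fun n => G z (u n)) atTop (𝓝 (G z x)) := fun z =>
      ((G z).continuous.tendsto x).comp hu
    have hup : ∀ z : ℂ, 0 < z.im →
        ∫ s : ℝ, ((s : ℂ) - z)⁻¹ • (y : ℝ → E) s = (2 * Real.pi * Complex.I : ℂ) • G z x := by
      intro z hz
      refine ext_inner_left ℂ fun a => tendsto_nhds_unique (hkey z hz.ne' a) ?_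
      simp_rw [(hΦb _).integral_upper z hz]
      exact Tendsto.inner tendsto_const_nhds ((hlim z).const_smul _)
    have hlow : ∀ z : ℂ, z.im < 0 → ∫ s : ℝ, ((s : ℂ) - z)⁻¹ • (y : ℝ → E) s = 0 := by
      intro z hz
      refine ext_inner_left ℂ fun a => tendsto_nhds_unique (hkey z hz.ne a) ?_
      simp_rw [(hΦb _).integral_lower z hz]
      exact tendsto_const_nhds
    refine Lp.ext ?_
    filter_upwards [tendsto_poisson_integral (F := fun z => G z x) (Lp.memLp y) hup hlow,
      (hΦb x).ae_tendsto] with k h1 h2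
    exact tendsto_nhds_unique h1 h2
  exact ⟨⟨Φ, hcont⟩, hΦb⟩

end BoundaryOperator

open ContinuousLinearMap (adjoint)

/-! ### Resolvent families and their adjoints -/

section ResolventIdentity

variable {H K : Type*} [NormedAddCommGroup H] [InnerProductSpace ℂ H]
  [NormedAddCommGroup K] [InnerProductSpace ℂ K]

/-- The first resolvent identity at the non-real points. -/
def IsResolventFamily (R : ℂ → H →L[ℂ] H) : Prop :=
  ∀ z w : ℂ, z.im ≠ 0 → w.im ≠ 0 → R z - R w = (z - w) • (R z).comp (R w)

theorem tendsto_vertical_inv {ζ : ℂ} (hζ : ζ.im ≠ 0) (k : ℝ) :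
    Tendsto (fun ε : ℝ => ((k : ℂ) + ε * Complex.I - ζ)⁻¹) (𝓝[>] 0) (𝓝 ((k : ℂ) - ζ)⁻¹) := by
  have h : ContinuousAt (fun ε : ℝ => ((k : ℂ) + ε * Complex.I - ζ)⁻¹) 0 := by
    refine ContinuousAt.inv₀ (by fun_prop) ?_
    simpa using ofReal_sub_ne_zero hζ k
  have := h.tendsto.mono_left (nhdsWithin_le_nhds (s := Set.Ioi 0))
  simpa using this

/-- The boundary form of MR(z)R(ζ) = (z − ζ)⁻¹(MR(z) − MR(ζ)); for non-real ζ the denominator does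
not vanish on the real line. -/
theorem IsBoundaryOperator.apply_resolvent {R : ℂ → H →L[ℂ] H} (hR : IsResolventFamily R)
    {M : H →L[ℂ] K} {Φ : H →L[ℂ] Lp K 2 (volume : Measure ℝ)}
    (hΦ : IsBoundaryOperator (fun z => M.comp (R z)) Φ) {ζ : ℂ} (hζ : ζ.im ≠ 0) (φ : H) :
    ∀ᵐ k : ℝ, (Φ (R ζ φ) : ℝ → K) k =
      ((k : ℂ) - ζ)⁻¹ • ((Φ φ : ℝ → K) k - M (R ζ φ)) := by
  filter_upwards [(hΦ φ).ae_tendsto, (hΦ (R ζ φ)).ae_tendsto] with k h1 h2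
  refine tendsto_nhds_unique h2 ?_
  have h3 := (tendsto_vertical_inv hζ k).smul (h1.sub_const (M (R ζ φ)))
  refine h3.congr' ?_
  have hne : ∀ᶠ ε : ℝ in 𝓝[>] 0, (k : ℂ) + ε * Complex.I - ζ ≠ 0 := by
    have hc : ContinuousAt (fun ε : ℝ => (k : ℂ) + ε * Complex.I - ζ) 0 := by fun_prop
    refine (hc.eventually_ne ?_).filter_mono nhdsWithin_le_nhds
    simpa using ofReal_sub_ne_zero hζ k
  filter_upwards [self_mem_nhdsWithin, hne] with ε hε hε2
  have hε' : 0 < ε := hε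
  have h4 := congrArg (fun S : H →L[ℂ] H => M (S φ))
    (hR ((k : ℂ) + ε * Complex.I) ζ (by simp [hε'.ne']) hζ)
  simp only [sub_apply, smul_apply, map_sub, map_smul,
    ContinuousLinearMap.comp_apply] at h4 ⊢
  rw [h4, smul_smul, inv_mul_cancel₀ hε2, one_smul]

end ResolventIdentity

section ResolventFamilies

variable {H K : Type*} [NormedAddCommGroup H] [InnerProductSpace ℂ H] [CompleteSpace H]
  [NormedAddCommGroup K] [InnerProductSpace ℂ K] [CompleteSpace K]

/-- The family `z ↦ R (conj z)†`. -/
def starFamily (R : ℂ → H →L[ℂ] H) (z : ℂ) : H →L[ℂ] H := adjoint (R ((starRingEnd ℂ) z))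

theorem IsResolventFamily.star {R : ℂ → H →L[ℂ] H} (hR : IsResolventFamily R) :
    IsResolventFamily (starFamily R) := by
  intro z w hz hw
  have h := congrArg adjoint (hR ((starRingEnd ℂ) w) ((starRingEnd ℂ) z) (by simpa) (by simpa))
  rw [map_sub, map_smulₛₗ, ContinuousLinearMap.adjoint_comp] at h
  rw [← neg_sub (starFamily R w), starFamily, starFamily, h, ← neg_smul]
  congr 1
  simp

end ResolventFamilies

theorem integrable_inner_of_memLp {K : Type*} [NormedAddCommGroup K] [InnerProductSpace ℂ K]
    {f g : ℝ → K} (hf : MemLp f 2 volume) (hg : MemLp g 2 volume) :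
    Integrable fun k => inner ℂ (f k) (g k) := by
  refine (L2.integrable_inner (𝕜 := ℂ) (hf.toLp f) (hg.toLp g)).congr ?_
  filter_upwards [hf.coeFn_toLp, hg.coeFn_toLp] with k h1 h2
  rw [h1, h2]

/-! ### Weak boundary values of the sandwiched resolvent -/

section WeakMultiplier

variable {K : Type*} [NormedAddCommGroup K] [InnerProductSpace ℂ K] [CompleteSpace K]

/-- A weak limit of the functions `Q (k - iε) u(k)` for a bounded continuous operator function
`Q` in the lower half-plane. -/
theorem exists_weak_multiplier {Q : ℂ → K →L[ℂ] K} (hQ : ContinuousOn Q {z | z.im < 0}) {C : ℝ}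
    (hC : ∀ z : ℂ, z.im < 0 → ‖Q z‖ ≤ C) (u : Lp K 2 (volume : Measure ℝ)) :
    ∃ g : Lp K 2 (volume : Measure ℝ), ∀ a v : ℝ → K, MemLp a 2 volume →
      (∀ᵐ k : ℝ, Tendsto (fun ε : ℝ =>
        adjoint (Q ((starRingEnd ℂ) ((k : ℂ) + ε * Complex.I))) (a k)) (𝓝[>] 0) (𝓝 (v k))) →
      ∫ k : ℝ, inner ℂ (a k) ((g : ℝ → K) k) = ∫ k : ℝ, inner ℂ (v k) ((u : ℝ → K) k) := by
  classical
  let l : Ultrafilter ℝ := Ultrafilter.of (𝓝[>] (0 : ℝ))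
  have hl : (l : Filter ℝ) ≤ 𝓝[>] (0 : ℝ) := Ultrafilter.of_le _
  have him : ∀ k ε : ℝ, 0 < ε → ((starRingEnd ℂ) ((k : ℂ) + ε * Complex.I)).im < 0 := by
    intro k ε hε
    simp [hε]
  let q : ℝ → ℝ → K := fun ε k => Q ((starRingEnd ℂ) ((k : ℂ) + ε * Complex.I)) ((u : ℝ → K) k)
  have hum : MemLp u 2 volume := Lp.memLp u
  have hqc : ∀ ε : ℝ, 0 < ε →
      Continuous fun k : ℝ => Q ((starRingEnd ℂ) ((k : ℂ) + ε * Complex.I)) := by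
    intro ε hε
    refine hQ.comp_continuous ?_ fun k => him k ε hε
    exact Complex.continuous_conj.comp (by fun_prop)
  have hq : ∀ ε : ℝ, 0 < ε → MemLp (q ε) 2 volume := by
    intro ε hε
    refine hum.of_le_mul (c := C) ?_ (ae_of_all _ fun k => ?_)
    · exact isBoundedBilinearMap_apply.continuous.comp_aestronglyMeasurable
        ((hqc ε hε).aestronglyMeasurable.prodMk hum.1)
    · exact ContinuousLinearMap.le_of_opNorm_le _ (hC _ (him k ε hε)) _
  let x : ℝ → Lp K 2 (volume : Measure ℝ) := fun ε =>
    if h : 0 < ε then (hq ε h).toLp _ else 0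
  have hC0 : 0 ≤ C := (norm_nonneg _).trans (hC (-Complex.I) (by simp))
  have hx : ∀ ε, ‖x ε‖ ≤ C * ‖u‖ := by
    intro ε
    by_cases h : 0 < ε
    · simp only [x, dif_pos h]
      refine Lp.norm_le_mul_norm_of_ae_le_mul ?_
      filter_upwards [(hq ε h).coeFn_toLp] with k hk
      rw [hk]
      exact ContinuousLinearMap.le_of_opNorm_le _ (hC _ (him k ε h)) _
    · simp only [x, dif_neg h, norm_zero]
      positivity
  obtain ⟨g, hg⟩ := exists_weak_limit l x hx
  refine ⟨g, fun a v ha hv => ?_⟩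
  have h1 := hg (ha.toLp a)
  have h2 : inner ℂ (ha.toLp a) g = ∫ k : ℝ, inner ℂ (a k) ((g : ℝ → K) k) := by
    conv_lhs => rw [← Lp.toLp_coeFn g (Lp.memLp g)]
    exact inner_toLp_eq (Lp.memLp g) ha
  rw [h2] at h1
  refine tendsto_nhds_unique h1 ?_
  -- Moved to the test function, the multiplier converges pointwise by `hv`, and the integrands are
  -- dominated by C‖u‖‖a‖. This identifies the pairing with the weak limit although Q itself need
  -- not have boundary values.
  have h3 : Tendsto (fun ε : ℝ => ∫ k : ℝ, inner ℂ
      (adjoint (Q ((starRingEnd ℂ) ((k : ℂ) + ε * Complex.I))) (a k)) ((u : ℝ → K) k))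
      (𝓝[>] 0) (𝓝 (∫ k : ℝ, inner ℂ (v k) ((u : ℝ → K) k))) := by
    refine tendsto_integral_filter_of_dominated_convergence
      (fun k => C * (‖(u : ℝ → K) k‖ * ‖a k‖)) ?_ ?_ ?_ ?_
    · filter_upwards [self_mem_nhdsWithin] with ε hε
      refine AEStronglyMeasurable.inner ?_ hum.1
      exact isBoundedBilinearMap_apply.continuous.comp_aestronglyMeasurable
        (((adjoint : (K →L[ℂ] K) ≃ₗᵢ⋆[ℂ] (K →L[ℂ] K)).continuous.comp
          (hqc ε hε)).aestronglyMeasurable.prodMk ha.1)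
    · filter_upwards [self_mem_nhdsWithin] with ε hε
      refine ae_of_all _ fun k => ?_
      rw [ContinuousLinearMap.adjoint_inner_left]
      refine (norm_inner_le_norm _ _).trans ?_
      calc ‖a k‖ * ‖Q ((starRingEnd ℂ) ((k : ℂ) + ε * Complex.I)) ((u : ℝ → K) k)‖
          ≤ ‖a k‖ * (C * ‖(u : ℝ → K) k‖) := by
            gcongr
            exact ContinuousLinearMap.le_of_opNorm_le _ (hC _ (him k ε hε)) _
        _ = _ := by ring
    · exact (hum.norm.integrable_mul ha.norm).const_mul C
    · filter_upwards [hv] with k hk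
      exact Tendsto.inner hk tendsto_const_nhds
  refine (h3.mono_left hl).congr' ?_
  filter_upwards [hl self_mem_nhdsWithin] with ε hε
  have hε' : 0 < ε := hε
  simp only [x, dif_pos hε']
  rw [inner_toLp_eq _ ha]
  refine integral_congr_ae (ae_of_all _ fun k => ?_)
  simp only [q]
  rw [ContinuousLinearMap.adjoint_inner_left]

end WeakMultiplier

/-! ### Stationary wave operators and the chain rule -/

section WaveOperators

variable {H K : Type*} [NormedAddCommGroup H] [InnerProductSpace ℂ H] [CompleteSpace H]
  [NormedAddCommGroup K] [InnerProductSpace ℂ K] [CompleteSpace K]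

/-- The stationary wave operator with identification `J` and boundary operators `Φ`, `Ψ`. -/
def waveOperator (J : H →L[ℂ] H) (Φ Ψ : H →L[ℂ] Lp K 2 (volume : Measure ℝ)) : H →L[ℂ] H :=
  J - (2 * Real.pi * Complex.I : ℂ)⁻¹ • (adjoint Ψ).comp Φ

theorem inner_waveOperator (J : H →L[ℂ] H) (Φ Ψ : H →L[ℂ] Lp K 2 (volume : Measure ℝ))
    (φ ψ : H) : inner ℂ ψ (waveOperator J Φ Ψ φ) =
      inner ℂ ψ (J φ) - (2 * Real.pi * Complex.I : ℂ)⁻¹ * inner ℂ (Ψ ψ) (Φ φ) := by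
  simp only [waveOperator, sub_apply, smul_apply, inner_sub_right, inner_smul_right,
    ContinuousLinearMap.comp_apply, ContinuousLinearMap.adjoint_inner_right]

/-- The chain rule for stationary wave operators. -/
theorem waveOperator_comp {R₁ R₂ R₃ : ℂ → H →L[ℂ] H} {J J' : H →L[ℂ] H} {X Y X' Y' : H →L[ℂ] K}
    (h12 : ∀ z : ℂ, z.im ≠ 0 → J.comp (R₁ z) - (R₂ z).comp J =
      (R₂ z).comp ((adjoint X).comp (Y.comp (R₁ z))))
    (h23 : ∀ z : ℂ, z.im ≠ 0 → J'.comp (R₂ z) - (R₃ z).comp J' =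
      (R₃ z).comp ((adjoint X').comp (Y'.comp (R₂ z))))
    (hres : IsResolventFamily R₂) (hcont : ContinuousOn R₂ {z | z.im < 0}) {C : ℝ}
    (hbd : ∀ z : ℂ, z.im < 0 → ‖Y'.comp ((R₂ z).comp (adjoint X))‖ ≤ C)
    {Φ₁ Φ₁' Ψ₂ Φ₂ Ψ₃ Ψ₃' : H →L[ℂ] Lp K 2 (volume : Measure ℝ)}
    (hΦ₁ : IsBoundaryOperator (fun z => Y.comp (R₁ z)) Φ₁)
    (hΦ₁' : IsBoundaryOperator (fun z => (Y'.comp J).comp (R₁ z)) Φ₁')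
    (hΨ₂ : IsBoundaryOperator (fun z => X.comp (starFamily R₂ z)) Ψ₂)
    (hΦ₂ : IsBoundaryOperator (fun z => Y'.comp (R₂ z)) Φ₂)
    (hΨ₃ : IsBoundaryOperator (fun z => X'.comp (starFamily R₃ z)) Ψ₃)
    (hX' : IsHardyFamily (fun z => X'.comp (starFamily R₃ z)))
    (hΨ₃' : IsBoundaryOperator (fun z => (X.comp (adjoint J')).comp (starFamily R₃ z)) Ψ₃') :
    (waveOperator J' Φ₂ Ψ₃).comp (waveOperator J Φ₁ Ψ₂) =
      J'.comp J - (2 * Real.pi * Complex.I : ℂ)⁻¹ • (adjoint Ψ₃').comp Φ₁ -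
        (2 * Real.pi * Complex.I : ℂ)⁻¹ • (adjoint Ψ₃).comp Φ₁' := by
  refine ContinuousLinearMap.ext fun φ => ext_inner_left ℂ fun ψ => ?_
  set Ω := waveOperator J Φ₁ Ψ₂ with hΩ
  set Q : ℂ → K →L[ℂ] K := fun z => Y'.comp ((R₂ z).comp (adjoint X)) with hQ
  have hQc : ContinuousOn Q {z | z.im < 0} := by
    exact continuousOn_const.clm_comp (hcont.clm_comp continuousOn_const)
  -- Formally g(k) = Q(k − i0)(Φ₁φ)(k). The lower half-plane is used because the adjoint of Q(k −
  -- iε) is XR₂(k − iε)*Y'*, whose boundary values are those of `Ψ₂`.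
  obtain ⟨g, hg⟩ := exists_weak_multiplier hQc hbd (Φ₁ φ)
  have hQadj : ∀ (z : ℂ) (w : K), adjoint (Q ((starRingEnd ℂ) z)) w =
      X (starFamily R₂ z (adjoint Y' w)) := by
    intro z w
    simp [hQ, ContinuousLinearMap.adjoint_comp, starFamily]
  -- the pairing of the weak limit with Cauchy kernels
  have hgker : ∀ (z : ℂ) (w : K), 0 < z.im →
      inner ℂ w (∫ s : ℝ, ((s : ℂ) - z)⁻¹ • (g : ℝ → K) s) =
        ∫ k : ℝ, inner ℂ (((k : ℂ) - (starRingEnd ℂ) z)⁻¹ • (Ψ₂ (adjoint Y' w) : ℝ → K) k)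
          ((Φ₁ φ : ℝ → K) k) := by
    intro z w hz
    rw [inner_integral_kernel_smul (Lp.memLp g) hz.ne']
    refine hg _ _ (memLp_kernel_smul_const (by simp [hz.ne']) w) ?_
    filter_upwards [(hΨ₂ (adjoint Y' w)).ae_tendsto] with k hk
    simp_rw [map_smul, hQadj]
    exact hk.const_smul _
  -- The adjoint of `h23` at z̄ gives Q(z̄)*X'R₃(z̄)* = XR₂(z̄)*J'* − XJ'*R₃(z̄)*, so Q* applied to
  -- the approximants of `Ψ₃ ψ` converges. Replacing the approximants by `Ψ₃ ψ` itself is harmless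
  -- because Q is bounded.
  have hghardy : inner ℂ (Ψ₃ ψ) g = inner ℂ (Ψ₂ (adjoint J' ψ)) (Φ₁ φ) -
      inner ℂ (Ψ₃' ψ) (Φ₁ φ) := by
    have h1 : inner ℂ (Ψ₃ ψ) g =
        ∫ k : ℝ, inner ℂ ((Ψ₂ (adjoint J' ψ) - Ψ₃' ψ : Lp K 2 (volume : Measure ℝ)) k)
          ((Φ₁ φ : ℝ → K) k) := by
      rw [L2.inner_def]
      refine hg _ _ (Lp.memLp _) ?_
      filter_upwards [(hΨ₃ ψ).ae_tendsto, (hΨ₂ (adjoint J' ψ)).ae_tendsto,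
        (hΨ₃' ψ).ae_tendsto, Lp.coeFn_sub (Ψ₂ (adjoint J' ψ)) (Ψ₃' ψ)] with k hk1 hk2 hk3 hk4
      rw [hk4, Pi.sub_apply]
      have h2 : Tendsto (fun ε : ℝ =>
          adjoint (Q ((starRingEnd ℂ) ((k : ℂ) + ε * Complex.I)))
            ((Ψ₃ ψ : ℝ → K) k - X' (starFamily R₃ ((k : ℂ) + ε * Complex.I) ψ)))
          (𝓝[>] 0) (𝓝 0) := by
        have h3 : Tendsto (fun ε : ℝ => C *
            ‖(Ψ₃ ψ : ℝ → K) k - X' (starFamily R₃ ((k : ℂ) + ε * Complex.I) ψ)‖)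
            (𝓝[>] 0) (𝓝 0) := by
          have := ((tendsto_const_nhds (x := (Ψ₃ ψ : ℝ → K) k)).sub hk1).norm.const_mul C
          simpa using this
        refine squeeze_zero_norm' ?_ h3
        filter_upwards [self_mem_nhdsWithin] with ε hε
        have hε' : 0 < ε := hε
        refine ContinuousLinearMap.le_of_opNorm_le _ ?_ _
        rw [LinearIsometryEquiv.norm_map]
        exact hbd _ (by simp [hε'])
      have h4 := h2.add (hk2.sub hk3)
      rw [zero_add] at h4
      refine h4.congr' ?_
      filter_upwards [self_mem_nhdsWithin] with ε hε
      have hε' : 0 < ε := hε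
      have h5 := congrArg (fun S => X (adjoint S ψ))
        (h23 ((starRingEnd ℂ) ((k : ℂ) + ε * Complex.I)) (by simp [hε'.ne']))
      simp only [map_sub, ContinuousLinearMap.adjoint_comp, ContinuousLinearMap.adjoint_adjoint,
        sub_apply, ContinuousLinearMap.comp_apply] at h5
      rw [map_sub, hQadj, hQadj]
      simp only [starFamily, ContinuousLinearMap.comp_apply] at h5 ⊢
      rw [h5]
      abel
    rw [h1, ← L2.inner_def, inner_sub_left]
  -- If Q had boundary values on both sides of the axis, r would be formed from their jump. Only one
  -- property is needed: its Cauchy integral is zero above the axis.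
  set r : Lp K 2 (volume : Measure ℝ) := Φ₁' φ - Φ₂ (Ω φ) - g with hr
  have hrker : ∀ z : ℂ, 0 < z.im → ∫ s : ℝ, ((s : ℂ) - z)⁻¹ • (r : ℝ → K) s = 0 := by
    intro z hz
    have hzi : ((starRingEnd ℂ) z).im ≠ 0 := by simp [hz.ne']
    have h1 : ∫ s : ℝ, ((s : ℂ) - z)⁻¹ • (r : ℝ → K) s =
        (∫ s : ℝ, ((s : ℂ) - z)⁻¹ • (Φ₁' φ : ℝ → K) s) -
        (∫ s : ℝ, ((s : ℂ) - z)⁻¹ • (Φ₂ (Ω φ) : ℝ → K) s) -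
        ∫ s : ℝ, ((s : ℂ) - z)⁻¹ • (g : ℝ → K) s := by
      have i1 := integrable_kernel_smul (Lp.memLp (Φ₁' φ)) hz.ne'
      have i2 := integrable_kernel_smul (Lp.memLp (Φ₂ (Ω φ))) hz.ne'
      have i3 := integrable_kernel_smul (Lp.memLp g) hz.ne'
      have i12 : Integrable fun s : ℝ => ((s : ℂ) - z)⁻¹ • (Φ₁' φ : ℝ → K) s -
          ((s : ℂ) - z)⁻¹ • (Φ₂ (Ω φ) : ℝ → K) s := i1.sub i2
      rw [← integral_sub i1 i2, ← integral_sub i12 i3]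
      refine integral_congr_ae ?_
      filter_upwards [Lp.coeFn_sub (Φ₁' φ - Φ₂ (Ω φ)) g,
        Lp.coeFn_sub (Φ₁' φ) (Φ₂ (Ω φ))] with s h1 h2
      rw [hr, h1, Pi.sub_apply, h2, Pi.sub_apply, smul_sub, smul_sub]
    rw [h1, (hΦ₁' φ).integral_upper z hz, (hΦ₂ (Ω φ)).integral_upper z hz]
    refine ext_inner_left ℂ fun w => ?_
    rw [inner_sub_right, inner_sub_right, hgker z w hz, inner_zero_right, inner_smul_right,
      inner_smul_right]
    set y := adjoint Y' w with hy
    set η := starFamily R₂ ((starRingEnd ℂ) z) y with hη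
    have hη' : η = adjoint (R₂ z) y := by simp [hη, starFamily]
    have h2 : inner ℂ w ((Y'.comp (R₂ z)) (Ω φ)) = inner ℂ η (Ω φ) := by
      rw [hη', hy, ContinuousLinearMap.adjoint_inner_left, ContinuousLinearMap.adjoint_inner_left]
      rfl
    -- By the resolvent identity Ψ₂η = (k − z̄)⁻¹(Ψ₂y − Xη). The constant Xη meets the Cauchy
    -- integral of Φ₁φ at z, which is 2πi·YR₁(z)φ; this supplies the perturbation term of `h12`.
    have h3 : inner ℂ (Ψ₂ η) (Φ₁ φ) =
        (∫ k : ℝ, inner ℂ (((k : ℂ) - (starRingEnd ℂ) z)⁻¹ • (Ψ₂ y : ℝ → K) k)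
          ((Φ₁ φ : ℝ → K) k)) -
        inner ℂ (X η) ((2 * Real.pi * Complex.I : ℂ) • Y (R₁ z φ)) := by
      have h4 := (hΦ₁ φ).integral_upper z hz
      rw [ContinuousLinearMap.comp_apply] at h4
      rw [← h4, inner_integral_kernel_smul (Lp.memLp _) hz.ne', L2.inner_def,
        ← integral_sub]
      · refine integral_congr_ae ?_
        filter_upwards [hΨ₂.apply_resolvent hres.star hzi y] with k hk
        rw [hk, smul_sub, inner_sub_left]
      · exact integrable_inner_of_memLp ((Lp.memLp (Ψ₂ y)).smul (p := ∞) (r := 2)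
          (memLp_top_of_bound (continuous_kernel hzi).aestronglyMeasurable _
            (ae_of_all _ fun k => norm_kernel_le hzi k))) (Lp.memLp _)
      · exact integrable_inner_of_memLp (memLp_kernel_smul_const hzi _) (Lp.memLp _)
    have h5 := congrArg (fun S : H →L[ℂ] H => inner ℂ y (S φ)) (h12 z hz.ne')
    simp only [sub_apply, ContinuousLinearMap.comp_apply,
      inner_sub_right] at h5
    have h6 : inner ℂ w (((Y'.comp J).comp (R₁ z)) φ) = inner ℂ y (J (R₁ z φ)) := by
      rw [hy, ContinuousLinearMap.adjoint_inner_left]; rfl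
    have h7 : inner ℂ η (J φ) = inner ℂ y (R₂ z (J φ)) := by
      rw [hη', ContinuousLinearMap.adjoint_inner_left]
    have h8 : inner ℂ (X η) (Y (R₁ z φ)) = inner ℂ y (R₂ z (adjoint X (Y (R₁ z φ)))) := by
      rw [← ContinuousLinearMap.adjoint_inner_right, hη', ContinuousLinearMap.adjoint_inner_left]
    rw [h6, h2, hΩ, inner_waveOperator, h7, h3, inner_smul_right, h8, mul_sub, ← mul_assoc,
      mul_inv_cancel₀ Complex.two_pi_I_ne_zero, one_mul, ← h5]
    ring
  -- In the pairing with `Ψ₃ ψ` the remainder r drops out, so Φ₂(Ωφ) may be replaced there by Φ₁'φ −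
  -- g.
  have horth := (hΨ₃ ψ).integral_inner_eq_zero (hX' ψ) (Lp.memLp r) hrker
  rw [← L2.inner_def, ← inner_conj_symm, map_eq_zero, hr, inner_sub_right, inner_sub_right,
    hghardy] at horth
  have hfin : inner ℂ (Ψ₃ ψ) (Φ₂ (Ω φ)) = inner ℂ (Ψ₃ ψ) (Φ₁' φ) -
      inner ℂ (Ψ₂ (adjoint J' ψ)) (Φ₁ φ) + inner ℂ (Ψ₃' ψ) (Φ₁ φ) := by
    linear_combination -horth
  have hJ : inner ℂ ψ (J' (Ω φ)) = inner ℂ ψ (J' (J φ)) -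
      (2 * Real.pi * Complex.I : ℂ)⁻¹ * inner ℂ (Ψ₂ (adjoint J' ψ)) (Φ₁ φ) := by
    rw [← ContinuousLinearMap.adjoint_inner_left, hΩ, inner_waveOperator,
      ContinuousLinearMap.adjoint_inner_left]
  rw [ContinuousLinearMap.comp_apply, inner_waveOperator, hfin, hJ]
  simp only [sub_apply, ContinuousLinearMap.comp_apply,
    smul_apply, inner_sub_right, inner_smul_right,
    ContinuousLinearMap.adjoint_inner_right]
  ring

end WaveOperators

/-! ### Vanishing of the wave operator with a smooth identification -/

theorem IsResolventFamily.commutator_identity {H : Type*} [NormedAddCommGroup H]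
    [InnerProductSpace ℂ H] {R : ℂ → H →L[ℂ] H} (hR : IsResolventFamily R)
    {P D : H →L[ℂ] H}
    (hD : ∀ z : ℂ, z.im ≠ 0 → P.comp (R z) - (R z).comp P = (R z).comp (D.comp (R z)))
    {z w : ℂ} (hz : z.im ≠ 0) (hw : w.im ≠ 0) :
    (R w).comp (D.comp (R z)) =
      P.comp (R z) - (R w).comp P + (w - z) • (R w).comp (P.comp (R z)) := by
  ext x
  have h1 : ∀ y, R w y = R z y + (w - z) • R w (R z y) := fun y => by
    have := congrArg (fun S : H →L[ℂ] H => S y) (hR w z hw hz)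
    simp only [sub_apply, smul_apply, ContinuousLinearMap.comp_apply] at this
    rw [← this]; abel
  have h2 : R z (D (R z x)) = P (R z x) - R z (P x) := by
    have := congrArg (fun S : H →L[ℂ] H => S x) (hD z hz)
    simpa using this.symm
  simp only [sub_apply, smul_apply, add_apply, ContinuousLinearMap.comp_apply]
  rw [h1 (D (R z x)), h2, map_sub, smul_sub, h1 (P x)]
  abel

section Commutator

variable {H K : Type*} [NormedAddCommGroup H] [InnerProductSpace ℂ H] [CompleteSpace H]
  [NormedAddCommGroup K] [InnerProductSpace ℂ K] [CompleteSpace K]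

theorem integral_kernel_sub_kernel_I :
    Integrable (fun k : ℝ => ((k : ℂ) - Complex.I)⁻¹ - ((k : ℂ) - -Complex.I)⁻¹) ∧
    ∫ k : ℝ, (((k : ℂ) - Complex.I)⁻¹ - ((k : ℂ) - -Complex.I)⁻¹) = 2 * Real.pi * Complex.I := by
  have h : ∀ k : ℝ, ((k : ℂ) - Complex.I)⁻¹ - ((k : ℂ) - -Complex.I)⁻¹ =
      (2 * Real.pi * Complex.I : ℂ) *
        ((1 / Real.pi * ‖((k : ℂ) - ((0 : ℝ) + (1 : ℝ) * Complex.I))⁻¹‖ ^ 2 : ℝ) : ℂ) := by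
    intro k
    rw [← poisson_kernel_eq one_pos]
    simp
  simp_rw [h]
  constructor
  · exact (((integrable_kernel_sq (by simp)).const_mul _).ofReal).const_mul _
  · rw [integral_const_mul, integral_complex_ofReal, integral_poisson one_pos]
    simp

/-- The wave operator for a pair of equal operators with a smooth identification vanishes. -/
theorem boundary_commutator {R : ℂ → H →L[ℂ] H} (hR : IsResolventFamily R) {P : H →L[ℂ] H}
    (hP : P.comp P = P) {A B : H →L[ℂ] K}
    (hcomm : ∀ z : ℂ, z.im ≠ 0 → P.comp (R z) - (R z).comp P = (R z).comp
      ((P.comp ((adjoint B).comp A) - ((adjoint B).comp A).comp P).comp (R z)))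
    (hdense : DenseRange (R (-Complex.I))) (hdense' : DenseRange (starFamily R (-Complex.I)))
    {ΦA ΦAP ΨB ΨBP : H →L[ℂ] Lp K 2 (volume : Measure ℝ)}
    {ΦP ΨP : H →L[ℂ] Lp H 2 (volume : Measure ℝ)}
    (hΦA : IsBoundaryOperator (fun z => A.comp (R z)) ΦA)
    (hΦAP : IsBoundaryOperator (fun z => (A.comp P).comp (R z)) ΦAP)
    (hΨB : IsBoundaryOperator (fun z => B.comp (starFamily R z)) ΨB)
    (hΨBP : IsBoundaryOperator (fun z => (B.comp (adjoint P)).comp (starFamily R z)) ΨBP)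
    (hΦP : IsBoundaryOperator (fun z => P.comp (R z)) ΦP)
    (hΨP : IsBoundaryOperator (fun z => (adjoint P).comp (starFamily R z)) ΨP) :
    (adjoint ΨBP).comp ΦA - (adjoint ΨB).comp ΦAP = (2 * Real.pi * Complex.I : ℂ) • P := by
  have hI : (-Complex.I).im ≠ 0 := by simp
  have hI' : (starRingEnd ℂ (-Complex.I)).im ≠ 0 := by simp
  -- On the dense ranges of the resolvents at −i the boundary values acquire a factor (k + i)⁻¹,
  -- which makes each term of the boundary identity integrable after the constants are combined.
  suffices h : ∀ φ ψ : H, inner ℂ (starFamily R (-Complex.I) ψ)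
      (((adjoint ΨBP).comp ΦA - (adjoint ΨB).comp ΦAP) (R (-Complex.I) φ)) =
      inner ℂ (starFamily R (-Complex.I) ψ)
        (((2 * Real.pi * Complex.I : ℂ) • P) (R (-Complex.I) φ)) by
    have h1 : ∀ φ, ((adjoint ΨBP).comp ΦA - (adjoint ΨB).comp ΦAP) (R (-Complex.I) φ) =
        ((2 * Real.pi * Complex.I : ℂ) • P) (R (-Complex.I) φ) := by
      intro φ
      refine ext_inner_left ℂ fun v => ?_
      have h2 : ∀ a : H, Continuous fun v : H => (inner ℂ v a : ℂ) := fun a => by fun_prop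
      exact congrFun (hdense'.equalizer (h2 _) (h2 _) (funext fun ψ => h φ ψ)) v
    refine ContinuousLinearMap.ext fun x => ?_
    refine congrFun (hdense.equalizer (ContinuousLinearMap.continuous _)
      (ContinuousLinearMap.continuous _) ?_) x
    funext φ
    exact h1 φ
  intro φ' ψ'
  set φ := R (-Complex.I) φ' with hφ
  set ψ := starFamily R (-Complex.I) ψ' with hψ
  -- Apply `commutator_identity` with z = k + iε and w = z̄. The extra term carries w − z = −2iε;
  -- writing P = P·P splits it into a pairing of PR(z)φ with P*R(z̄)*ψ, both of which have boundary
  -- values, so it vanishes in the limit.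
  have hpt : ∀ᵐ k : ℝ, inner ℂ ((ΨBP ψ : ℝ → K) k) ((ΦA φ : ℝ → K) k) -
      inner ℂ ((ΨB ψ : ℝ → K) k) ((ΦAP φ : ℝ → K) k) =
      inner ℂ ψ ((ΦP φ : ℝ → H) k) - inner ℂ ((ΨP ψ : ℝ → H) k) φ := by
    filter_upwards [(hΨBP ψ).ae_tendsto, (hΦA φ).ae_tendsto, (hΨB ψ).ae_tendsto,
      (hΦAP φ).ae_tendsto, (hΦP φ).ae_tendsto, (hΨP ψ).ae_tendsto] with k h1 h2 h3 h4 h5 h6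
    have hε0 : Tendsto (fun ε : ℝ => -(2 * (ε : ℂ) * Complex.I)) (𝓝[>] 0) (𝓝 0) := by
      have : Continuous fun ε : ℝ => -(2 * (ε : ℂ) * Complex.I) := by fun_prop
      have h := this.tendsto 0
      simp only [Complex.ofReal_zero, mul_zero, zero_mul, neg_zero] at h
      exact h.mono_left nhdsWithin_le_nhds
    have hl := (h1.inner h2 (𝕜 := ℂ)).sub (h3.inner h4 (𝕜 := ℂ))
    have hr := (((tendsto_const_nhds (x := ψ)).inner h5 (𝕜 := ℂ)).sub
      (h6.inner (tendsto_const_nhds (x := φ)) (𝕜 := ℂ))).add (hε0.mul (h6.inner h5 (𝕜 := ℂ)))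
    rw [zero_mul, add_zero] at hr
    refine tendsto_nhds_unique hl (hr.congr' ?_)
    filter_upwards [self_mem_nhdsWithin] with ε hε
    have hε' : 0 < ε := hε
    set z : ℂ := (k : ℂ) + ε * Complex.I with hz
    have hzi : z.im ≠ 0 := by simp [hz, hε'.ne']
    have hzc : ((starRingEnd ℂ) z).im ≠ 0 := by simpa using hzi
    have hid := congrArg (fun S : H →L[ℂ] H => inner ℂ ψ (S φ))
      (hR.commutator_identity hcomm hzi hzc)
    have hsub : (starRingEnd ℂ) z - z = -(2 * (ε : ℂ) * Complex.I) := by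
      simp [hz]; ring
    rw [hsub] at hid
    simp only [sub_apply, smul_apply, add_apply, ContinuousLinearMap.comp_apply, map_sub,
      inner_sub_right, inner_add_right, inner_smul_right] at hid
    have e1 : ∀ x : H, inner ℂ ((adjoint P) (starFamily R z ψ)) x =
        inner ℂ ψ (R ((starRingEnd ℂ) z) (P x)) := fun x => by
      rw [starFamily, ContinuousLinearMap.adjoint_inner_left,
        ContinuousLinearMap.adjoint_inner_left]
    have e2 : inner ℂ (B ((adjoint P) (starFamily R z ψ))) (A (R z φ)) =
        inner ℂ ψ (R ((starRingEnd ℂ) z) (P ((adjoint B) (A (R z φ))))) := by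
      rw [← ContinuousLinearMap.adjoint_inner_right, e1]
    have e3 : inner ℂ (B (starFamily R z ψ)) (A (P (R z φ))) =
        inner ℂ ψ (R ((starRingEnd ℂ) z) ((adjoint B) (A (P (R z φ))))) := by
      rw [← ContinuousLinearMap.adjoint_inner_right, starFamily,
        ContinuousLinearMap.adjoint_inner_left]
    have e4 : P (P (R z φ)) = P (R z φ) := congrArg (fun S : H →L[ℂ] H => S (R z φ)) hP
    simp only [ContinuousLinearMap.comp_apply]
    rw [e1, e1, e2, e3, e4]
    linear_combination -hid
  have hφk := hΦP.apply_resolvent hR hI φ'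
  have hψk := hΨP.apply_resolvent hR.star hI ψ'
  have mΦ := integrable_kernel_smul (Lp.memLp (ΦP φ')) hI
  have mΨ := integrable_kernel_smul (Lp.memLp (ΨP ψ')) hI
  have hPφ : inner ℂ (adjoint P ψ) φ = inner ℂ ψ (P φ) :=
    ContinuousLinearMap.adjoint_inner_left _ _ _
  -- The constants from the two resolvent formulas combine into (k − i)⁻¹ − (k + i)⁻¹. Neither
  -- kernel is integrable alone, but their difference is, with integral 2πi.
  have hpt2 : ∀ᵐ k : ℝ, inner ℂ ((ΨBP ψ : ℝ → K) k) ((ΦA φ : ℝ → K) k) -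
      inner ℂ ((ΨB ψ : ℝ → K) k) ((ΦAP φ : ℝ → K) k) =
      inner ℂ ψ (((k : ℂ) - -Complex.I)⁻¹ • (ΦP φ' : ℝ → H) k) -
      inner ℂ (((k : ℂ) - -Complex.I)⁻¹ • (ΨP ψ' : ℝ → H) k) φ +
      (((k : ℂ) - Complex.I)⁻¹ - ((k : ℂ) - -Complex.I)⁻¹) * inner ℂ ψ (P φ) := by
    filter_upwards [hpt, hφk, hψk] with k h1 h2 h3
    rw [h1, h2, h3, smul_sub, smul_sub, inner_sub_left, inner_sub_right, ← hφ, ← hψ,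
      inner_smul_right _ (P φ), inner_smul_left ((adjoint P) ψ), hPφ, conj_kernel]
    simp only [map_neg, Complex.conj_I, neg_neg]
    ring
  have i1 : Integrable fun k : ℝ => inner ℂ ((ΨBP ψ : ℝ → K) k) ((ΦA φ : ℝ → K) k) :=
    L2.integrable_inner _ _
  have i2 : Integrable fun k : ℝ => inner ℂ ((ΨB ψ : ℝ → K) k) ((ΦAP φ : ℝ → K) k) :=
    L2.integrable_inner _ _
  have i3 : Integrable fun k : ℝ => inner ℂ ψ (((k : ℂ) - -Complex.I)⁻¹ • (ΦP φ' : ℝ → H) k) :=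
    mΦ.const_inner ψ
  have i4 : Integrable fun k : ℝ => inner ℂ (((k : ℂ) - -Complex.I)⁻¹ • (ΨP ψ' : ℝ → H) k) φ :=
    mΨ.inner_const φ
  have i34 : Integrable fun k : ℝ => inner ℂ ψ (((k : ℂ) - -Complex.I)⁻¹ • (ΦP φ' : ℝ → H) k) -
      inner ℂ (((k : ℂ) - -Complex.I)⁻¹ • (ΨP ψ' : ℝ → H) k) φ := i3.sub i4
  -- The point −i lies below the axis, where the Cauchy integral of a Hardy boundary function is
  -- zero.
  have e3 : ∫ k : ℝ, inner ℂ ψ (((k : ℂ) - -Complex.I)⁻¹ • (ΦP φ' : ℝ → H) k) = 0 := by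
    rw [integral_inner mΦ, (hΦP φ').integral_lower _ (by simp), inner_zero_right]
  have e4 : ∫ k : ℝ, inner ℂ (((k : ℂ) - -Complex.I)⁻¹ • (ΨP ψ' : ℝ → H) k) φ = 0 := by
    have : ∀ k : ℝ, inner ℂ (((k : ℂ) - -Complex.I)⁻¹ • (ΨP ψ' : ℝ → H) k) φ =
        (starRingEnd ℂ) (inner ℂ φ (((k : ℂ) - -Complex.I)⁻¹ • (ΨP ψ' : ℝ → H) k)) := fun k => by
      rw [inner_conj_symm]
    simp_rw [this]
    rw [integral_conj, integral_inner mΨ, (hΨP ψ').integral_lower _ (by simp), inner_zero_right,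
      map_zero]
  simp only [sub_apply, smul_apply, ContinuousLinearMap.comp_apply, inner_sub_right,
    ContinuousLinearMap.adjoint_inner_right, inner_smul_right]
  rw [L2.inner_def, L2.inner_def, ← integral_sub i1 i2, integral_congr_ae hpt2,
    integral_add i34 (integral_kernel_sub_kernel_I.1.mul_const _), integral_sub i3 i4, e3, e4,
    integral_mul_const, integral_kernel_sub_kernel_I.2]
  ring

end Commutator

/-! ### Resolvents of unbounded operators and of their adjoints -/

section Resolvent

variable {H : Type*} [NormedAddCommGroup H] [InnerProductSpace ℂ H]
  {S : H →ₗ.[ℂ] H} {z w : ℂ}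

theorem IsResolventAt.unique {R R' : H →L[ℂ] H} (h : IsResolventAt S z R)
    (h' : IsResolventAt S z R') : R = R' := by
  ext x
  obtain ⟨hd, hx⟩ := h.1 x
  have := h'.2 ⟨R x, hd⟩
  rw [hx] at this
  exact this.symm

theorem opResolvent_spec (hz : z ∈ opResolventSet S) : IsResolventAt S z (opResolvent S z) := by
  have h : ∃ R : H →L[ℂ] H, IsResolventAt S z R := hz
  rw [opResolvent, dif_pos h]
  exact h.choose_spec

theorem IsResolventAt.opResolvent_eq {R : H →L[ℂ] H} (h : IsResolventAt S z R) :
    opResolvent S z = R :=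
  (opResolvent_spec ⟨R, h⟩).unique h

theorem opResolvent_of_notMem (hz : z ∉ opResolventSet S) : opResolvent S z = 0 :=
  dif_neg hz

theorem opResolvent_sub (hz : z ∈ opResolventSet S) (hw : w ∈ opResolventSet S) :
    opResolvent S z - opResolvent S w =
      (z - w) • (opResolvent S z).comp (opResolvent S w) := by
  ext x
  obtain ⟨hd, hx⟩ := (opResolvent_spec hw).1 x
  have h1 := (opResolvent_spec hz).2 ⟨_, hd⟩
  have h2 : S ⟨opResolvent S w x, hd⟩ - z • opResolvent S w x =
      x + (w - z) • opResolvent S w x := by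
    rw [sub_eq_iff_eq_add.1 hx, sub_smul]; abel
  simp only at h1
  rw [h2, map_add, map_smul] at h1
  simp only [sub_apply, smul_apply, ContinuousLinearMap.comp_apply]
  linear_combination (norm := module) h1

theorem opResolvent_comp_comm (hz : z ∈ opResolventSet S) (hw : w ∈ opResolventSet S) :
    (opResolvent S z).comp (opResolvent S w) = (opResolvent S w).comp (opResolvent S z) := by
  rcases eq_or_ne z w with rfl | hne
  · rfl
  · have h1 := opResolvent_sub hz hw
    have h2 := opResolvent_sub hw hz
    rw [← neg_sub, h2, ← neg_smul, neg_sub] at h1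
    exact (smul_right_injective _ (sub_ne_zero.2 hne) h1).symm

theorem denseRange_opResolvent {T : H →ₗ.[ℂ] H} (hT : Dense (T.domain : Set H)) (hz : z ∈ opResolventSet T) :
    DenseRange (opResolvent T z) := by
  refine hT.mono ?_
  intro x hx
  exact ⟨_, (opResolvent_spec hz).2 ⟨x, hx⟩⟩

variable [CompleteSpace H]

theorem IsResolventAt.neumann {R : H →L[ℂ] H} (h : IsResolventAt S z R)
    (hw : ‖(w - z) • R‖ < 1) :
    IsResolventAt S w (R * Ring.inverse (1 - (w - z) • R)) := by
  set N := Ring.inverse (1 - (w - z) • R) with hN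
  have hu : IsUnit (1 - (w - z) • R) := isUnit_one_sub_of_norm_lt_one hw
  have h1 : (1 - (w - z) • R) * N = 1 := Ring.mul_inverse_cancel _ hu
  have h1' : N * (1 - (w - z) • R) = 1 := Ring.inverse_mul_cancel _ hu
  have hcomm : R * N = N * R := by
    have hu' : (1 - (w - z) • R) * R = R * (1 - (w - z) • R) := by
      rw [sub_mul, mul_sub, one_mul, mul_one, smul_mul_assoc, mul_smul_comm]
    calc R * N = N * ((1 - (w - z) • R) * R) * N := by rw [← mul_assoc, h1', one_mul]
      _ = N * R * ((1 - (w - z) • R) * N) := by rw [hu', mul_assoc, mul_assoc, mul_assoc]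
      _ = N * R := by rw [h1, mul_one]
  constructor
  · intro x
    obtain ⟨hd, hx⟩ := h.1 (N x)
    refine ⟨hd, ?_⟩
    have h2 := congrArg (fun T : H →L[ℂ] H => T x) h1
    simp only [sub_mul, one_mul, sub_apply, smul_mul_assoc, smul_apply,
      mul_apply_eq_comp, one_apply_eq_self] at h2
    change S ⟨R (N x), hd⟩ - w • R (N x) = x
    linear_combination (norm := module) hx + h2
  · intro x
    have h2 := h.2 x
    have h3 : S x - w • (x : H) = (S x - z • (x : H)) - (w - z) • (x : H) := by
      rw [sub_smul]; abel
    have h4 := congrArg (fun T : H →L[ℂ] H => T (x : H)) h1'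
    simp only [mul_apply_eq_comp, sub_apply, smul_apply,
      one_apply_eq_self] at h4
    rw [hcomm, mul_apply_eq_comp, h3, map_sub, h2, map_smul]
    exact h4

theorem eventually_opResolvent_eq (hz : z ∈ opResolventSet S) :
    ∀ᶠ w in 𝓝 z, IsResolventAt S w
      (opResolvent S z * Ring.inverse (1 - (w - z) • opResolvent S z)) := by
  have hc : ContinuousAt (fun w : ℂ => ‖(w - z) • opResolvent S z‖) z := by fun_prop
  have h0 : ‖(z - z) • opResolvent S z‖ < 1 := by simp
  filter_upwards [hc.eventually_lt continuousAt_const h0] with w hw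
  exact (opResolvent_spec hz).neumann hw

theorem isOpen_opResolventSet : IsOpen (opResolventSet S) := by
  refine isOpen_iff_mem_nhds.2 fun z hz => ?_
  filter_upwards [eventually_opResolvent_eq hz] with w hw
  exact ⟨_, hw⟩

theorem differentiableAt_opResolvent (hz : z ∈ opResolventSet S) :
    DifferentiableAt ℂ (opResolvent S) z := by
  have h : (fun w => opResolvent S z * Ring.inverse (1 - (w - z) • opResolvent S z)) =ᶠ[𝓝 z]
      opResolvent S := by
    filter_upwards [eventually_opResolvent_eq hz] with w hw
    exact hw.opResolvent_eq.symm
  refine DifferentiableAt.congr_of_eventuallyEq ?_ h.symm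
  refine DifferentiableAt.const_mul ?_ _
  have h1 : DifferentiableAt ℂ (Ring.inverse : (H →L[ℂ] H) → (H →L[ℂ] H))
      (1 - (z - z) • opResolvent S z) := by
    rw [sub_self, zero_smul, sub_zero]
    exact differentiableAt_inverse isUnit_one
  have h2 : DifferentiableAt ℂ (fun w : ℂ => (1 : H →L[ℂ] H) - (w - z) • opResolvent S z) z := by
    fun_prop
  exact DifferentiableAt.comp (g := Ring.inverse) z h1 h2

theorem isResolventAt_adjoint {R : H →L[ℂ] H} (hS : Dense (S.domain : Set H))
    (h : IsResolventAt S z R) : IsResolventAt S.adjoint ((starRingEnd ℂ) z)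
      (adjoint R) := by
  constructor
  · intro x
    have key : ∀ y : S.domain, inner ℂ (x + (starRingEnd ℂ) z • adjoint R x) (y : H) =
        inner ℂ (adjoint R x) (S y) := by
      intro y
      have h1 : inner ℂ x (R (S y - z • (y : H))) = inner ℂ x (y : H) := by rw [h.2 y]
      rw [← ContinuousLinearMap.adjoint_inner_left, inner_sub_right, inner_smul_right] at h1
      rw [inner_add_left, inner_smul_left, ← h1]
      simp
    have hd : adjoint R x ∈ S.adjoint.domain :=
      LinearPMap.mem_adjoint_domain_of_exists _ ⟨_, key⟩
    refine ⟨hd, ?_⟩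
    rw [LinearPMap.adjoint_apply_eq hS ⟨_, hd⟩ key]
    simp
  · intro x
    refine ext_inner_right ℂ fun y => ?_
    obtain ⟨hd, hy⟩ := h.1 y
    have h2 := LinearPMap.adjoint_isFormalAdjoint hS x ⟨_, hd⟩
    rw [ContinuousLinearMap.adjoint_inner_left, inner_sub_left, inner_smul_left, h2]
    conv_rhs => rw [← hy]
    rw [inner_sub_right, inner_smul_right]
    simp

/-- The adjoint of the given resolvent is a bounded left inverse of S − z. The range of S − z is
dense, since a vector orthogonal to it would be annihilated by S* − z̄, and closedness of S extends
the inverse from the range to the whole space. -/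
theorem mem_opResolventSet_of_adjoint (hS : Dense (S.domain : Set H)) (hc : S.IsClosed)
    (h : (starRingEnd ℂ) z ∈ opResolventSet S.adjoint) : z ∈ opResolventSet S := by
  obtain ⟨R', hR'⟩ := h
  have hleft : ∀ x : S.domain, adjoint R' (S x - z • (x : H)) = (x : H) := by
    intro x
    refine ext_inner_right ℂ fun y => ?_
    obtain ⟨hd, hy⟩ := hR'.1 y
    have h2 := (LinearPMap.adjoint_isFormalAdjoint hS).symm x ⟨_, hd⟩
    rw [ContinuousLinearMap.adjoint_inner_left, inner_sub_left, inner_smul_left, h2]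
    conv_rhs => rw [← hy]
    rw [inner_sub_right, inner_smul_right]
  let A : S.domain →ₗ[ℂ] H := S.toFun - z • S.domain.subtype
  have hA : ∀ x, A x = S x - z • (x : H) := fun x => rfl
  have hdense : Dense ((LinearMap.range A : Submodule ℂ H) : Set H) := by
    rw [Submodule.dense_iff_topologicalClosure_eq_top, Submodule.topologicalClosure_eq_top_iff,
      Submodule.eq_bot_iff]
    intro v hv
    rw [Submodule.mem_orthogonal'] at hv
    have key : ∀ x : S.domain, inner ℂ ((starRingEnd ℂ) z • v) (x : H) = inner ℂ v (S x) := by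
      intro x
      have h1 := hv (A x) (LinearMap.mem_range_self A x)
      rw [hA, inner_sub_right, inner_smul_right, sub_eq_zero] at h1
      rw [h1, inner_smul_left, Complex.conj_conj]
    have hd : v ∈ S.adjoint.domain := LinearPMap.mem_adjoint_domain_of_exists _ ⟨_, key⟩
    have h3 := hR'.2 ⟨v, hd⟩
    rw [LinearPMap.adjoint_apply_eq hS ⟨v, hd⟩ key] at h3
    simpa using h3.symm
  refine ⟨adjoint R', fun y => ?_, hleft⟩
  obtain ⟨u, hu, hlim⟩ := mem_closure_iff_seq_limit.1 (hdense y)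
  choose x hx using hu
  have h1 : ∀ n, adjoint R' (u n) = x n := fun n => by rw [← hx n, hA, hleft]
  have h2 : Tendsto (fun n => ((x n : H))) atTop (𝓝 (adjoint R' y)) := by
    simp_rw [← h1]
    exact ((adjoint R').continuous.tendsto y).comp hlim
  have h3 : Tendsto (fun n => S (x n)) atTop (𝓝 (y + z • adjoint R' y)) := by
    have : ∀ n, S (x n) = u n + z • (x n : H) := fun n => by rw [← hx n, hA]; abel
    simp_rw [this]
    exact hlim.add (h2.const_smul z)
  have h4 : (adjoint R' y, y + z • adjoint R' y) ∈ S.graph :=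
    IsClosed.mem_of_tendsto hc (h2.prodMk_nhds h3)
      (Eventually.of_forall fun n => S.mem_graph (x n))
  rw [LinearPMap.mem_graph_iff] at h4
  obtain ⟨v, hv1, hv2⟩ := h4
  have hd : adjoint R' y ∈ S.domain := by
    have := v.2
    rwa [hv1] at this
  refine ⟨hd, ?_⟩
  have : (⟨adjoint R' y, hd⟩ : S.domain) = v := Subtype.ext hv1.symm
  rw [this, hv2]
  exact add_sub_cancel_right _ _

theorem mem_opResolventSet_adjoint (hS : Dense (S.domain : Set H)) (hc : S.IsClosed) :
    z ∈ opResolventSet S.adjoint ↔ (starRingEnd ℂ) z ∈ opResolventSet S := by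
  constructor
  · intro h
    refine mem_opResolventSet_of_adjoint hS hc ?_
    simpa using h
  · rintro ⟨R, hR⟩
    have := isResolventAt_adjoint hS hR
    rw [Complex.conj_conj] at this
    exact ⟨_, this⟩

/-- The equality holds at every point: on the spectrum both sides have the default value zero. -/
theorem opResolvent_adjoint (hS : Dense (S.domain : Set H)) (hc : S.IsClosed) :
    opResolvent S.adjoint = starFamily (opResolvent S) := by
  funext z
  by_cases hz : z ∈ opResolventSet S.adjoint
  · have h := isResolventAt_adjoint hS (opResolvent_spec ((mem_opResolventSet_adjoint hS hc).1 hz))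
    rw [Complex.conj_conj] at h
    exact h.opResolvent_eq
  · rw [opResolvent_of_notMem hz, starFamily, opResolvent_of_notMem, map_zero]
    rwa [← mem_opResolventSet_adjoint hS hc]

end Resolvent

/-! ### The second resolvent identity -/

section Perturbation

variable {H : Type*} [NormedAddCommGroup H] [InnerProductSpace ℂ H] [CompleteSpace H]
  {K : Type*} [NormedAddCommGroup K] [InnerProductSpace ℂ K] [CompleteSpace K]
  {T : H →ₗ.[ℂ] H} {A B : H →L[ℂ] K} {z : ℂ}

theorem perturbed_apply (x : H) (hx : x ∈ T.domain) (hx' : x ∈ (perturbed T A B).domain) :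
    perturbed T A B ⟨x, hx'⟩ = adjoint B (A x) + T ⟨x, hx⟩ := rfl

theorem perturbed_isClosed (hT : T.IsClosed) : (perturbed T A B).IsClosed := by
  have h : ((perturbed T A B).graph : Set (H × H)) =
      (fun p : H × H => (p.1, p.2 - adjoint B (A p.1))) ⁻¹' T.graph := by
    ext ⟨x, y⟩
    simp only [Set.mem_preimage, SetLike.mem_coe, LinearPMap.mem_graph_iff]
    constructor
    · rintro ⟨v, hv1, hv2⟩
      refine ⟨v, hv1, ?_⟩
      rw [← hv2, ← hv1]
      exact (add_sub_cancel_left _ _).symm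
    · rintro ⟨v, hv1, hv2⟩
      refine ⟨v, hv1, ?_⟩
      have : perturbed T A B v = adjoint B (A v) + T v := rfl
      rw [this, hv2, hv1]
      abel
  unfold LinearPMap.IsClosed
  rw [h]
  exact IsClosed.preimage (by fun_prop) hT

/-- Both orders of the factors are needed. After taking adjoints this one expresses BR_V* through
BR₀*; the other expresses AR_V through AR₀. -/
theorem opResolvent_perturbed_right (h0 : z ∈ opResolventSet T)
    (hV : z ∈ opResolventSet (perturbed T A B)) :
    opResolvent (perturbed T A B) z = opResolvent T z -
      (opResolvent T z).comp (((adjoint B).comp A).comp (opResolvent (perturbed T A B) z)) := by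
  ext x
  obtain ⟨hd, hx⟩ := (opResolvent_spec hV).1 x
  have hd' : opResolvent (perturbed T A B) z x ∈ T.domain := hd
  have h1 := (opResolvent_spec h0).2 ⟨_, hd'⟩
  rw [perturbed_apply _ hd'] at hx
  have h2 : T ⟨opResolvent (perturbed T A B) z x, hd'⟩ - z • opResolvent (perturbed T A B) z x =
      x - adjoint B (A (opResolvent (perturbed T A B) z x)) := by
    linear_combination (norm := module) hx
  simp only at h1
  rw [h2, map_sub] at h1
  simpa using h1.symm

theorem opResolvent_perturbed_left (h0 : z ∈ opResolventSet T)
    (hV : z ∈ opResolventSet (perturbed T A B)) :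
    opResolvent (perturbed T A B) z = opResolvent T z -
      (opResolvent (perturbed T A B) z).comp (((adjoint B).comp A).comp (opResolvent T z)) := by
  ext x
  obtain ⟨hd, hx⟩ := (opResolvent_spec h0).1 x
  have hd' : opResolvent T z x ∈ (perturbed T A B).domain := hd
  have h1 := (opResolvent_spec hV).2 ⟨_, hd'⟩
  rw [perturbed_apply _ hd] at h1
  have h2 : adjoint B (A (opResolvent T z x)) + T ⟨opResolvent T z x, hd⟩ -
      z • opResolvent T z x = x + adjoint B (A (opResolvent T z x)) := by
    linear_combination (norm := module) hx
  simp only at h1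
  rw [h2, map_add] at h1
  simp only [sub_apply, ContinuousLinearMap.comp_apply]
  exact eq_sub_of_add_eq h1

/-- The adjoint of an injective operator has dense range. -/
theorem denseRange_starFamily_opResolvent (hz : (starRingEnd ℂ) z ∈ opResolventSet T) :
    DenseRange (starFamily (opResolvent T) z) := by
  have h : Dense ((LinearMap.range (starFamily (opResolvent T) z : H →ₗ[ℂ] H) : Submodule ℂ H) :
      Set H) := by
    rw [Submodule.dense_iff_topologicalClosure_eq_top, Submodule.topologicalClosure_eq_top_iff,
      Submodule.eq_bot_iff]
    intro v hv
    rw [Submodule.mem_orthogonal] at hv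
    have h1 : opResolvent T ((starRingEnd ℂ) z) v = 0 := by
      refine ext_inner_left ℂ fun y => ?_
      rw [inner_zero_right, ← ContinuousLinearMap.adjoint_inner_left]
      exact hv _ ⟨y, rfl⟩
    obtain ⟨hd, hx⟩ := (opResolvent_spec hz).1 v
    have h2 : (⟨_, hd⟩ : T.domain) = 0 := Subtype.ext h1
    rw [h2, h1] at hx
    simpa using hx.symm
  exact h

end Perturbation

/-! ### Riesz projections at isolated points -/

section CircleIntegral

theorem circleIntegral_comp_comm {E F : Type*} [NormedAddCommGroup E] [NormedSpace ℂ E]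
    [NormedAddCommGroup F] [NormedSpace ℂ F] [CompleteSpace E] [CompleteSpace F]
    (L : E →L[ℂ] F) {f : ℂ → E} {c : ℂ} {r : ℝ} (hf : CircleIntegrable f c r) :
    (∮ z in C(c, r), L (f z)) = L (∮ z in C(c, r), f z) := by
  rw [circleIntegral, circleIntegral, ← L.intervalIntegral_comp_comm hf.out]
  simp

theorem circleIntegral_sub_inv_of_lt {μ w : ℂ} {r : ℝ} (hr : 0 ≤ r) (h : r < ‖w - μ‖) :
    (∮ z in C(μ, r), (z - w)⁻¹) = 0 := by
  have hne : ∀ z ∈ Metric.closedBall μ r, z - w ≠ 0 := by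
    intro z hz h0
    rw [sub_eq_zero.1 h0, Metric.mem_closedBall, dist_eq_norm] at hz
    exact absurd hz (not_le.2 h)
  refine Complex.circleIntegral_eq_zero_of_differentiable_on_off_countable hr Set.countable_empty
    ?_ ?_
  · exact ContinuousOn.inv₀ (by fun_prop) hne
  · intro z hz
    exact DifferentiableAt.inv (by fun_prop) (hne z (Metric.ball_subset_closedBall hz.1))

theorem conj_circleMap (μ : ℂ) (r θ : ℝ) :
    (starRingEnd ℂ) (circleMap μ r θ) = circleMap ((starRingEnd ℂ) μ) r (-θ) := by
  simp [circleMap, ← Complex.exp_conj]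

end CircleIntegral

section Riesz

variable {H : Type*} [NormedAddCommGroup H] [InnerProductSpace ℂ H]
  {S : H →ₗ.[ℂ] H} {μ : ℂ} {r r₀ : ℝ}

/-- The punctured ball of radius `r₀` about `μ` lies in the resolvent set. -/
def IsIsolatingRadius (S : H →ₗ.[ℂ] H) (μ : ℂ) (r₀ : ℝ) : Prop :=
  0 < r₀ ∧ ∀ z, z ≠ μ → ‖z - μ‖ < r₀ → z ∈ opResolventSet S

theorem exists_isIsolatingRadius (h : ∀ᶠ z in 𝓝[≠] μ, z ∈ opResolventSet S) :
    ∃ r₀, IsIsolatingRadius S μ r₀ := by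
  rw [eventually_nhdsWithin_iff, Metric.eventually_nhds_iff] at h
  obtain ⟨r, hr, h⟩ := h
  exact ⟨r, hr, fun z hz hz' => h (by rwa [dist_eq_norm]) hz⟩

theorem IsIsolatingRadius.mem_of_sphere (h : IsIsolatingRadius S μ r₀) (hr : 0 < r) (hr₀ : r < r₀)
    {z : ℂ} (hz : z ∈ Metric.sphere μ r) : z ∈ opResolventSet S := by
  rw [mem_sphere_iff_norm] at hz
  refine h.2 z ?_ (by rwa [hz])
  rintro rfl
  simp at hz
  exact hr.ne hz

variable [CompleteSpace H]

theorem IsIsolatingRadius.continuousOn (h : IsIsolatingRadius S μ r₀) (hr : 0 < r) (hr₀ : r < r₀) :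
    ContinuousOn (opResolvent S) (Metric.sphere μ r) := fun _ hz =>
  (differentiableAt_opResolvent (h.mem_of_sphere hr hr₀ hz)).continuousAt.continuousWithinAt

theorem IsIsolatingRadius.circleIntegrable (h : IsIsolatingRadius S μ r₀) (hr : 0 < r)
    (hr₀ : r < r₀) : CircleIntegrable (opResolvent S) μ r :=
  (h.continuousOn hr hr₀).circleIntegrable hr.le

theorem IsIsolatingRadius.circleIntegral_eq {r r' : ℝ} (h : IsIsolatingRadius S μ r₀) (hr : 0 < r)
    (hrr' : r ≤ r') (hr' : r' < r₀) :
    (∮ z in C(μ, r'), opResolvent S z) = ∮ z in C(μ, r), opResolvent S z := by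
  have key : ∀ z, r ≤ ‖z - μ‖ → ‖z - μ‖ < r₀ → z ∈ opResolventSet S := by
    intro z h1 h2
    refine h.2 z ?_ h2
    rintro rfl
    simp at h1
    exact absurd hr (not_lt.2 h1)
  refine Complex.circleIntegral_eq_of_differentiable_on_annulus_off_countable hr hrr'
    Set.countable_empty (fun z hz => ?_) (fun z hz => ?_)
  · refine (differentiableAt_opResolvent (key z ?_ ?_)).continuousAt.continuousWithinAt
    · simpa [dist_eq_norm] using hz.2
    · have := hz.1
      rw [Metric.mem_closedBall, dist_eq_norm] at this
      linarith
  · refine differentiableAt_opResolvent (key z ?_ ?_)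
    · have := hz.1.2
      rw [Metric.mem_closedBall, dist_eq_norm] at this
      linarith
    · have := hz.1.1
      rw [Metric.mem_ball, dist_eq_norm] at this
      linarith

/-- By Cauchy's theorem in an annulus the integrals are constant for small radii, so the limit in
the definition exists and is attained. -/
theorem IsIsolatingRadius.rieszAt_eq (h : IsIsolatingRadius S μ r₀) (hr : 0 < r) (hr₀ : r < r₀) :
    rieszAt S μ =
      -((2 * (Real.pi : ℂ) * Complex.I)⁻¹ • ∮ z in C(μ, r), opResolvent S z) := by
  refine Tendsto.limUnder_eq (tendsto_const_nhds.congr' ?_)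
  filter_upwards [Ioo_mem_nhdsGT hr] with s hs
  rw [h.circleIntegral_eq hs.1 hs.2.le hr₀]

theorem IsIsolatingRadius.comp_rieszAt (h : IsIsolatingRadius S μ r₀) (hr : 0 < r) (hr₀ : r < r₀)
    (X : H →L[ℂ] H) :
    X.comp (rieszAt S μ) =
      -((2 * (Real.pi : ℂ) * Complex.I)⁻¹ • ∮ z in C(μ, r), X.comp (opResolvent S z)) := by
  rw [h.rieszAt_eq hr hr₀]
  have := circleIntegral_comp_comm (ContinuousLinearMap.compL ℂ H H H X)
    (h.circleIntegrable hr hr₀)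
  simp only [ContinuousLinearMap.compL_apply] at this
  rw [this, ContinuousLinearMap.comp_neg, ContinuousLinearMap.comp_smul]

theorem IsIsolatingRadius.rieszAt_comp (h : IsIsolatingRadius S μ r₀) (hr : 0 < r) (hr₀ : r < r₀)
    (X : H →L[ℂ] H) :
    (rieszAt S μ).comp X =
      -((2 * (Real.pi : ℂ) * Complex.I)⁻¹ • ∮ z in C(μ, r), (opResolvent S z).comp X) := by
  rw [h.rieszAt_eq hr hr₀]
  have := circleIntegral_comp_comm ((ContinuousLinearMap.compL ℂ H H H).flip X)
    (h.circleIntegrable hr hr₀)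
  simp only [ContinuousLinearMap.flip_apply, ContinuousLinearMap.compL_apply] at this
  rw [this, ContinuousLinearMap.neg_comp, ContinuousLinearMap.smul_comp]

theorem IsIsolatingRadius.rieszAt_comm (h : IsIsolatingRadius S μ r₀) {w : ℂ}
    (hw : w ∈ opResolventSet S) :
    (rieszAt S μ).comp (opResolvent S w) = (opResolvent S w).comp (rieszAt S μ) := by
  have hr : 0 < r₀ / 2 := half_pos h.1
  have hr' : r₀ / 2 < r₀ := half_lt_self h.1
  rw [h.rieszAt_comp hr hr', h.comp_rieszAt hr hr']
  congr 2
  refine circleIntegral.integral_congr hr.le fun z hz => ?_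
  exact opResolvent_comp_comm (h.mem_of_sphere hr hr' hz) hw

/-- The first resolvent identity under the integral sign. The coefficient of the resolvent at w is 1
or 0 according to whether w is inside or outside the circle, which yields the bounds near μ and away
from it. -/
theorem IsIsolatingRadius.rieszAt_comp_opResolvent (h : IsIsolatingRadius S μ r₀) (hr : 0 < r)
    (hr₀ : r < r₀) {w : ℂ} (hw : w ∈ opResolventSet S) (hwr : ‖w - μ‖ ≠ r) :
    (rieszAt S μ).comp (opResolvent S w) =
      ((2 * (Real.pi : ℂ) * Complex.I)⁻¹ * ∮ z in C(μ, r), (z - w)⁻¹) • opResolvent S w -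
      (2 * (Real.pi : ℂ) * Complex.I)⁻¹ • ∮ z in C(μ, r), (z - w)⁻¹ • opResolvent S z := by
  have hne : ∀ z ∈ Metric.sphere μ r, z - w ≠ 0 := by
    intro z hz h0
    rw [mem_sphere_iff_norm, sub_eq_zero.1 h0] at hz
    exact hwr hz
  have hc : ContinuousOn (fun z : ℂ => (z - w)⁻¹) (Metric.sphere μ r) :=
    ContinuousOn.inv₀ (by fun_prop) hne
  rw [h.rieszAt_comp hr hr₀]
  have h1 : (∮ z in C(μ, r), (opResolvent S z).comp (opResolvent S w)) =
      ∮ z in C(μ, r), ((z - w)⁻¹ • opResolvent S z - (z - w)⁻¹ • opResolvent S w) := by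
    refine circleIntegral.integral_congr hr.le fun z hz => ?_
    rw [← smul_sub, opResolvent_sub (h.mem_of_sphere hr hr₀ hz) hw, smul_smul,
      inv_mul_cancel₀ (hne z hz), one_smul]
  have h2 : CircleIntegrable (fun z => (z - w)⁻¹ • opResolvent S z) μ r :=
    ContinuousOn.circleIntegrable hr.le (hc.smul (h.continuousOn hr hr₀))
  have h3 : CircleIntegrable (fun z => (z - w)⁻¹ • opResolvent S w) μ r :=
    ContinuousOn.circleIntegrable hr.le (hc.smul continuousOn_const)
  rw [h1, circleIntegral.integral_sub h2 h3, circleIntegral.integral_smul_const, smul_sub, smul_smul]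
  abel

theorem IsIsolatingRadius.exists_norm_le (h : IsIsolatingRadius S μ r₀) (hr : 0 < r)
    (hr₀ : r < r₀) : ∃ M, 0 ≤ M ∧ ∀ z ∈ Metric.sphere μ r, ‖opResolvent S z‖ ≤ M := by
  obtain ⟨M, hM⟩ := (isCompact_sphere μ r).exists_bound_of_continuousOn (h.continuousOn hr hr₀)
  exact ⟨max M 0, le_max_right _ _, fun z hz => (hM z hz).trans (le_max_left _ _)⟩

theorem norm_cauchy_constant_smul_circleIntegral_le {f : ℂ → H →L[ℂ] H} {M : ℝ} (hr : 0 ≤ r)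
    (hf : ∀ z ∈ Metric.sphere μ r, ‖f z‖ ≤ M) :
    ‖(2 * (Real.pi : ℂ) * Complex.I)⁻¹ • ∮ z in C(μ, r), f z‖ ≤ r * M :=
  circleIntegral.norm_two_pi_i_inv_smul_integral_le_of_norm_le_const hr hf

/-- The Riesz projection regularizes the resolvent at the isolated point. -/
theorem IsIsolatingRadius.exists_bound_near (h : IsIsolatingRadius S μ r₀) :
    ∃ δ > 0, δ < r₀ ∧ ∃ M, ∀ w, w ≠ μ → ‖w - μ‖ ≤ δ →
      ‖((1 : H →L[ℂ] H) - rieszAt S μ).comp (opResolvent S w)‖ ≤ M := by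
  have hr : 0 < r₀ / 2 := half_pos h.1
  have hr₀ : r₀ / 2 < r₀ := half_lt_self h.1
  obtain ⟨M, hM0, hM⟩ := h.exists_norm_le hr hr₀
  refine ⟨r₀ / 4, by linarith, by linarith, r₀ / 2 * ((r₀ / 4)⁻¹ * M), fun w hw hwr => ?_⟩
  have hwρ : w ∈ opResolventSet S := h.2 w hw (by linarith)
  have h1 := h.rieszAt_comp_opResolvent hr hr₀ hwρ (by linarith)
  rw [circleIntegral.integral_sub_inv_of_mem_ball (by
    rw [Metric.mem_ball, dist_eq_norm]; linarith), inv_mul_cancel₀ Complex.two_pi_I_ne_zero, one_smul] at h1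
  have h2 : ((1 : H →L[ℂ] H) - rieszAt S μ).comp (opResolvent S w) =
      (2 * (Real.pi : ℂ) * Complex.I)⁻¹ • ∮ z in C(μ, r₀ / 2), (z - w)⁻¹ • opResolvent S z := by
    rw [ContinuousLinearMap.sub_comp, h1]
    change opResolvent S w - _ = _
    abel
  rw [h2]
  refine norm_cauchy_constant_smul_circleIntegral_le hr.le fun z hz => ?_
  rw [norm_smul, norm_inv]
  have h3 : r₀ / 4 ≤ ‖z - w‖ := by
    rw [mem_sphere_iff_norm] at hz
    have := norm_sub_le_norm_sub_add_norm_sub z w μ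
    linarith
  have h4 := hM z hz
  have : 0 < r₀ / 4 := by linarith
  gcongr

/-- On a circle of radius at most ρ/2 the point w is outside, only the integral with kernel (z −
w)⁻¹ survives, and that kernel is at most 2/‖w − μ‖. -/
theorem IsIsolatingRadius.exists_bound_away (h : IsIsolatingRadius S μ r₀) {ρ : ℝ} (hρ : 0 < ρ) :
    ∃ M, ∀ w ∈ opResolventSet S, ρ ≤ ‖w - μ‖ →
      ‖(rieszAt S μ).comp (opResolvent S w)‖ ≤ M / ‖w - μ‖ := by
  set r := min (r₀ / 2) (ρ / 2) with hr_def
  have hr : 0 < r := lt_min (half_pos h.1) (half_pos hρ)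
  have hr₀ : r < r₀ := (min_le_left _ _).trans_lt (half_lt_self h.1)
  have hrρ : r ≤ ρ / 2 := min_le_right _ _
  obtain ⟨M, hM0, hM⟩ := h.exists_norm_le hr hr₀
  refine ⟨r * (2 * M), fun w hw hwρ => ?_⟩
  rw [h.rieszAt_comp_opResolvent hr hr₀ hw (by linarith),
    circleIntegral_sub_inv_of_lt hr.le (by linarith), mul_zero, zero_smul, zero_sub, norm_neg,
    mul_div_assoc]
  refine norm_cauchy_constant_smul_circleIntegral_le hr.le fun z hz => ?_
  rw [mem_sphere_iff_norm] at hz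
  have h1 := norm_sub_le_norm_sub_add_norm_sub w z μ
  have h2 : 0 < ‖w - μ‖ := by linarith
  have h3 : ‖w - μ‖ / 2 ≤ ‖z - w‖ := by
    rw [norm_sub_rev z w]
    linarith
  have h4 := hM z (mem_sphere_iff_norm.2 hz)
  rw [norm_smul, norm_inv]
  calc ‖z - w‖⁻¹ * ‖opResolvent S z‖ ≤ (‖w - μ‖ / 2)⁻¹ * M := by gcongr
    _ = 2 * M / ‖w - μ‖ := by rw [inv_div]; ring

/-- An operator that makes the resolvent bounded near an isolated point annihilates the Riesz
projection. -/
theorem IsIsolatingRadius.comp_rieszAt_eq_zero (h : IsIsolatingRadius S μ r₀) (X : H →L[ℂ] H)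
    {δ M : ℝ} (hδ : 0 < δ)
    (hX : ∀ w, w ≠ μ → ‖w - μ‖ ≤ δ → ‖X.comp (opResolvent S w)‖ ≤ M) :
    X.comp (rieszAt S μ) = 0 := by
  have key : ∀ᶠ r in 𝓝[>] (0 : ℝ), ‖X.comp (rieszAt S μ)‖ ≤ r * M := by
    filter_upwards [Ioo_mem_nhdsGT (lt_min h.1 hδ)] with r hr
    rw [h.comp_rieszAt hr.1 (hr.2.trans_le (min_le_left _ _)), norm_neg]
    refine norm_cauchy_constant_smul_circleIntegral_le hr.1.le fun z hz => ?_
    rw [mem_sphere_iff_norm] at hz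
    refine hX z ?_ (hz.trans_le (hr.2.le.trans (min_le_right _ _)))
    rintro rfl
    simp at hz
    exact hr.1.ne hz
  have hlim : Tendsto (fun r : ℝ => r * M) (𝓝[>] 0) (𝓝 0) := by
    have : Tendsto (fun r : ℝ => r * M) (𝓝 0) (𝓝 (0 * M)) := by
      exact (continuous_id.mul continuous_const).tendsto 0
    rw [zero_mul] at this
    exact this.mono_left nhdsWithin_le_nhds
  exact norm_le_zero_iff.1 (ge_of_tendsto hlim key)

end Riesz

/-! ### Riesz projections of the adjoint operator -/

section AdjointRiesz

variable {H : Type*} [NormedAddCommGroup H] [InnerProductSpace ℂ H] [CompleteSpace H]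

/-- Conjugation reverses the orientation of the circle; the sign is absorbed by the conjugate of
2πi. -/
theorem star_circleIntegral (f : ℂ → H →L[ℂ] H) (μ : ℂ) (r : ℝ) :
    adjoint ((2 * (Real.pi : ℂ) * Complex.I)⁻¹ • ∮ z in C(μ, r), f z) =
      (2 * (Real.pi : ℂ) * Complex.I)⁻¹ •
        ∮ z in C((starRingEnd ℂ) μ, r), starFamily f z := by
  have hper : Function.Periodic (fun θ : ℝ => deriv (circleMap ((starRingEnd ℂ) μ) r) θ •
      starFamily f (circleMap ((starRingEnd ℂ) μ) r θ)) (2 * Real.pi) := by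
    intro θ
    simp only [deriv_circleMap, periodic_circleMap _ _ θ]
  have h1 : adjoint (∮ z in C(μ, r), f z) =
      -∮ z in C((starRingEnd ℂ) μ, r), starFamily f z := by
    rw [circleIntegral, circleIntegral]
    have h2 := hper.intervalIntegral_add_eq 0 (-(2 * Real.pi))
    rw [zero_add, neg_add_cancel] at h2
    have h3 := intervalIntegral.integral_comp_neg (a := 0) (b := 2 * Real.pi)
      (fun θ : ℝ => deriv (circleMap ((starRingEnd ℂ) μ) r) θ •
        starFamily f (circleMap ((starRingEnd ℂ) μ) r θ))
    rw [neg_zero] at h3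
    rw [h2, ← h3, ← intervalIntegral.integral_neg, intervalIntegral.integral_of_le (by positivity),
      intervalIntegral.integral_of_le (by positivity)]
    have h4 := ContinuousLinearEquiv.integral_comp_comm (μ := volume.restrict (Set.Ioc 0 (2 * Real.pi)))
      (starL' ℝ : (H →L[ℂ] H) ≃L[ℝ] (H →L[ℂ] H))
      (fun θ => deriv (circleMap μ r) θ • f (circleMap μ r θ))
    change star _ = _
    change _ = star _ at h4
    rw [← h4]
    refine integral_congr_ae (ae_of_all _ fun θ => ?_)
    change star _ = _
    simp only [starFamily]
    rw [star_smul, ← conj_circleMap, Complex.conj_conj]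
    rw [deriv_circleMap, deriv_circleMap, ← neg_smul]
    congr 1
    simp [circleMap, ← Complex.exp_conj]
  rw [map_smulₛₗ, h1, smul_neg, ← neg_smul]
  congr 1
  simp [Complex.conj_ofNat]

end AdjointRiesz

section AdjointSpectrum

variable {H : Type*} [NormedAddCommGroup H] [InnerProductSpace ℂ H]
  {S : H →ₗ.[ℂ] H} {μ : ℂ} {r : ℝ}

theorem IsIsolatingRadius.eventually (h : IsIsolatingRadius S μ r) :
    ∀ᶠ z in 𝓝[≠] μ, z ∈ opResolventSet S := by
  rw [eventually_nhdsWithin_iff, Metric.eventually_nhds_iff]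
  exact ⟨r, h.1, fun z hz hz' => h.2 z hz' (by rwa [dist_eq_norm] at hz)⟩

variable [CompleteSpace H]

theorem isIsolatingRadius_adjoint (hS : Dense (S.domain : Set H)) (hc : S.IsClosed) :
    IsIsolatingRadius S.adjoint μ r ↔ IsIsolatingRadius S ((starRingEnd ℂ) μ) r := by
  have hnorm : ∀ z : ℂ, ‖(starRingEnd ℂ) z - (starRingEnd ℂ) μ‖ = ‖z - μ‖ := fun z => by
    rw [← map_sub, RCLike.norm_conj]
  refine and_congr_right fun _ => ⟨fun h z hz hzr => ?_, fun h z hz hzr => ?_⟩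
  · have h1 := h ((starRingEnd ℂ) z) (fun h0 => hz (by rw [← h0, Complex.conj_conj]))
      (by rw [← hnorm, Complex.conj_conj]; exact hzr)
    rwa [mem_opResolventSet_adjoint hS hc, Complex.conj_conj] at h1
  · rw [mem_opResolventSet_adjoint hS hc]
    exact h _ (fun h0 => hz ((starRingEnd ℂ).injective h0)) (by rwa [hnorm])

theorem rieszAt_adjoint (hS : Dense (S.domain : Set H)) (hc : S.IsClosed)
    (h : IsIsolatingRadius S μ r) :
    rieszAt S.adjoint ((starRingEnd ℂ) μ) = adjoint (rieszAt S μ) := by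
  have h' : IsIsolatingRadius S.adjoint ((starRingEnd ℂ) μ) r := by
    rwa [isIsolatingRadius_adjoint hS hc, Complex.conj_conj]
  rw [h.rieszAt_eq (half_pos h.1) (half_lt_self h.1),
    h'.rieszAt_eq (half_pos h.1) (half_lt_self h.1), map_neg, star_circleIntegral,
    opResolvent_adjoint hS hc]

/-- The adjoint vanishes on the orthogonal complement of the range of X, so its range is the image
of a finite-dimensional space. -/
theorem finiteDimensional_range_adjoint {X : H →L[ℂ] H}
    (h : FiniteDimensional ℂ (LinearMap.range (X : H →ₗ[ℂ] H))) :
    FiniteDimensional ℂ (LinearMap.range (adjoint X : H →ₗ[ℂ] H)) := by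
  set V := LinearMap.range (X : H →ₗ[ℂ] H) with hV
  have hle : LinearMap.range (adjoint X : H →ₗ[ℂ] H) ≤ V.map (adjoint X : H →ₗ[ℂ] H) := by
    rintro _ ⟨y, rfl⟩
    refine ⟨V.starProjection y, V.starProjection_apply_mem y, ?_⟩
    have h1 : y - V.starProjection y ∈ Vᗮ := V.sub_starProjection_mem_orthogonal y
    have h2 : adjoint X (y - V.starProjection y) = 0 := by
      refine ext_inner_right ℂ fun x => ?_
      rw [ContinuousLinearMap.adjoint_inner_left, inner_zero_left]
      exact (Submodule.mem_orthogonal' V _).1 h1 _ ⟨x, rfl⟩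
    rw [map_sub, sub_eq_zero] at h2
    exact h2.symm
  exact Submodule.finiteDimensional_of_le hle

theorem mem_discreteSpectrum_adjoint_of_mem (hS : Dense (S.domain : Set H)) (hc : S.IsClosed)
    (hμ : μ ∈ discreteSpectrum S) : (starRingEnd ℂ) μ ∈ discreteSpectrum S.adjoint := by
  obtain ⟨h1, h2, h3⟩ := hμ
  obtain ⟨r, hr⟩ := exists_isIsolatingRadius h2
  refine ⟨?_, ?_, ?_⟩
  · rw [opSpectrum, Set.mem_compl_iff, mem_opResolventSet_adjoint hS hc, Complex.conj_conj]
    exact h1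
  · exact ((isIsolatingRadius_adjoint hS hc).2 (by rwa [Complex.conj_conj])).eventually
  · rw [rieszAt_adjoint hS hc hr]
    exact finiteDimensional_range_adjoint h3

theorem discreteSpectrum_adjoint (hS : Dense (S.domain : Set H)) (hc : S.IsClosed) :
    discreteSpectrum S.adjoint = (starRingEnd ℂ) '' discreteSpectrum S := by
  refine Set.Subset.antisymm (fun μ hμ => ?_) ?_
  · obtain ⟨h1, h2, h3⟩ := hμ
    obtain ⟨r, hr⟩ := exists_isIsolatingRadius h2
    rw [isIsolatingRadius_adjoint hS hc] at hr
    refine ⟨(starRingEnd ℂ) μ, ⟨?_, hr.eventually, ?_⟩, Complex.conj_conj μ⟩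
    · rwa [opSpectrum, Set.mem_compl_iff, mem_opResolventSet_adjoint hS hc] at h1
    · have h4 := rieszAt_adjoint hS hc hr
      rw [Complex.conj_conj] at h4
      rw [h4] at h3
      have h5 := finiteDimensional_range_adjoint h3
      rwa [ContinuousLinearMap.adjoint_adjoint] at h5
  · rintro _ ⟨μ, hμ, rfl⟩
    exact mem_discreteSpectrum_adjoint_of_mem hS hc hμ

theorem rieszProjection_adjoint (hS : Dense (S.domain : Set H)) (hc : S.IsClosed)
    (hfin : (discreteSpectrum S).Finite) :
    rieszProjection S.adjoint = adjoint (rieszProjection S) := by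
  rw [rieszProjection, rieszProjection, discreteSpectrum_adjoint hS hc,
    finsum_mem_image (starRingEnd ℂ).injective.injOn]
  have h := AddMonoidHom.map_finsum_mem (rieszAt S)
    ((adjoint : (H →L[ℂ] H) ≃ₗᵢ⋆[ℂ] (H →L[ℂ] H)).toLinearEquiv.toLinearMap.toAddMonoidHom) hfin
  refine Eq.trans ?_ h.symm
  refine finsum_mem_congr rfl fun μ hμ => ?_
  obtain ⟨r, hr⟩ := exists_isIsolatingRadius hμ.2.1
  exact rieszAt_adjoint hS hc hr

end AdjointSpectrum

/-! ### The projection of the discrete spectrum and the regular part of the resolvent -/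

section Projection

variable {H : Type*} [NormedAddCommGroup H] [InnerProductSpace ℂ H] [CompleteSpace H]
  {S : H →ₗ.[ℂ] H} {z w μ : ℂ}

theorem rieszProjection_eq_sum (hfin : (discreteSpectrum S).Finite) :
    rieszProjection S = ∑ μ ∈ hfin.toFinset, rieszAt S μ :=
  finsum_mem_eq_finite_toFinset_sum _ hfin

theorem rieszProjection_comm (hfin : (discreteSpectrum S).Finite) (hw : w ∈ opResolventSet S) :
    (rieszProjection S).comp (opResolvent S w) = (opResolvent S w).comp (rieszProjection S) := by
  rw [rieszProjection_eq_sum hfin, ContinuousLinearMap.finsetSum_comp,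
    ContinuousLinearMap.comp_finsetSum]
  refine Finset.sum_congr rfl fun μ hμ => ?_
  obtain ⟨r, hr⟩ := exists_isIsolatingRadius (hfin.mem_toFinset.1 hμ).2.1
  exact hr.rieszAt_comm hw

theorem exists_bound_sum_away {F : Finset ℂ} (hF : ∀ ν ∈ F, ν ∈ discreteSpectrum S) {ρ : ℝ}
    (hρ : 0 < ρ) : ∃ M, 0 ≤ M ∧ ∀ w ∈ opResolventSet S, (∀ ν ∈ F, ρ ≤ ‖w - ν‖) →
      ‖(∑ ν ∈ F, rieszAt S ν).comp (opResolvent S w)‖ ≤ M / (1 + ‖w‖) := by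
  have key : ∀ ν ∈ F, ∃ M, 0 ≤ M ∧ ∀ w ∈ opResolventSet S, ρ ≤ ‖w - ν‖ →
      ‖(rieszAt S ν).comp (opResolvent S w)‖ ≤ M / (1 + ‖w‖) := by
    intro ν hν
    obtain ⟨r, hr⟩ := exists_isIsolatingRadius (hF ν hν).2.1
    obtain ⟨M, hM⟩ := hr.exists_bound_away hρ
    refine ⟨|M| * (1 + (1 + ‖ν‖) / ρ), by positivity, fun w hw hwν => ?_⟩
    have h0 : 0 < ‖w - ν‖ := hρ.trans_le hwν
    refine (hM w hw hwν).trans ?_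
    rw [div_le_div_iff₀ h0 (by positivity)]
    have h1 : ‖w‖ ≤ ‖w - ν‖ + ‖ν‖ := by simpa using norm_add_le (w - ν) ν
    have h2 : (1 + ‖ν‖) ≤ (1 + ‖ν‖) / ρ * ‖w - ν‖ := by
      rw [div_mul_eq_mul_div, le_div_iff₀ hρ]
      gcongr
    calc M * (1 + ‖w‖) ≤ |M| * (1 + ‖w‖) := by gcongr; exact le_abs_self M
      _ ≤ |M| * ((1 + (1 + ‖ν‖) / ρ) * ‖w - ν‖) := by
        gcongr
        linarith
      _ = _ := by ring
  choose! M hM0 hM using key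
  refine ⟨∑ ν ∈ F, M ν, Finset.sum_nonneg hM0, fun w hw hwF => ?_⟩
  rw [ContinuousLinearMap.finsetSum_comp, Finset.sum_div]
  exact (norm_sum_le _ _).trans (Finset.sum_le_sum fun ν hν => hM ν hν w hw (hwF ν hν))

theorem exists_separation {F : Set ℂ} (hF : F.Finite) (μ : ℂ) :
    ∃ ρ > 0, ∀ ν ∈ F, ν ≠ μ → ρ ≤ ‖ν - μ‖ := by
  have h : (F \ {μ})ᶜ ∈ 𝓝 μ := (hF.subset Set.sdiff_subset).isClosed.compl_mem_nhds (by simp)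
  obtain ⟨ρ, hρ, h⟩ := Metric.mem_nhds_iff.1 h
  refine ⟨ρ, hρ, fun ν hν hne => ?_⟩
  by_contra! hlt
  exact h (by rwa [Metric.mem_ball, dist_eq_norm]) ⟨hν, hne⟩

/-- The complementary part of the resolvent is bounded near the discrete spectrum. -/
theorem exists_bound_compl_near (hfin : (discreteSpectrum S).Finite)
    (hμ : μ ∈ discreteSpectrum S) :
    ∃ δ > 0, ∃ M, ∀ w, w ≠ μ → ‖w - μ‖ ≤ δ → w ∈ opResolventSet S ∧
      ‖((1 : H →L[ℂ] H) - rieszProjection S).comp (opResolvent S w)‖ ≤ M := by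
  classical
  obtain ⟨r, hr⟩ := exists_isIsolatingRadius hμ.2.1
  obtain ⟨δ₁, hδ₁, hδr, M₁, hM₁⟩ := hr.exists_bound_near
  obtain ⟨ρ, hρ, hsep⟩ := exists_separation hfin μ
  obtain ⟨M₂, hM₂, hb⟩ := exists_bound_sum_away (S := S) (F := hfin.toFinset.erase μ)
    (fun ν hν => hfin.mem_toFinset.1 (Finset.mem_of_mem_erase hν)) (half_pos hρ)
  refine ⟨min δ₁ (ρ / 2), lt_min hδ₁ (half_pos hρ), M₁ + M₂, fun w hw hwδ => ?_⟩
  have hwρ : w ∈ opResolventSet S := hr.2 w hw ((hwδ.trans (min_le_left _ _)).trans_lt hδr)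
  refine ⟨hwρ, ?_⟩
  have h1 : ((1 : H →L[ℂ] H) - rieszProjection S).comp (opResolvent S w) =
      ((1 : H →L[ℂ] H) - rieszAt S μ).comp (opResolvent S w) -
        (∑ ν ∈ hfin.toFinset.erase μ, rieszAt S ν).comp (opResolvent S w) := by
    rw [← ContinuousLinearMap.sub_comp, rieszProjection_eq_sum hfin,
      ← Finset.add_sum_erase _ _ (hfin.mem_toFinset.2 hμ)]
    congr 1
    abel
  rw [h1]
  refine (norm_sub_le _ _).trans (add_le_add (hM₁ w hw (hwδ.trans (min_le_left _ _))) ?_)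
  refine (hb w hwρ fun ν hν => ?_).trans (div_le_self hM₂ (by linarith [norm_nonneg w]))
  have h2 := hsep ν (hfin.mem_toFinset.1 (Finset.mem_of_mem_erase hν)) (Finset.ne_of_mem_erase hν)
  have h3 := norm_sub_le_norm_sub_add_norm_sub ν w μ
  rw [norm_sub_rev ν w] at h3
  linarith [hwδ.trans (min_le_right _ _)]

/-- Near each discrete point 1 − P makes the resolvent bounded, hence it annihilates the Riesz
projection at that point. This replaces the usual double contour integral and the mutual
orthogonality of the projections. -/
theorem rieszProjection_idempotent (hfin : (discreteSpectrum S).Finite) :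
    (rieszProjection S).comp (rieszProjection S) = rieszProjection S := by
  have h : ((1 : H →L[ℂ] H) - rieszProjection S).comp (rieszProjection S) = 0 := by
    conv_lhs => rw [rieszProjection_eq_sum hfin, ContinuousLinearMap.comp_finsetSum]
    rw [← rieszProjection_eq_sum hfin]
    refine Finset.sum_eq_zero fun μ hμ => ?_
    have hμ' := hfin.mem_toFinset.1 hμ
    obtain ⟨r, hr⟩ := exists_isIsolatingRadius hμ'.2.1
    obtain ⟨δ, hδ, M, hM⟩ := exists_bound_compl_near hfin hμ'
    exact hr.comp_rieszAt_eq_zero _ hδ fun w hw hwδ => (hM w hw hwδ).2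
  rw [ContinuousLinearMap.sub_comp, sub_eq_zero] at h
  exact h.symm

theorem rieszProjection_compl_idempotent (hfin : (discreteSpectrum S).Finite) :
    ((1 : H →L[ℂ] H) - rieszProjection S).comp ((1 : H →L[ℂ] H) - rieszProjection S) =
      (1 : H →L[ℂ] H) - rieszProjection S :=
  IsIdempotentElem.one_sub (a := rieszProjection S) (rieszProjection_idempotent hfin)

/-- The part of the resolvent in the subspace complementary to the root subspaces of the discrete
spectrum, continued to the discrete spectrum. -/
def regularResolvent (S : H →ₗ.[ℂ] H) (z : ℂ) : H →L[ℂ] H :=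
  limUnder (𝓝[≠] z) fun w => ((1 : H →L[ℂ] H) - rieszProjection S).comp (opResolvent S w)

theorem differentiableAt_compl (hz : z ∈ opResolventSet S) : DifferentiableAt ℂ
    (fun w => ((1 : H →L[ℂ] H) - rieszProjection S).comp (opResolvent S w)) z :=
  ((ContinuousLinearMap.compL ℂ H H H
    ((1 : H →L[ℂ] H) - rieszProjection S)).differentiableAt).comp z (differentiableAt_opResolvent hz)

theorem regularResolvent_eq (hz : z ∈ opResolventSet S) :
    regularResolvent S z = ((1 : H →L[ℂ] H) - rieszProjection S).comp (opResolvent S z) :=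
  Tendsto.limUnder_eq ((differentiableAt_compl hz).continuousAt.tendsto.mono_left
    nhdsWithin_le_nhds)

/-- At a discrete point the bound near it allows Riemann's removable singularity theorem, and the
limit in the definition is exactly the removing value. -/
theorem differentiableAt_regularResolvent (hfin : (discreteSpectrum S).Finite)
    (hz : z ∈ opResolventSet S ∪ discreteSpectrum S) :
    DifferentiableAt ℂ (regularResolvent S) z := by
  rcases hz with hz | hz
  · refine (differentiableAt_compl hz).congr_of_eventuallyEq ?_
    filter_upwards [isOpen_opResolventSet.mem_nhds hz] with w hw
    exact regularResolvent_eq hw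
  · obtain ⟨δ, hδ, M, hM⟩ := exists_bound_compl_near hfin hz
    have hball : Metric.ball z δ ∈ 𝓝 z := Metric.ball_mem_nhds z hδ
    have hmem : ∀ w ∈ Metric.ball z δ \ {z}, w ∈ opResolventSet S ∧
        ‖((1 : H →L[ℂ] H) - rieszProjection S).comp (opResolvent S w)‖ ≤ M := by
      intro w hw
      refine hM w hw.2 ?_
      have := hw.1
      rw [Metric.mem_ball, dist_eq_norm] at this
      exact this.le
    have h1 := Complex.differentiableOn_update_limUnder_of_bddAbove hball
      (f := fun w => ((1 : H →L[ℂ] H) - rieszProjection S).comp (opResolvent S w))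
      (fun w hw => (differentiableAt_compl (hmem w hw).1).differentiableWithinAt)
      ⟨M, by rintro _ ⟨w, hw, rfl⟩; exact (hmem w hw).2⟩
    refine (h1.differentiableAt hball).congr_of_eventuallyEq ?_
    filter_upwards [hball] with w hw
    by_cases hwz : w = z
    · subst hwz
      rw [Function.update_self]
      rfl
    · rw [Function.update_of_ne hwz, regularResolvent_eq (hmem w ⟨hw, hwz⟩).1]

theorem eventually_mem_opResolventSet (hz : z ∈ opResolventSet S ∪ discreteSpectrum S) :
    ∀ᶠ w in 𝓝[≠] z, w ∈ opResolventSet S := by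
  rcases hz with hz | hz
  · exact nhdsWithin_le_nhds (isOpen_opResolventSet.mem_nhds hz)
  · exact hz.2.1

/-- Identities between continuous functions extend from the resolvent set to the discrete
spectrum. -/
theorem eq_of_eq_on_opResolventSet {E : Type*} [TopologicalSpace E] [T2Space E] {f g : ℂ → E}
    (hz : z ∈ opResolventSet S ∪ discreteSpectrum S) (hf : ContinuousAt f z)
    (hg : ContinuousAt g z) (h : ∀ w ∈ opResolventSet S, f w = g w) : f z = g z := by
  refine tendsto_nhds_unique (hf.tendsto.mono_left (nhdsWithin_le_nhds (s := {z}ᶜ)))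
    ((hg.tendsto.mono_left nhdsWithin_le_nhds).congr' ?_)
  filter_upwards [eventually_mem_opResolventSet hz] with w hw
  exact (h w hw).symm

theorem exists_bound_near_of_continuousAt {E : Type*} [NormedAddCommGroup E] {F : Set ℂ}
    (hfin : F.Finite) {f : ℂ → E} (hf : ∀ μ ∈ F, ContinuousAt f μ) :
    ∃ δ > 0, ∃ M, 0 ≤ M ∧ ∀ μ ∈ F, ∀ w, ‖w - μ‖ ≤ δ → ‖f w‖ ≤ M := by
  have key : ∀ μ ∈ F, ∃ δ > 0, ∀ w, ‖w - μ‖ ≤ δ → ‖f w‖ ≤ ‖f μ‖ + 1 := by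
    intro μ hμ
    obtain ⟨δ, hδ, h⟩ := Metric.continuousAt_iff.1 (hf μ hμ) 1 one_pos
    refine ⟨δ / 2, half_pos hδ, fun w hw => ?_⟩
    have h1 := h (x := w) (by rw [dist_eq_norm]; linarith)
    rw [dist_eq_norm] at h1
    have h2 := norm_le_norm_add_norm_sub' (f w) (f μ)
    linarith
  choose! δ hδ hM using key
  rcases F.eq_empty_or_nonempty with he | hne
  · exact ⟨1, one_pos, 0, le_rfl, by simp [he]⟩
  · have hne' : hfin.toFinset.Nonempty := by simpa using hne
    refine ⟨hfin.toFinset.inf' hne' δ, ?_, ∑ μ ∈ hfin.toFinset, (‖f μ‖ + 1), ?_,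
      fun μ hμ w hw => ?_⟩
    · rw [gt_iff_lt, Finset.lt_inf'_iff]
      exact fun μ hμ => hδ μ (hfin.mem_toFinset.1 hμ)
    · positivity
    · have hμ' := hfin.mem_toFinset.2 hμ
      exact (hM μ hμ w (hw.trans (Finset.inf'_le _ hμ'))).trans
        (Finset.single_le_sum (f := fun μ => ‖f μ‖ + 1) (fun _ _ => by positivity) hμ')

theorem compl_comp_regularResolvent (hfin : (discreteSpectrum S).Finite)
    (hz : z ∈ opResolventSet S ∪ discreteSpectrum S) :
    ((1 : H →L[ℂ] H) - rieszProjection S).comp (regularResolvent S z) = regularResolvent S z := by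
  have hc := (differentiableAt_regularResolvent hfin hz).continuousAt
  refine eq_of_eq_on_opResolventSet
    (f := fun z => ((1 : H →L[ℂ] H) - rieszProjection S).comp (regularResolvent S z)) hz
    ?_ hc fun w hw => ?_
  · exact continuousAt_const.clm_comp hc
  · rw [regularResolvent_eq hw, ← ContinuousLinearMap.comp_assoc,
      rieszProjection_compl_idempotent hfin]

theorem regularResolvent_comp_compl (hfin : (discreteSpectrum S).Finite)
    (hz : z ∈ opResolventSet S ∪ discreteSpectrum S) :
    (regularResolvent S z).comp ((1 : H →L[ℂ] H) - rieszProjection S) = regularResolvent S z := by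
  have hc := (differentiableAt_regularResolvent hfin hz).continuousAt
  refine eq_of_eq_on_opResolventSet
    (f := fun z => (regularResolvent S z).comp ((1 : H →L[ℂ] H) - rieszProjection S)) hz
    ?_ hc fun w hw => ?_
  · exact hc.clm_comp continuousAt_const
  · have h := rieszProjection_comm hfin hw
    have h2 := rieszProjection_idempotent hfin
    have h3 : (opResolvent S w).comp ((1 : H →L[ℂ] H) - rieszProjection S) =
        ((1 : H →L[ℂ] H) - rieszProjection S).comp (opResolvent S w) := by
      rw [ContinuousLinearMap.sub_comp, ContinuousLinearMap.comp_sub, h]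
      rfl
    rw [regularResolvent_eq hw, ContinuousLinearMap.comp_assoc, h3, ← regularResolvent_eq hw,
      compl_comp_regularResolvent hfin (Or.inl hw)]

/-- The identity is inherited on the resolvent set and reaches the discrete points by continuity,
one variable at a time. The regular part thus acts as a resolvent even at non-real eigenvalues. -/
theorem isResolventFamily_regularResolvent (hfin : (discreteSpectrum S).Finite)
    (hsub : ∀ z : ℂ, z.im ≠ 0 → z ∈ opResolventSet S ∪ discreteSpectrum S) :
    IsResolventFamily (regularResolvent S) := by
  have h1 : ∀ z ∈ opResolventSet S, ∀ w ∈ opResolventSet S,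
      regularResolvent S z - regularResolvent S w =
        (z - w) • (regularResolvent S z).comp (regularResolvent S w) := by
    intro z hz w hw
    have h2 : (regularResolvent S z).comp (regularResolvent S w) =
        ((1 : H →L[ℂ] H) - rieszProjection S).comp
          ((opResolvent S z).comp (opResolvent S w)) := by
      conv_lhs => rw [regularResolvent_eq hw]
      rw [← ContinuousLinearMap.comp_assoc, regularResolvent_comp_compl hfin (Or.inl hz),
        regularResolvent_eq hz, ContinuousLinearMap.comp_assoc]
    rw [h2, regularResolvent_eq hz, regularResolvent_eq hw, ← ContinuousLinearMap.comp_sub,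
      opResolvent_sub hz hw, ContinuousLinearMap.comp_smul]
  have hc : ∀ z ∈ opResolventSet S ∪ discreteSpectrum S,
      ContinuousAt (regularResolvent S) z := fun z hz =>
    (differentiableAt_regularResolvent hfin hz).continuousAt
  have h2 : ∀ z ∈ opResolventSet S, ∀ w ∈ opResolventSet S ∪ discreteSpectrum S,
      regularResolvent S z - regularResolvent S w =
        (z - w) • (regularResolvent S z).comp (regularResolvent S w) := by
    intro z hz w hw
    refine eq_of_eq_on_opResolventSet (f := fun w => regularResolvent S z - regularResolvent S w)
      (g := fun w => (z - w) • (regularResolvent S z).comp (regularResolvent S w)) hw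
      ?_ ?_ (h1 z hz)
    · exact continuousAt_const.sub (hc w hw)
    · exact (continuousAt_const.sub continuousAt_id).smul (continuousAt_const.clm_comp (hc w hw))
  intro z w hz hw
  refine eq_of_eq_on_opResolventSet (f := fun z => regularResolvent S z - regularResolvent S w)
    (g := fun z => (z - w) • (regularResolvent S z).comp (regularResolvent S w)) (hsub z hz)
    ?_ ?_ fun z hz => h2 z hz w (hsub w hw)
  · exact (hc z (hsub z hz)).sub continuousAt_const
  · exact (continuousAt_id.sub continuousAt_const).smul
      ((hc z (hsub z hz)).clm_comp continuousAt_const)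

end Projection

/-! ### Membership in the Hardy class by domination -/

section HardyClass

variable {E E₁ E₂ : Type*} [NormedAddCommGroup E] [NormedSpace ℂ E] [NormedAddCommGroup E₁]
  [NormedSpace ℂ E₁] [NormedAddCommGroup E₂] [NormedSpace ℂ E₂]

theorem continuous_horizontal {F : ℂ → E} (hF : DifferentiableOn ℂ F {z | 0 < z.im}) {ε : ℝ}
    (hε : 0 < ε) : Continuous fun k : ℝ => F ((k : ℂ) + (ε : ℂ) * Complex.I) := by
  refine hF.continuousOn.comp_continuous (by fun_prop) fun k => ?_
  simpa using hε

theorem lintegral_indicator_near_le (μ : ℂ) {δ : ℝ} (c : ℝ≥0∞) :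
    ∫⁻ k : ℝ, (Set.Icc (μ.re - δ) (μ.re + δ)).indicator (fun _ => c) k =
      c * ENNReal.ofReal (2 * δ) := by
  rw [lintegral_indicator_const measurableSet_Icc, Real.volume_Icc]
  congr 2
  ring

/-- A function dominated by functions of the Hardy class away from a finite set and bounded near
this set is of the Hardy class. -/
theorem MemHardyUpper.of_le_off_finite {F : ℂ → E} {G₁ : ℂ → E₁} {G₂ : ℂ → E₂}
    (h₁ : MemHardyUpper G₁) (h₂ : MemHardyUpper G₂) (hd : DifferentiableOn ℂ F {z | 0 < z.im})
    {D : Set ℂ} (hD : D.Finite) {δ : ℝ} {c M : ℝ≥0}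
    (hoff : ∀ z, 0 < z.im → (∀ μ ∈ D, δ ≤ ‖z - μ‖) → ‖F z‖ ≤ c * (‖G₁ z‖ + ‖G₂ z‖))
    (hnear : ∀ z, 0 < z.im → ∀ μ ∈ D, ‖z - μ‖ ≤ δ → ‖F z‖ ≤ M) : MemHardyUpper F := by
  obtain ⟨hd₁, C₁, hC₁⟩ := h₁
  obtain ⟨-, C₂, hC₂⟩ := h₂
  refine ⟨hd, c ^ 2 * (2 * C₁ + 2 * C₂) +
    ∑ μ ∈ hD.toFinset, M ^ 2 * Real.toNNReal (2 * δ), fun ε hε => ?_⟩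
  set ℓ : ℝ → ℂ := fun k => (k : ℂ) + (ε : ℂ) * Complex.I with hℓ
  have hℓim : ∀ k, 0 < (ℓ k).im := fun k => by simpa [hℓ] using hε
  -- Whatever the height ε, points of the line within δ of μ have real part in [Re μ − δ, Re μ + δ].
  -- Each exceptional point therefore costs at most 2δM², uniformly in ε.
  have hpt : ∀ k, ‖F (ℓ k)‖ₑ ^ 2 ≤ (c : ℝ≥0∞) ^ 2 * ‖‖G₁ (ℓ k)‖ + ‖G₂ (ℓ k)‖‖ₑ ^ 2 +
      ∑ μ ∈ hD.toFinset,
        (Set.Icc (μ.re - δ) (μ.re + δ)).indicator (fun _ => (M : ℝ≥0∞) ^ 2) k := by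
    intro k
    by_cases hk : ∃ μ ∈ D, ‖ℓ k - μ‖ ≤ δ
    · obtain ⟨μ, hμ, hkμ⟩ := hk
      refine le_add_left ?_
      have hmem : k ∈ Set.Icc (μ.re - δ) (μ.re + δ) := by
        have h1 := Complex.abs_re_le_norm (ℓ k - μ)
        have h2 : (ℓ k - μ).re = k - μ.re := by simp [hℓ]
        rw [h2] at h1
        have h3 := abs_le.1 (h1.trans hkμ)
        constructor <;> linarith [h3.1, h3.2]
      calc ‖F (ℓ k)‖ₑ ^ 2 ≤ (M : ℝ≥0∞) ^ 2 := by
            gcongr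
            rw [← ofReal_norm]
            exact ENNReal.ofReal_le_of_le_toReal (hnear _ (hℓim k) μ hμ hkμ)
        _ = (Set.Icc (μ.re - δ) (μ.re + δ)).indicator (fun _ => (M : ℝ≥0∞) ^ 2) k :=
            (Set.indicator_of_mem hmem (fun _ => (M : ℝ≥0∞) ^ 2)).symm
        _ ≤ _ := Finset.single_le_sum
            (f := fun μ : ℂ => (Set.Icc (μ.re - δ) (μ.re + δ)).indicator
              (fun _ => (M : ℝ≥0∞) ^ 2) k) (fun _ _ => zero_le) (hD.mem_toFinset.2 hμ)
    · push Not at hk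
      refine le_add_right ?_
      rw [← mul_pow]
      gcongr
      rw [← ofReal_norm, ← ofReal_norm]
      refine (ENNReal.ofReal_le_ofReal (hoff _ (hℓim k) fun μ hμ => (hk μ hμ).le)).trans ?_
      rw [ENNReal.ofReal_mul (by simp), Real.norm_of_nonneg (by positivity)]
      simp
  have hm₁ : Continuous fun k => ‖G₁ (ℓ k)‖ := (continuous_horizontal hd₁ hε).norm
  calc ∫⁻ k, ‖F (ℓ k)‖ₑ ^ 2
      ≤ ∫⁻ k, ((c : ℝ≥0∞) ^ 2 * ‖‖G₁ (ℓ k)‖ + ‖G₂ (ℓ k)‖‖ₑ ^ 2 + ∑ μ ∈ hD.toFinset,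
        (Set.Icc (μ.re - δ) (μ.re + δ)).indicator (fun _ => (M : ℝ≥0∞) ^ 2) k) :=
        lintegral_mono hpt
    _ = (c : ℝ≥0∞) ^ 2 * (∫⁻ k, ‖‖G₁ (ℓ k)‖ + ‖G₂ (ℓ k)‖‖ₑ ^ 2) +
        ∑ μ ∈ hD.toFinset, (M : ℝ≥0∞) ^ 2 * ENNReal.ofReal (2 * δ) := by
        have hmeas : Measurable fun k : ℝ => ∑ μ ∈ hD.toFinset,
            (Set.Icc (μ.re - δ) (μ.re + δ)).indicator (fun _ => (M : ℝ≥0∞) ^ 2) k :=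
          Finset.measurable_sum _ fun μ _ => measurable_const.indicator measurableSet_Icc
        rw [lintegral_add_right _ hmeas, lintegral_const_mul' _ _ (by simp),
          lintegral_finsetSum _ fun μ _ => measurable_const.indicator measurableSet_Icc]
        simp_rw [lintegral_indicator_near_le]
    _ ≤ (c : ℝ≥0∞) ^ 2 * (2 * C₁ + 2 * C₂) +
        ∑ μ ∈ hD.toFinset, (M : ℝ≥0∞) ^ 2 * ENNReal.ofReal (2 * δ) := by
        refine add_le_add (mul_le_mul_right ?_ _) le_rfl
        refine (lintegral_enorm_add_sq_le hm₁.aestronglyMeasurable).trans ?_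
        simp only [enorm_norm]
        gcongr
        · exact hC₁ ε hε
        · exact hC₂ ε hε
    _ = _ := by
        push_cast
        rfl

theorem memHardyUpper_inv_smul (x : E) :
    MemHardyUpper fun z : ℂ => (z + Complex.I)⁻¹ • x := by
  refine ⟨fun z hz => ?_, Real.toNNReal Real.pi * ‖x‖₊ ^ 2, fun ε hε => ?_⟩
  · have hz' : 0 < z.im := hz
    refine DifferentiableAt.differentiableWithinAt ?_
    refine DifferentiableAt.smul_const (DifferentiableAt.inv (by fun_prop) fun h0 => ?_) x
    have := congrArg Complex.im h0
    simp at this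
    linarith
  · have h1 : ∀ k : ℝ, (k : ℂ) + ε * Complex.I + Complex.I =
        (k : ℂ) - (-((ε + 1 : ℝ) : ℂ) * Complex.I) := fun k => by push_cast; ring
    have him : (-((ε + 1 : ℝ) : ℂ) * Complex.I).im = -(ε + 1) := by simp
    simp_rw [h1, enorm_smul, mul_pow]
    rw [lintegral_mul_const' _ _ (by finiteness), lintegral_kernel_sq (by rw [him]; linarith), him,
      abs_neg, abs_of_pos (by linarith)]
    push_cast
    gcongr
    · refine ENNReal.ofReal_le_ofReal (div_le_self Real.pi_pos.le (by linarith))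
    · simp [enorm]

theorem memHardyUpper_zero : MemHardyUpper fun _ : ℂ => (0 : E) :=
  ⟨differentiableOn_const _, 0, fun ε _ => by simp⟩

theorem MemHardyUpper.sub {F G : ℂ → E} (hF : MemHardyUpper F) (hG : MemHardyUpper G) :
    MemHardyUpper fun z => F z - G z := by
  refine hF.of_le_off_finite hG (hF.1.sub hG.1) Set.finite_empty (δ := 1) (c := 1) (M := 0)
    (fun z _ _ => ?_) (by simp)
  simpa using norm_sub_le (F z) (G z)

end HardyClass

/-! ### Algebra of Hardy families and boundary operators -/

section Families

variable {H : Type*} [NormedAddCommGroup H] [InnerProductSpace ℂ H]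
  {E E' : Type*} [NormedAddCommGroup E] [InnerProductSpace ℂ E] [NormedAddCommGroup E']
  [InnerProductSpace ℂ E']

theorem IsHardyFamily.comp_left {G : ℂ → H →L[ℂ] E} (hG : IsHardyFamily G) (X : E →L[ℂ] E') :
    IsHardyFamily fun z => X.comp (G z) := fun φ =>
  (hG φ).of_le (X.differentiable.comp_differentiableOn (hG φ).1) ‖X‖₊ fun _ _ => X.le_opNorm _

theorem IsHardyFamily.sub {G G' : ℂ → H →L[ℂ] E} (hG : IsHardyFamily G) (hG' : IsHardyFamily G') :
    IsHardyFamily fun z => G z - G' z := fun φ => (hG φ).sub (hG' φ)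

theorem IsHardyFamily.congr {G G' : ℂ → H →L[ℂ] E} (hG : IsHardyFamily G)
    (h : ∀ z, 0 < z.im → G' z = G z) : IsHardyFamily G' := fun φ =>
  (hG φ).of_le ((hG φ).1.congr fun z hz => by rw [h z hz]) 1 fun z hz => by simp [h z hz]

theorem IsHardyFamily.neg {G : ℂ → H →L[ℂ] E} (hG : IsHardyFamily G) :
    IsHardyFamily fun z => -G z := fun φ =>
  (hG φ).of_le (hG φ).1.neg 1 fun z _ => by simp

variable [CompleteSpace H] [CompleteSpace E] {G G' G'' : ℂ → H →L[ℂ] E}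
  {Φ Φ' : H →L[ℂ] Lp E 2 (volume : Measure ℝ)}

theorem IsBoundaryOperator.congr (hΦ : IsBoundaryOperator G Φ) (hG : IsHardyFamily G)
    (h : ∀ z, 0 < z.im → G' z = G z) : IsBoundaryOperator G' Φ := by
  obtain ⟨Φ', hΦ'⟩ := (hG.congr h).exists_boundaryOperator
  suffices Φ' = Φ by rwa [← this]
  ext φ : 1
  refine Lp.ext ?_
  filter_upwards [(hΦ φ).ae_tendsto, (hΦ' φ).ae_tendsto] with k h1 h2
  refine tendsto_nhds_unique h2 (h1.congr' ?_)
  filter_upwards [self_mem_nhdsWithin] with ε hε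
  have hε' : 0 < ε := hε
  rw [h _ (by simpa using hε')]

theorem IsBoundaryOperator.sub (hΦ : IsBoundaryOperator G Φ) (hΦ' : IsBoundaryOperator G' Φ')
    (hG : IsHardyFamily G) (hG' : IsHardyFamily G') (h : ∀ z, 0 < z.im → G'' z = G z - G' z) :
    IsBoundaryOperator G'' (Φ - Φ') := by
  obtain ⟨Φ'', hΦ''⟩ := ((hG.sub hG').congr h).exists_boundaryOperator
  suffices Φ'' = Φ - Φ' by rwa [← this]
  ext φ : 1
  refine Lp.ext ?_
  filter_upwards [(hΦ φ).ae_tendsto, (hΦ' φ).ae_tendsto, (hΦ'' φ).ae_tendsto,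
    Lp.coeFn_sub (Φ φ) (Φ' φ)] with k h1 h2 h3 h4
  change _ = (Φ φ - Φ' φ : Lp E 2 (volume : Measure ℝ)) k
  rw [h4]
  refine tendsto_nhds_unique h3 ((h1.sub h2).congr' ?_)
  filter_upwards [self_mem_nhdsWithin] with ε hε
  have hε' : 0 < ε := hε
  rw [h _ (by simpa using hε')]
  rfl

theorem IsBoundaryOperator.neg (hΦ : IsBoundaryOperator G Φ) (hG : IsHardyFamily G)
    (h : ∀ z, 0 < z.im → G' z = -G z) : IsBoundaryOperator G' (-Φ) := by
  obtain ⟨Φ', hΦ'⟩ := (hG.neg.congr h).exists_boundaryOperator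
  suffices Φ' = -Φ by rwa [← this]
  ext φ : 1
  refine Lp.ext ?_
  filter_upwards [(hΦ φ).ae_tendsto, (hΦ' φ).ae_tendsto, Lp.coeFn_neg (Φ φ)] with k h1 h2 h4
  change _ = (-Φ φ : Lp E 2 (volume : Measure ℝ)) k
  rw [h4]
  refine tendsto_nhds_unique h2 (h1.neg.congr' ?_)
  filter_upwards [self_mem_nhdsWithin] with ε hε
  have hε' : 0 < ε := hε
  rw [h _ (by simpa using hε')]
  rfl

end Families

section StarFamily

variable {H : Type*} [NormedAddCommGroup H] [InnerProductSpace ℂ H]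

theorem differentiableAt_starFamily [CompleteSpace H] {R : ℂ → H →L[ℂ] H} {z : ℂ}
    (h : DifferentiableAt ℂ R ((starRingEnd ℂ) z)) : DifferentiableAt ℂ (starFamily R) z :=
  differentiableAt_star_conj_iff.2 h

end StarFamily

/-! ### Intertwining relations and Hardy bounds for the perturbed operator -/

section ModelFamilies

variable {H : Type*} [NormedAddCommGroup H] [InnerProductSpace ℂ H] [CompleteSpace H]
  {K : Type*} [NormedAddCommGroup K] [InnerProductSpace ℂ K] [CompleteSpace K]

theorem regularResolvent_eq_comp_compl {S : H →ₗ.[ℂ] H} {z : ℂ}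
    (hfin : (discreteSpectrum S).Finite) (hz : z ∈ opResolventSet S) :
    regularResolvent S z =
      (opResolvent S z).comp ((1 : H →L[ℂ] H) - rieszProjection S) := by
  rw [regularResolvent_eq hz, ContinuousLinearMap.sub_comp, ContinuousLinearMap.comp_sub,
    rieszProjection_comm hfin hz]
  rfl

/-- The hypotheses on the unperturbed and the perturbed operator under which the stationary wave
operators are constructed. -/
structure IsSmoothPerturbation (T : H →ₗ.[ℂ] H) (A B : H →L[ℂ] K) : Prop where
  isClosed : T.IsClosed
  dense : Dense (T.domain : Set H)
  real : ∀ z ∈ opSpectrum T, z.im = 0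
  smooth_left : IsHardyFamily fun z => A.comp (opResolvent T z)
  smooth_right : IsHardyFamily fun z => B.comp (starFamily (opResolvent T) z)
  bounded_free : ∃ C : ℝ, ∀ z : ℂ, z.im ≠ 0 → ‖sandwich T A B z‖ ≤ C
  finite : (discreteSpectrum (perturbed T A B)).Finite
  complementary : complementarySpectrum (perturbed T A B) = opSpectrum T
  bounded : BoundedAwayFromDiscrete (perturbed T A B) A B

namespace IsSmoothPerturbation

variable {T : H →ₗ.[ℂ] H} {A B : H →L[ℂ] K} {z μ : ℂ} (h : IsSmoothPerturbation T A B)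
include h

theorem mem_free (hz : z.im ≠ 0) : z ∈ opResolventSet T := by
  by_contra h0
  exact hz (h.real z h0)

theorem mem_perturbed (hz : z.im ≠ 0) :
    z ∈ opResolventSet (perturbed T A B) ∪ discreteSpectrum (perturbed T A B) := by
  by_contra h0
  rw [Set.mem_union, not_or] at h0
  have h1 : z ∈ complementarySpectrum (perturbed T A B) := ⟨h0.1, h0.2⟩
  rw [h.complementary] at h1
  exact hz (h.real z h1)

theorem mem_perturbed_of_notMem (hz : z.im ≠ 0) (hz' : z ∉ discreteSpectrum (perturbed T A B)) :
    z ∈ opResolventSet (perturbed T A B) :=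
  (h.mem_perturbed hz).resolve_right hz'

theorem mem_free_of_discrete (hμ : μ ∈ discreteSpectrum (perturbed T A B)) :
    μ ∈ opResolventSet T := by
  by_contra h0
  have h1 : μ ∈ opSpectrum T := h0
  rw [← h.complementary] at h1
  exact h1.2 hμ

theorem continuousAt_free (hz : z.im ≠ 0) : ContinuousAt (opResolvent T) z :=
  (differentiableAt_opResolvent (h.mem_free hz)).continuousAt

theorem differentiableAt_regular (hz : z.im ≠ 0) :
    DifferentiableAt ℂ (regularResolvent (perturbed T A B)) z :=
  differentiableAt_regularResolvent h.finite (h.mem_perturbed hz)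

theorem eq_of_eq_perturbed {E : Type*} [TopologicalSpace E] [T2Space E] {f g : ℂ → E}
    (hz : z.im ≠ 0) (hf : ContinuousAt f z) (hg : ContinuousAt g z)
    (hfg : ∀ w, w ∈ opResolventSet T → w ∈ opResolventSet (perturbed T A B) → f w = g w) :
    f z = g z := by
  refine tendsto_nhds_unique (hf.tendsto.mono_left (nhdsWithin_le_nhds (s := {z}ᶜ)))
    ((hg.tendsto.mono_left nhdsWithin_le_nhds).congr' ?_)
  filter_upwards [eventually_mem_opResolventSet (h.mem_perturbed hz),
    nhdsWithin_le_nhds (isOpen_opResolventSet.mem_nhds (h.mem_free hz))] with w hw hw'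
  exact (hfg w hw' hw).symm

/-- On the common resolvent set this is 1 − P applied to R₀ − R_V = R_V V R₀; continuity carries it
to the non-real eigenvalues of L. It is one of the two relations that the chain rule takes as input.
-/
theorem intertwine_direct (hz : z.im ≠ 0) :
    ((1 : H →L[ℂ] H) - rieszProjection (perturbed T A B)).comp (opResolvent T z) -
      (regularResolvent (perturbed T A B) z).comp
        ((1 : H →L[ℂ] H) - rieszProjection (perturbed T A B)) =
    (regularResolvent (perturbed T A B) z).comp
      ((adjoint B).comp (A.comp (opResolvent T z))) := by
  rw [regularResolvent_comp_compl h.finite (h.mem_perturbed hz)]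
  have hc := (h.differentiableAt_regular hz).continuousAt
  have hc₀ := h.continuousAt_free hz
  refine h.eq_of_eq_perturbed
    (f := fun z => ((1 : H →L[ℂ] H) - rieszProjection (perturbed T A B)).comp (opResolvent T z) -
      regularResolvent (perturbed T A B) z)
    (g := fun z => (regularResolvent (perturbed T A B) z).comp
      ((adjoint B).comp (A.comp (opResolvent T z)))) hz ?_ ?_ fun w hw₀ hw => ?_
  · exact (continuousAt_const.clm_comp hc₀).sub hc
  · exact hc.clm_comp (continuousAt_const.clm_comp (continuousAt_const.clm_comp hc₀))
  · have h1 := opResolvent_perturbed_left hw₀ hw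
    rw [eq_sub_iff_add_eq, ← eq_sub_iff_add_eq'] at h1
    rw [regularResolvent_eq hw, ← ContinuousLinearMap.comp_sub, ← h1]
    rfl

/-- The counterpart with the roles of T and L exchanged; −B appears because T = L − B*A. -/
theorem intertwine_inverse (hz : z.im ≠ 0) :
    ((1 : H →L[ℂ] H) - rieszProjection (perturbed T A B)).comp
        (regularResolvent (perturbed T A B) z) -
      (opResolvent T z).comp ((1 : H →L[ℂ] H) - rieszProjection (perturbed T A B)) =
    (opResolvent T z).comp
      ((adjoint (-B)).comp (A.comp (regularResolvent (perturbed T A B) z))) := by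
  rw [compl_comp_regularResolvent h.finite (h.mem_perturbed hz)]
  have hc := (h.differentiableAt_regular hz).continuousAt
  have hc₀ := h.continuousAt_free hz
  refine h.eq_of_eq_perturbed
    (f := fun z => regularResolvent (perturbed T A B) z -
      (opResolvent T z).comp ((1 : H →L[ℂ] H) - rieszProjection (perturbed T A B)))
    (g := fun z => (opResolvent T z).comp
      ((adjoint (-B)).comp (A.comp (regularResolvent (perturbed T A B) z)))) hz
    ?_ ?_ fun w hw₀ hw => ?_
  · exact hc.sub (hc₀.clm_comp continuousAt_const)
  · exact hc₀.clm_comp (continuousAt_const.clm_comp (continuousAt_const.clm_comp hc))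
  · have h1 := opResolvent_perturbed_right hw₀ hw
    rw [eq_sub_iff_add_eq, ← eq_sub_iff_add_eq', ← neg_inj, neg_sub] at h1
    rw [regularResolvent_eq_comp_compl h.finite hw, ← ContinuousLinearMap.sub_comp, ← h1, map_neg]
    ext x
    simp

/-- Formally [P, L] = 0 gives [T, P] = [P, V], and [P, R₀] = R₀[T, P]R₀. The computation avoids
domains by using only bounded operators: both forms of the second resolvent identity and the
commutation of P with R_V. -/
theorem commutator_free (hz : z.im ≠ 0) :
    (rieszProjection (perturbed T A B)).comp (opResolvent T z) -
      (opResolvent T z).comp (rieszProjection (perturbed T A B)) =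
    (opResolvent T z).comp (((rieszProjection (perturbed T A B)).comp ((adjoint B).comp A) -
      ((adjoint B).comp A).comp (rieszProjection (perturbed T A B))).comp (opResolvent T z)) := by
  have hc₀ := h.continuousAt_free hz
  set P := rieszProjection (perturbed T A B) with hP
  set V := (adjoint B).comp A with hV
  refine h.eq_of_eq_perturbed
    (f := fun z => P.comp (opResolvent T z) - (opResolvent T z).comp P)
    (g := fun z => (opResolvent T z).comp ((P.comp V - V.comp P).comp (opResolvent T z))) hz
    ?_ ?_ fun w hw₀ hw => ?_
  · exact (continuousAt_const.clm_comp hc₀).sub (hc₀.clm_comp continuousAt_const)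
  · exact hc₀.clm_comp (continuousAt_const.clm_comp hc₀)
  · have h1 := opResolvent_perturbed_right hw₀ hw
    have h2 := opResolvent_perturbed_left hw₀ hw
    have h3 := rieszProjection_comm h.finite hw
    simp only [← ContinuousLinearMap.mul_def, ← hV, ← hP] at h1 h2 h3 ⊢
    set R := opResolvent (perturbed T A B) w
    set R₀ := opResolvent T w
    have h4 : R₀ = R + R₀ * (V * R) := sub_eq_iff_eq_add.1 h1.symm
    have h5 : R₀ = R + R * (V * R₀) := sub_eq_iff_eq_add.1 h2.symm
    have h6 : R₀ * P + R₀ * P * V * R₀ = P * R₀ + R₀ * V * P * R₀ := by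
      calc R₀ * P + R₀ * P * V * R₀ = R₀ * (P * (1 + V * R₀)) := by noncomm_ring
        _ = (R + R₀ * (V * R)) * (P * (1 + V * R₀)) := by rw [← h4]
        _ = R * P + R * P * (V * R₀) + R₀ * V * (R * P) + R₀ * V * (R * P) * (V * R₀) := by
          noncomm_ring
        _ = P * (R + R * (V * R₀)) + R₀ * V * (P * (R + R * (V * R₀))) := by
          rw [← h3]
          noncomm_ring
        _ = P * R₀ + R₀ * V * P * R₀ := by
          rw [← h5]
          noncomm_ring
    calc P * R₀ - R₀ * P = (R₀ * P + R₀ * P * V * R₀) - R₀ * V * P * R₀ - R₀ * P := by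
          rw [h6]; abel
      _ = R₀ * ((P * V - V * P) * R₀) := by noncomm_ring

/-- The Riesz projection makes the perturbed resolvent decay away from the discrete spectrum. -/
theorem exists_bound_projection {δ : ℝ} (hδ : 0 < δ) : ∃ M, 0 ≤ M ∧ ∀ z : ℂ, z.im ≠ 0 →
    (∀ μ ∈ discreteSpectrum (perturbed T A B), δ ≤ ‖z - μ‖) →
    z ∈ opResolventSet (perturbed T A B) ∧
      ‖(rieszProjection (perturbed T A B)).comp (opResolvent (perturbed T A B) z)‖ ≤
        M / (1 + ‖z‖) := by
  obtain ⟨M, hM, hb⟩ := exists_bound_sum_away (S := perturbed T A B) (F := h.finite.toFinset)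
    (fun ν hν => h.finite.mem_toFinset.1 hν) hδ
  refine ⟨M, hM, fun z hz hzδ => ?_⟩
  have hz' : z ∈ opResolventSet (perturbed T A B) := by
    refine h.mem_perturbed_of_notMem hz fun h0 => ?_
    have := hzδ z h0
    simp at this
    linarith
  refine ⟨hz', ?_⟩
  rw [rieszProjection_eq_sum h.finite]
  exact hb z hz' fun ν hν => hzδ ν (h.finite.mem_toFinset.1 hν)

theorem exists_bound_regular_near : ∃ δ > 0, ∃ M, 0 ≤ M ∧
    ∀ μ ∈ discreteSpectrum (perturbed T A B), ∀ w, ‖w - μ‖ ≤ δ →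
      ‖regularResolvent (perturbed T A B) w‖ ≤ M :=
  exists_bound_near_of_continuousAt h.finite fun _ hμ =>
    (differentiableAt_regularResolvent h.finite (Or.inr hμ)).continuousAt

theorem exists_bound_free_near : ∃ δ > 0, ∃ M, 0 ≤ M ∧
    ∀ μ ∈ discreteSpectrum (perturbed T A B), ∀ w, ‖w - μ‖ ≤ δ → ‖opResolvent T w‖ ≤ M :=
  exists_bound_near_of_continuousAt h.finite fun _ hμ =>
    (differentiableAt_opResolvent (h.mem_free_of_discrete hμ)).continuousAt

/-- The radius δ is one within which the regular part is bounded by continuity. Outside, the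
hypothesis on Q_V is used with this δ, and the correction AP R_V B* is bounded because PR_V is. -/
theorem exists_bound_regular_sandwich : ∃ C : ℝ, ∀ z : ℂ, z.im ≠ 0 →
    ‖A.comp ((regularResolvent (perturbed T A B) z).comp (adjoint B))‖ ≤ C := by
  obtain ⟨δ, hδ, M, hM, hnear⟩ := h.exists_bound_regular_near
  obtain ⟨M', hM', hoff⟩ := h.exists_bound_projection hδ
  obtain ⟨C, hC⟩ := h.bounded δ hδ
  have hcomp : ∀ (X : H →L[ℂ] H) (m : ℝ), ‖X‖ ≤ m →
      ‖A.comp (X.comp (adjoint B))‖ ≤ ‖A‖ * (m * ‖adjoint B‖) := fun X m hX =>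
    (ContinuousLinearMap.opNorm_comp_le _ _).trans (by
      gcongr
      exact (ContinuousLinearMap.opNorm_comp_le _ _).trans (by gcongr))
  refine ⟨max (C + ‖A‖ * (M' * ‖adjoint B‖)) (‖A‖ * (M * ‖adjoint B‖)), fun z hz => ?_⟩
  by_cases hk : ∃ μ ∈ discreteSpectrum (perturbed T A B), ‖z - μ‖ ≤ δ
  · obtain ⟨μ, hμ, hzμ⟩ := hk
    exact (hcomp _ _ (hnear μ hμ z hzμ)).trans (le_max_right _ _)
  · push Not at hk
    have hk' := fun μ hμ => (hk μ hμ).le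
    obtain ⟨hzρ, hb⟩ := hoff z hz hk'
    have h1 : A.comp ((regularResolvent (perturbed T A B) z).comp (adjoint B)) =
        sandwich (perturbed T A B) A B z - A.comp (((rieszProjection (perturbed T A B)).comp
          (opResolvent (perturbed T A B) z)).comp (adjoint B)) := by
      rw [regularResolvent_eq hzρ, sandwich]
      ext x
      simp
    rw [h1]
    refine (norm_sub_le _ _).trans (le_trans ?_ (le_max_left _ _))
    exact add_le_add (hC z hz hk') (hcomp _ _ (hb.trans (div_le_self hM' (by
      linarith [norm_nonneg z]))))

theorem differentiableOn_regular_apply (X : H →L[ℂ] K) (φ : H) : DifferentiableOn ℂ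
    (fun z => X (regularResolvent (perturbed T A B) z φ)) {z | 0 < z.im} := fun z hz => by
  have hz' : z.im ≠ 0 := ne_of_gt hz
  exact (X.differentiableAt.comp z
    ((h.differentiableAt_regular hz').clm_apply
      (differentiableAt_const φ))).differentiableWithinAt

theorem differentiableOn_star_regular_apply (X : H →L[ℂ] K) (φ : H) : DifferentiableOn ℂ
    (fun z => X (starFamily (regularResolvent (perturbed T A B)) z φ)) {z | 0 < z.im} :=
  fun z hz => by
  have hz' : ((starRingEnd ℂ) z).im ≠ 0 := by
    have : 0 < z.im := hz
    simp [this.ne']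
  exact (X.differentiableAt.comp z
    ((differentiableAt_starFamily (h.differentiableAt_regular hz')).clm_apply
      (differentiableAt_const φ))).differentiableWithinAt

theorem differentiableOn_free_apply (X : H →L[ℂ] H) (φ : H) : DifferentiableOn ℂ
    (fun z => X (opResolvent T z φ)) {z | 0 < z.im} := fun z hz => by
  have hz' : z.im ≠ 0 := ne_of_gt hz
  exact (X.differentiableAt.comp z
    ((differentiableAt_opResolvent (h.mem_free hz')).clm_apply
      (differentiableAt_const φ))).differentiableWithinAt

theorem differentiableOn_star_free_apply (X : H →L[ℂ] H) (φ : H) : DifferentiableOn ℂ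
    (fun z => X (starFamily (opResolvent T) z φ)) {z | 0 < z.im} := fun z hz => by
  have hz' : ((starRingEnd ℂ) z).im ≠ 0 := by
    have : 0 < z.im := hz
    simp [this.ne']
  exact (X.differentiableAt.comp z
    ((differentiableAt_starFamily (differentiableAt_opResolvent (h.mem_free hz'))).clm_apply
      (differentiableAt_const φ))).differentiableWithinAt

/-- Away from the discrete spectrum AR_V = (1 − Q_V)AR₀, applied to (1 − P)φ, transfers the Hardy
bound of T; near it the regular part is bounded. -/
theorem isHardyFamily_regular :
    IsHardyFamily fun z => A.comp (regularResolvent (perturbed T A B) z) := by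
  intro φ
  obtain ⟨δ, hδ, M, hM, hnear⟩ := h.exists_bound_regular_near
  obtain ⟨M', hM', hoff⟩ := h.exists_bound_projection hδ
  obtain ⟨C, hC⟩ := h.bounded δ hδ
  set φ' := ((1 : H →L[ℂ] H) - rieszProjection (perturbed T A B)) φ with hφ'
  refine (h.smooth_left φ').of_le_off_finite (memHardyUpper_zero (E := K))
    (h.differentiableOn_regular_apply A φ) h.finite (δ := δ) (c := 1 + ‖C‖₊)
    (M := ‖A‖₊ * (M.toNNReal * ‖φ‖₊)) (fun z hz hzδ => ?_) (fun z hz μ hμ hzμ => ?_)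
  · obtain ⟨hzρ, -⟩ := hoff z hz.ne' hzδ
    have h1 := congrArg (fun X : H →L[ℂ] H => A (X φ'))
      (opResolvent_perturbed_left (h.mem_free hz.ne') hzρ)
    have h2 : A (regularResolvent (perturbed T A B) z φ) =
        A (opResolvent T z φ') - sandwich (perturbed T A B) A B z (A (opResolvent T z φ')) := by
      rw [regularResolvent_eq_comp_compl h.finite hzρ, ContinuousLinearMap.comp_apply, ← hφ']
      simpa [sandwich] using h1
    simp only [ContinuousLinearMap.comp_apply, norm_zero, add_zero]
    rw [h2]
    refine (norm_sub_le _ _).trans ?_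
    have h3 := (sandwich (perturbed T A B) A B z).le_of_opNorm_le
      ((hC z hz.ne' hzδ).trans (le_abs_self C)) (A (opResolvent T z φ'))
    push_cast
    rw [add_mul, one_mul, Real.norm_eq_abs]
    gcongr
  · push_cast
    rw [Real.coe_toNNReal M hM]
    refine (A.le_opNorm _).trans ?_
    refine mul_le_mul_of_nonneg_left ?_ (norm_nonneg A)
    exact ContinuousLinearMap.le_of_opNorm_le _ (hnear μ hμ z hzμ) φ

/-- The adjoint argument with BR_V* = (1 − Q_V*)BR₀*. All bounds are taken at z̄, so the exceptional
set is the conjugate of the discrete spectrum. -/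
theorem isHardyFamily_star_regular :
    IsHardyFamily fun z => B.comp (starFamily (regularResolvent (perturbed T A B)) z) := by
  intro ψ
  obtain ⟨δ, hδ, M, hM, hnear⟩ := h.exists_bound_regular_near
  obtain ⟨M', hM', hoff⟩ := h.exists_bound_projection hδ
  obtain ⟨C, hC⟩ := h.bounded δ hδ
  set ψ' := adjoint ((1 : H →L[ℂ] H) - rieszProjection (perturbed T A B)) ψ with hψ'
  have hconj : ∀ z μ : ℂ, ‖(starRingEnd ℂ) z - μ‖ = ‖z - (starRingEnd ℂ) μ‖ := fun z μ => by
    rw [← RCLike.norm_conj, map_sub, Complex.conj_conj]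
  refine (h.smooth_right ψ').of_le_off_finite (memHardyUpper_zero (E := K))
    (h.differentiableOn_star_regular_apply B ψ)
    (h.finite.image (starRingEnd ℂ)) (δ := δ) (c := 1 + ‖C‖₊)
    (M := ‖B‖₊ * (M.toNNReal * ‖ψ‖₊)) (fun z hz hzδ => ?_) (fun z hz μ hμ hzμ => ?_)
  · have hz' : ((starRingEnd ℂ) z).im ≠ 0 := by simp [hz.ne']
    have hzδ' : ∀ μ ∈ discreteSpectrum (perturbed T A B), δ ≤ ‖(starRingEnd ℂ) z - μ‖ :=
      fun μ hμ => by
        rw [hconj]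
        exact hzδ _ ⟨μ, hμ, rfl⟩
    obtain ⟨hzρ, -⟩ := hoff _ hz' hzδ'
    have h1 := congrArg (fun X : H →L[ℂ] H => B (adjoint X ψ'))
      (opResolvent_perturbed_right (h.mem_free hz') hzρ)
    have h2 : B (starFamily (regularResolvent (perturbed T A B)) z ψ) =
        B (starFamily (opResolvent T) z ψ') -
          adjoint (sandwich (perturbed T A B) A B ((starRingEnd ℂ) z))
            (B (starFamily (opResolvent T) z ψ')) := by
      rw [starFamily, regularResolvent_eq hzρ,
        ContinuousLinearMap.adjoint_comp, ContinuousLinearMap.comp_apply, ← hψ']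
      simpa [sandwich, starFamily, ContinuousLinearMap.adjoint_comp] using h1
    simp only [ContinuousLinearMap.comp_apply, norm_zero, add_zero]
    rw [h2]
    refine (norm_sub_le _ _).trans ?_
    have h4 : ‖adjoint (sandwich (perturbed T A B) A B ((starRingEnd ℂ) z))‖ ≤ |C| := by
      rw [LinearIsometryEquiv.norm_map]
      exact (hC _ hz' hzδ').trans (le_abs_self C)
    have h3 := ContinuousLinearMap.le_of_opNorm_le _ h4 (B (starFamily (opResolvent T) z ψ'))
    push_cast
    rw [add_mul, one_mul, Real.norm_eq_abs]
    gcongr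
  · obtain ⟨ν, hν, rfl⟩ := hμ
    rw [← hconj] at hzμ
    push_cast
    rw [Real.coe_toNNReal M hM]
    refine (B.le_opNorm _).trans ?_
    refine mul_le_mul_of_nonneg_left ?_ (norm_nonneg B)
    refine ContinuousLinearMap.le_of_opNorm_le _ ?_ ψ
    rw [starFamily, LinearIsometryEquiv.norm_map]
    exact hnear ν hν _ hzμ

/-- Away from the discrete spectrum PR₀ = PR_V + PR_V B*AR₀. The first term is O(1/|z|), dominated
by `memHardyUpper_inv_smul`, and the second is a bounded factor times AR₀φ. Near the discrete
spectrum, which is disjoint from the spectrum of T, R₀ is bounded. -/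
theorem isHardyFamily_projection_free :
    IsHardyFamily fun z => (rieszProjection (perturbed T A B)).comp (opResolvent T z) := by
  intro φ
  obtain ⟨δ, hδ, M, hM, hnear⟩ := h.exists_bound_free_near
  obtain ⟨M', hM', hoff⟩ := h.exists_bound_projection hδ
  set P := rieszProjection (perturbed T A B) with hP
  refine (memHardyUpper_inv_smul φ).of_le_off_finite ((h.smooth_left φ).of_le
    ((adjoint B).differentiable.comp_differentiableOn (h.smooth_left φ).1) ‖adjoint B‖₊
      fun z _ => (adjoint B).le_opNorm _)
    (h.differentiableOn_free_apply P φ) h.finite (δ := δ) (c := M'.toNNReal)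
    (M := ‖P‖₊ * (M.toNNReal * ‖φ‖₊)) (fun z hz hzδ => ?_) (fun z hz μ hμ hzμ => ?_)
  · obtain ⟨hzρ, hb⟩ := hoff z hz.ne' hzδ
    have h1 := opResolvent_perturbed_left (h.mem_free hz.ne') hzρ
    have h2 : P (opResolvent T z φ) = (P.comp (opResolvent (perturbed T A B) z)) φ +
        (P.comp (opResolvent (perturbed T A B) z)) (adjoint B (A (opResolvent T z φ))) := by
      have h3 := congrArg (fun X : H →L[ℂ] H => P (X φ)) h1
      simp only [sub_apply, ContinuousLinearMap.comp_apply, map_sub] at h3 ⊢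
      rw [h3]
      abel
    have hz1 : ‖z + Complex.I‖ ≤ 1 + ‖z‖ := by
      have := norm_add_le z Complex.I
      rw [Complex.norm_I] at this
      linarith
    have hz0 : 0 < ‖z + Complex.I‖ := by
      rw [norm_pos_iff]
      intro h0
      have := congrArg Complex.im h0
      simp at this
      linarith
    have h4 : (1 + ‖z‖)⁻¹ ≤ ‖z + Complex.I‖⁻¹ := by gcongr
    have h5 : M' / (1 + ‖z‖) ≤ M' := div_le_self hM' (by linarith [norm_nonneg z])
    simp only [ContinuousLinearMap.comp_apply]
    rw [h2, Real.coe_toNNReal M' hM', mul_add, norm_smul, norm_inv]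
    refine (norm_add_le _ _).trans (add_le_add ?_ ?_)
    · refine (ContinuousLinearMap.le_of_opNorm_le _ hb φ).trans ?_
      rw [div_eq_mul_inv, mul_assoc]
      gcongr
    · exact ContinuousLinearMap.le_of_opNorm_le _ (hb.trans h5) _
  · push_cast
    rw [Real.coe_toNNReal M hM]
    refine (P.le_opNorm _).trans ?_
    refine mul_le_mul_of_nonneg_left ?_ (norm_nonneg P)
    exact ContinuousLinearMap.le_of_opNorm_le _ (hnear μ hμ z hzμ) φ

theorem isHardyFamily_projection_star_free : IsHardyFamily fun z =>
    (adjoint (rieszProjection (perturbed T A B))).comp (starFamily (opResolvent T) z) := by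
  intro ψ
  obtain ⟨δ, hδ, M, hM, hnear⟩ := h.exists_bound_free_near
  obtain ⟨M', hM', hoff⟩ := h.exists_bound_projection hδ
  set P := rieszProjection (perturbed T A B) with hP
  have hconj : ∀ z μ : ℂ, ‖(starRingEnd ℂ) z - μ‖ = ‖z - (starRingEnd ℂ) μ‖ := fun z μ => by
    rw [← RCLike.norm_conj, map_sub, Complex.conj_conj]
  refine (memHardyUpper_inv_smul ψ).of_le_off_finite ((h.smooth_right ψ).of_le
    ((adjoint A).differentiable.comp_differentiableOn (h.smooth_right ψ).1) ‖adjoint A‖₊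
      fun z _ => (adjoint A).le_opNorm _)
    (h.differentiableOn_star_free_apply (adjoint P) ψ) (h.finite.image (starRingEnd ℂ)) (δ := δ)
    (c := M'.toNNReal) (M := ‖P‖₊ * (M.toNNReal * ‖ψ‖₊)) (fun z hz hzδ => ?_)
    (fun z hz μ hμ hzμ => ?_)
  · have hz' : ((starRingEnd ℂ) z).im ≠ 0 := by simp [hz.ne']
    obtain ⟨hzρ, hb⟩ := hoff _ hz' fun μ hμ => by
      rw [hconj]
      exact hzδ _ ⟨μ, hμ, rfl⟩
    rw [RCLike.norm_conj] at hb
    have h1 := opResolvent_perturbed_right (h.mem_free hz') hzρ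
    set D := adjoint (P.comp (opResolvent (perturbed T A B) ((starRingEnd ℂ) z))) with hD
    have hDn : ‖D‖ ≤ M' / (1 + ‖z‖) := by
      rw [hD, LinearIsometryEquiv.norm_map]
      exact hb
    have hD' : D = (adjoint P).comp
        (adjoint (opResolvent (perturbed T A B) ((starRingEnd ℂ) z))) := by
      rw [hD, rieszProjection_comm h.finite hzρ, ContinuousLinearMap.adjoint_comp]
    have h2 : adjoint P (starFamily (opResolvent T) z ψ) = D ψ +
        D (adjoint A (B (starFamily (opResolvent T) z ψ))) := by
      have h3 := congrArg (fun X : H →L[ℂ] H => adjoint P (adjoint X ψ)) h1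
      rw [hD']
      simp only [starFamily, map_sub, sub_apply, ContinuousLinearMap.adjoint_comp,
        ContinuousLinearMap.adjoint_adjoint, ContinuousLinearMap.comp_apply] at h3 ⊢
      rw [h3]
      abel
    have hz1 : ‖z + Complex.I‖ ≤ 1 + ‖z‖ := by
      have := norm_add_le z Complex.I
      rw [Complex.norm_I] at this
      linarith
    have hz0 : 0 < ‖z + Complex.I‖ := by
      rw [norm_pos_iff]
      intro h0
      have := congrArg Complex.im h0
      simp at this
      linarith
    have h4 : (1 + ‖z‖)⁻¹ ≤ ‖z + Complex.I‖⁻¹ := by gcongr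
    have h5 : M' / (1 + ‖z‖) ≤ M' := div_le_self hM' (by linarith [norm_nonneg z])
    simp only [ContinuousLinearMap.comp_apply]
    rw [h2, Real.coe_toNNReal M' hM', mul_add, norm_smul, norm_inv]
    refine (norm_add_le _ _).trans (add_le_add ?_ ?_)
    · refine (ContinuousLinearMap.le_of_opNorm_le _ hDn ψ).trans ?_
      rw [div_eq_mul_inv, mul_assoc]
      gcongr
    · exact ContinuousLinearMap.le_of_opNorm_le _ (hDn.trans h5) _
  · obtain ⟨ν, hν, rfl⟩ := hμ
    rw [← hconj] at hzμ
    push_cast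
    rw [Real.coe_toNNReal M hM, ← LinearIsometryEquiv.norm_map adjoint P]
    refine ((adjoint P).le_opNorm _).trans ?_
    refine mul_le_mul_of_nonneg_left ?_ (norm_nonneg _)
    refine ContinuousLinearMap.le_of_opNorm_le _ ?_ ψ
    rw [starFamily, LinearIsometryEquiv.norm_map]
    exact hnear ν hν _ hzμ

end IsSmoothPerturbation

end ModelFamilies

/-! ### The forms of the wave operators -/

section BoundaryValues

variable {H : Type*} [NormedAddCommGroup H] [InnerProductSpace ℂ H]
  {E : Type*} [NormedAddCommGroup E] [InnerProductSpace ℂ E]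

theorem IsBoundaryOperator.apply_eq_zero {G : ℂ → H →L[ℂ] E}
    {Φ : H →L[ℂ] Lp E 2 (volume : Measure ℝ)} (h : IsBoundaryOperator G Φ) {φ : H}
    (h0 : ∀ z, 0 < z.im → G z φ = 0) : Φ φ = 0 := by
  refine Lp.ext ?_
  filter_upwards [(h φ).ae_tendsto, Lp.coeFn_zero E 2 (volume : Measure ℝ)] with k h1 h2
  rw [h2]
  refine tendsto_nhds_unique h1 (tendsto_const_nhds.congr' ?_)
  filter_upwards [self_mem_nhdsWithin] with ε hε
  have hε' : 0 < ε := hε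
  exact (h0 _ (by simpa using hε')).symm

theorem IsHardyBoundary.ae_upperLimit {F G : ℂ → E} {f : ℝ → E} (h : IsHardyBoundary F f)
    (hG : ∀ᵐ k : ℝ, ∀ ε : ℝ, 0 < ε →
      G ((k : ℂ) + (ε : ℂ) * Complex.I) = F ((k : ℂ) + (ε : ℂ) * Complex.I)) :
    ∀ᵐ k : ℝ, HasUpperLimit G k ∧ upperLimit G k = f k := by
  filter_upwards [h.ae_tendsto, hG] with k h1 h2
  have h3 : Tendsto (fun ε : ℝ => G ((k : ℂ) + (ε : ℂ) * Complex.I)) (𝓝[>] (0 : ℝ))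
      (𝓝 (f k)) := by
    refine h1.congr' ?_
    filter_upwards [self_mem_nhdsWithin] with ε hε
    exact (h2 ε hε).symm
  exact ⟨⟨_, h3⟩, h3.limUnder_eq⟩

theorem integral_inner_of_ae_eq {f g : Lp E 2 (volume : Measure ℝ)} {u v : ℝ → E}
    (hu : ∀ᵐ k, u k = f k) (hv : ∀ᵐ k, v k = g k) :
    Integrable (fun k => (inner ℂ (u k) (v k) : ℂ)) ∧
      ∫ k, (inner ℂ (u k) (v k) : ℂ) = inner ℂ f g := by
  have h : (fun k => (inner ℂ (u k) (v k) : ℂ)) =ᵐ[volume] fun k => inner ℂ (f k) (g k) := by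
    filter_upwards [hu, hv] with k h1 h2
    rw [h1, h2]
  exact ⟨(L2.integrable_inner f g).congr h.symm, by rw [integral_congr_ae h, L2.inner_def]⟩

end BoundaryValues

section WaveOperatorForms

variable {H : Type*} [NormedAddCommGroup H] [InnerProductSpace ℂ H]
  {K : Type*} [NormedAddCommGroup K] [InnerProductSpace ℂ K] {T : H →ₗ.[ℂ] H} {A B : H →L[ℂ] K}

theorem ae_upperLimit_free {Φ₀ : H →L[ℂ] Lp K 2 (volume : Measure ℝ)}
    (hΦ₀ : IsBoundaryOperator (fun z => A.comp (opResolvent T z)) Φ₀) (φ : H) :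
    ∀ᵐ k : ℝ, HasUpperLimit (fun z => A (opResolvent T z φ)) k ∧
      upperLimit (fun z => A (opResolvent T z φ)) k = Φ₀ φ k :=
  (hΦ₀ φ).ae_upperLimit (ae_of_all _ fun _ _ _ => rfl)

variable [CompleteSpace H] [CompleteSpace K]

/-- The form is prescribed on the ranges of 1 − Q and of Q, with Q the Riesz projection of L*, and
these span the space. -/
theorem IsDirectWaveOperator.unique {W W' : H →L[ℂ] H} (hW : IsDirectWaveOperator T A B W)
    (hW' : IsDirectWaveOperator T A B W') : W' = W := by
  refine ContinuousLinearMap.ext fun φ => ext_inner_left ℂ fun ψ => ?_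
  set Q := rieszProjection (perturbed T A B).adjoint with hQ
  have h1 : ψ = ((1 : H →L[ℂ] H) - Q) ψ + Q ψ := by simp
  have hc : ((1 : H →L[ℂ] H) - Q) ψ ∈ continuousSubspace (perturbed T A B).adjoint := ⟨ψ, rfl⟩
  have hd : Q ψ ∈ discreteSubspace (perturbed T A B).adjoint := ⟨ψ, rfl⟩
  rw [h1, inner_add_left, inner_add_left, hW.1 _ _ hc, hW'.1 _ _ hc, hW.2 _ _ hd, hW'.2 _ _ hd]

theorem IsInverseWaveOperator.unique {Z Z' : H →L[ℂ] H} (hZ : IsInverseWaveOperator T A B Z)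
    (hZ' : IsInverseWaveOperator T A B Z') : Z' = Z := by
  refine ContinuousLinearMap.ext fun φ => ext_inner_left ℂ fun ψ => ?_
  set P := rieszProjection (perturbed T A B) with hP
  have h1 : φ = ((1 : H →L[ℂ] H) - P) φ + P φ := by simp
  have hc : ((1 : H →L[ℂ] H) - P) φ ∈ continuousSubspace (perturbed T A B) := ⟨φ, rfl⟩
  have hd : P φ ∈ discreteSubspace (perturbed T A B) := ⟨φ, rfl⟩
  rw [h1, map_add, map_add, inner_add_right, inner_add_right, hZ.1 _ hc, hZ'.1 _ hc, hZ.2 _ hd,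
    hZ'.2 _ hd]

end WaveOperatorForms

/-! ### The wave operators and their products -/

namespace IsSmoothPerturbation

variable {H : Type*} [NormedAddCommGroup H] [InnerProductSpace ℂ H] [CompleteSpace H]
  {K : Type*} [NormedAddCommGroup K] [InnerProductSpace ℂ K] [CompleteSpace K]
  {T : H →ₗ.[ℂ] H} {A B : H →L[ℂ] K} (h : IsSmoothPerturbation T A B)
include h

theorem dense_perturbed : Dense ((perturbed T A B).domain : Set H) := h.dense

theorem rieszProjection_perturbed_adjoint :
    rieszProjection (perturbed T A B).adjoint = adjoint (rieszProjection (perturbed T A B)) :=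
  rieszProjection_adjoint h.dense_perturbed (perturbed_isClosed h.isClosed) h.finite

/-- At a non-real eigenvalue the resolvent has the default value zero and differs from the regular
part. Only finitely many vertical lines meet such points, so boundary values are unaffected almost
everywhere. -/
theorem ae_notMem_discrete : ∀ᵐ k : ℝ, ∀ ε : ℝ, 0 < ε →
    (k : ℂ) + (ε : ℂ) * Complex.I ∈ opResolventSet (perturbed T A B) ∧
      (starRingEnd ℂ) ((k : ℂ) + (ε : ℂ) * Complex.I) ∈ opResolventSet (perturbed T A B) := by
  have hfin : (Complex.re '' discreteSpectrum (perturbed T A B)).Finite := h.finite.image _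
  filter_upwards [hfin.countable.ae_notMem volume] with k hk ε hε
  constructor
  · refine h.mem_perturbed_of_notMem (by simp [hε.ne']) fun h0 => hk ⟨_, h0, by simp⟩
  · refine h.mem_perturbed_of_notMem (by simp [hε.ne']) fun h0 => hk ⟨_, h0, by simp⟩

theorem projection_eq_zero_of_mem {φ : H} (hφ : φ ∈ continuousSubspace (perturbed T A B)) :
    rieszProjection (perturbed T A B) φ = 0 := by
  obtain ⟨x, rfl⟩ := hφ
  have h1 := congrArg (fun X : H →L[ℂ] H => X x) (rieszProjection_idempotent h.finite)
  simp only [ContinuousLinearMap.comp_apply] at h1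
  simp [h1]

theorem adjoint_projection_eq_zero_of_mem {ψ : H}
    (hψ : ψ ∈ continuousSubspace (perturbed T A B).adjoint) :
    adjoint (rieszProjection (perturbed T A B)) ψ = 0 := by
  obtain ⟨x, rfl⟩ := hψ
  rw [h.rieszProjection_perturbed_adjoint]
  have h1 := congrArg (fun X : H →L[ℂ] H => adjoint X x) (rieszProjection_idempotent h.finite)
  simp only [ContinuousLinearMap.adjoint_comp, ContinuousLinearMap.comp_apply] at h1
  simp [h1]

variable {Φ₀ Φc Ψ₀ Ψc : H →L[ℂ] Lp K 2 (volume : Measure ℝ)}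

theorem ae_upperLimit_star_free
    (hΨ₀ : IsBoundaryOperator (fun z => B.comp (starFamily (opResolvent T) z)) Ψ₀) (ψ : H) :
    ∀ᵐ k : ℝ, HasUpperLimit (fun z => B (opResolvent T.adjoint z ψ)) k ∧
      upperLimit (fun z => B (opResolvent T.adjoint z ψ)) k = Ψ₀ ψ k := by
  rw [opResolvent_adjoint h.dense h.isClosed]
  exact (hΨ₀ ψ).ae_upperLimit (ae_of_all _ fun _ _ _ => rfl)

theorem ae_upperLimit_perturbed
    (hΦc : IsBoundaryOperator (fun z => A.comp (regularResolvent (perturbed T A B) z)) Φc)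
    {φ : H} (hφ : φ ∈ continuousSubspace (perturbed T A B)) :
    ∀ᵐ k : ℝ, HasUpperLimit (fun z => A (opResolvent (perturbed T A B) z φ)) k ∧
      upperLimit (fun z => A (opResolvent (perturbed T A B) z φ)) k = Φc φ k := by
  refine (hΦc φ).ae_upperLimit ?_
  filter_upwards [h.ae_notMem_discrete] with k hk ε hε
  rw [regularResolvent_eq_comp_compl h.finite (hk ε hε).1]
  simp [h.projection_eq_zero_of_mem hφ]

theorem ae_upperLimit_star_perturbed
    (hΨc : IsBoundaryOperator
      (fun z => B.comp (starFamily (regularResolvent (perturbed T A B)) z)) Ψc)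
    {ψ : H} (hψ : ψ ∈ continuousSubspace (perturbed T A B).adjoint) :
    ∀ᵐ k : ℝ, HasUpperLimit (fun z => B (opResolvent (perturbed T A B).adjoint z ψ)) k ∧
      upperLimit (fun z => B (opResolvent (perturbed T A B).adjoint z ψ)) k = Ψc ψ k := by
  rw [opResolvent_adjoint h.dense_perturbed (perturbed_isClosed h.isClosed)]
  refine (hΨc ψ).ae_upperLimit ?_
  filter_upwards [h.ae_notMem_discrete] with k hk ε hε
  simp only [starFamily, ContinuousLinearMap.comp_apply]
  rw [regularResolvent_eq (hk ε hε).2, ContinuousLinearMap.adjoint_comp]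
  simp [h.adjoint_projection_eq_zero_of_mem hψ, ContinuousLinearMap.one_def,
    ContinuousLinearMap.adjoint_id]

theorem integral_directIntegrand
    (hΦ₀ : IsBoundaryOperator (fun z => A.comp (opResolvent T z)) Φ₀)
    (hΨc : IsBoundaryOperator
      (fun z => B.comp (starFamily (regularResolvent (perturbed T A B)) z)) Ψc)
    (φ : H) {ψ : H} (hψ : ψ ∈ continuousSubspace (perturbed T A B).adjoint) :
    Integrable (directIntegrand T A B φ ψ) ∧
      ∫ k, directIntegrand T A B φ ψ k = inner ℂ (Ψc ψ) (Φ₀ φ) :=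
  integral_inner_of_ae_eq ((h.ae_upperLimit_star_perturbed hΨc hψ).mono fun _ hk => hk.2)
    ((ae_upperLimit_free hΦ₀ φ).mono fun _ hk => hk.2)

theorem integral_inverseIntegrand
    (hΦc : IsBoundaryOperator (fun z => A.comp (regularResolvent (perturbed T A B) z)) Φc)
    (hΨ₀ : IsBoundaryOperator (fun z => B.comp (starFamily (opResolvent T) z)) Ψ₀)
    {φ : H} (hφ : φ ∈ continuousSubspace (perturbed T A B)) (ψ : H) :
    Integrable (inverseIntegrand T A B φ ψ) ∧
      ∫ k, inverseIntegrand T A B φ ψ k = inner ℂ (Ψ₀ ψ) (Φc φ) :=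
  integral_inner_of_ae_eq ((h.ae_upperLimit_star_free hΨ₀ ψ).mono fun _ hk => hk.2)
    ((h.ae_upperLimit_perturbed hΦc hφ).mono fun _ hk => hk.2)

theorem directFormWellDefined : DirectFormWellDefined T A B := by
  obtain ⟨Φ₀, hΦ₀⟩ := h.smooth_left.exists_boundaryOperator
  obtain ⟨Ψc, hΨc⟩ := h.isHardyFamily_star_regular.exists_boundaryOperator
  exact ⟨fun φ => (ae_upperLimit_free hΦ₀ φ).mono fun _ hk => hk.1,
    fun ψ hψ => (h.ae_upperLimit_star_perturbed hΨc hψ).mono fun _ hk => hk.1,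
    fun φ ψ hψ => (h.integral_directIntegrand hΦ₀ hΨc φ hψ).1⟩

theorem inverseFormWellDefined : InverseFormWellDefined T A B := by
  obtain ⟨Φc, hΦc⟩ := h.isHardyFamily_regular.exists_boundaryOperator
  obtain ⟨Ψ₀, hΨ₀⟩ := h.smooth_right.exists_boundaryOperator
  exact ⟨fun φ hφ => (h.ae_upperLimit_perturbed hΦc hφ).mono fun _ hk => hk.1,
    fun ψ => (h.ae_upperLimit_star_free hΨ₀ ψ).mono fun _ hk => hk.1,
    fun φ hφ ψ => (h.integral_inverseIntegrand hΦc hΨ₀ hφ ψ).1⟩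

/-- On the continuous subspace of L* the operator P* vanishes, so the identification 1 − P
contributes (φ, ψ). On the discrete subspace both the identification term and the boundary values of
the regular part vanish. -/
theorem isDirectWaveOperator
    (hΦ₀ : IsBoundaryOperator (fun z => A.comp (opResolvent T z)) Φ₀)
    (hΨc : IsBoundaryOperator
      (fun z => B.comp (starFamily (regularResolvent (perturbed T A B)) z)) Ψc) :
    IsDirectWaveOperator T A B
      (waveOperator ((1 : H →L[ℂ] H) - rieszProjection (perturbed T A B)) Φ₀ Ψc) := by
  refine ⟨fun φ ψ hψ => ?_, fun φ ψ hψ => ?_⟩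
  · rw [inner_waveOperator, (h.integral_directIntegrand hΦ₀ hΨc φ hψ).2, one_div, sub_apply,
      inner_sub_right, ← ContinuousLinearMap.adjoint_inner_left (rieszProjection _),
      h.adjoint_projection_eq_zero_of_mem hψ, inner_zero_left, sub_zero]
    rfl
  · obtain ⟨y, rfl⟩ := hψ
    rw [h.rieszProjection_perturbed_adjoint, inner_waveOperator]
    have h1 : Ψc (adjoint (rieszProjection (perturbed T A B)) y) = 0 := by
      refine hΨc.apply_eq_zero fun z hz => ?_
      have hz' : ((starRingEnd ℂ) z).im ≠ 0 := by simp [hz.ne']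
      have h2 := compl_comp_regularResolvent h.finite (h.mem_perturbed hz')
      rw [ContinuousLinearMap.sub_comp] at h2
      have h3 : (rieszProjection (perturbed T A B)).comp
          (regularResolvent (perturbed T A B) ((starRingEnd ℂ) z)) = 0 :=
        sub_eq_self.1 h2
      have h4 := congrArg (fun X : H →L[ℂ] H => adjoint X y) h3
      simp only [ContinuousLinearMap.adjoint_comp, ContinuousLinearMap.comp_apply, map_zero,
        zero_apply] at h4
      simp [starFamily, h4]
    have h5 := congrArg (fun X : H →L[ℂ] H => X φ) (rieszProjection_idempotent h.finite)
    simp only [ContinuousLinearMap.comp_apply] at h5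
    simp only [ContinuousLinearMap.coe_coe]
    rw [h1, inner_zero_left, mul_zero, sub_zero, ContinuousLinearMap.adjoint_inner_left, sub_apply,
      map_sub, h5]
    simp

theorem isInverseWaveOperator
    (hΦc : IsBoundaryOperator (fun z => A.comp (regularResolvent (perturbed T A B) z)) Φc)
    (hΨ₀ : IsBoundaryOperator (fun z => B.comp (starFamily (opResolvent T) z)) Ψ₀) :
    IsInverseWaveOperator T A B
      (waveOperator ((1 : H →L[ℂ] H) - rieszProjection (perturbed T A B)) Φc (-Ψ₀)) := by
  refine ⟨fun φ hφ ψ => ?_, fun φ hφ ψ => ?_⟩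
  · rw [inner_waveOperator, (h.integral_inverseIntegrand hΦc hΨ₀ hφ ψ).2, one_div, sub_apply,
      h.projection_eq_zero_of_mem hφ, sub_zero, neg_apply, inner_neg_left, mul_neg, sub_neg_eq_add]
    rfl
  · obtain ⟨y, rfl⟩ := hφ
    rw [inner_waveOperator]
    have h1 : Φc (rieszProjection (perturbed T A B) y) = 0 := by
      refine hΦc.apply_eq_zero fun z hz => ?_
      have h2 := regularResolvent_comp_compl h.finite (h.mem_perturbed hz.ne')
      rw [ContinuousLinearMap.comp_sub] at h2
      have h3 : (regularResolvent (perturbed T A B) z).comp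
          (rieszProjection (perturbed T A B)) = 0 := sub_eq_self.1 h2
      have h4 := congrArg (fun X : H →L[ℂ] H => X y) h3
      simp only [ContinuousLinearMap.comp_apply, zero_apply] at h4
      simp [h4]
    have h5 := congrArg (fun X : H →L[ℂ] H => X y) (rieszProjection_idempotent h.finite)
    simp only [ContinuousLinearMap.comp_apply] at h5
    simp only [ContinuousLinearMap.coe_coe]
    rw [h1, inner_zero_right, mul_zero, sub_zero, sub_apply, h5]
    simp

/-- The chain L, T, L. The regular part absorbs 1 − P on either side, so the composite boundary
operators are again Φc and −Ψc, and the two correction terms cancel. -/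
theorem direct_comp_inverse
    (hΦ₀ : IsBoundaryOperator (fun z => A.comp (opResolvent T z)) Φ₀)
    (hΦc : IsBoundaryOperator (fun z => A.comp (regularResolvent (perturbed T A B) z)) Φc)
    (hΨ₀ : IsBoundaryOperator (fun z => B.comp (starFamily (opResolvent T) z)) Ψ₀)
    (hΨc : IsBoundaryOperator
      (fun z => B.comp (starFamily (regularResolvent (perturbed T A B)) z)) Ψc) :
    (waveOperator ((1 : H →L[ℂ] H) - rieszProjection (perturbed T A B)) Φ₀ Ψc).comp
      (waveOperator ((1 : H →L[ℂ] H) - rieszProjection (perturbed T A B)) Φc (-Ψ₀)) =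
    1 - rieszProjection (perturbed T A B) := by
  obtain ⟨C, hC⟩ := h.bounded_free
  set P := rieszProjection (perturbed T A B) with hP
  have key := waveOperator_comp (R₁ := regularResolvent (perturbed T A B)) (R₂ := opResolvent T)
    (R₃ := regularResolvent (perturbed T A B)) (J := 1 - P) (J' := 1 - P) (X := -B) (Y := A)
    (X' := B) (Y' := A) (C := C) (Φ₁ := Φc) (Φ₁' := Φc) (Ψ₂ := -Ψ₀) (Φ₂ := Φ₀) (Ψ₃ := Ψc)
    (Ψ₃' := -Ψc) (fun z hz => h.intertwine_inverse hz) (fun z hz => h.intertwine_direct hz)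
    (fun z w hz hw => opResolvent_sub (h.mem_free hz) (h.mem_free hw))
    (fun z hz => (h.continuousAt_free (ne_of_lt hz)).continuousWithinAt)
    (fun z hz => by
      have h1 := hC z hz.ne
      rw [← norm_neg] at h1
      refine le_trans (le_of_eq ?_) h1
      congr 1
      ext x
      simp [sandwich]) hΦc
    (hΦc.congr h.isHardyFamily_regular fun z hz => by
      rw [ContinuousLinearMap.comp_assoc,
        compl_comp_regularResolvent h.finite (h.mem_perturbed hz.ne')])
    (hΨ₀.neg h.smooth_right fun z _ => ContinuousLinearMap.neg_comp _ _)
    hΦ₀ hΨc h.isHardyFamily_star_regular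
    (hΨc.neg h.isHardyFamily_star_regular fun z hz => by
      have hz' : ((starRingEnd ℂ) z).im ≠ 0 := by simp [hz.ne']
      rw [ContinuousLinearMap.comp_assoc, starFamily, ← ContinuousLinearMap.adjoint_comp,
        regularResolvent_comp_compl h.finite (h.mem_perturbed hz'),
        ContinuousLinearMap.neg_comp])
  rw [key, rieszProjection_compl_idempotent h.finite, map_neg, ContinuousLinearMap.neg_comp,
    smul_neg]
  abel

/-- The chain T, L, T. The resolvent of T does not absorb 1 − P, so (2πi)⁻¹(ΨB*Φ₀ − Ψ₀*ΦA) remains;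
by `boundary_commutator` it equals P and completes 1 − P to the identity. -/
theorem inverse_comp_direct
    (hΦ₀ : IsBoundaryOperator (fun z => A.comp (opResolvent T z)) Φ₀)
    (hΦc : IsBoundaryOperator (fun z => A.comp (regularResolvent (perturbed T A B) z)) Φc)
    (hΨ₀ : IsBoundaryOperator (fun z => B.comp (starFamily (opResolvent T) z)) Ψ₀)
    (hΨc : IsBoundaryOperator
      (fun z => B.comp (starFamily (regularResolvent (perturbed T A B)) z)) Ψc) :
    (waveOperator ((1 : H →L[ℂ] H) - rieszProjection (perturbed T A B)) Φc (-Ψ₀)).comp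
      (waveOperator ((1 : H →L[ℂ] H) - rieszProjection (perturbed T A B)) Φ₀ Ψc) = 1 := by
  obtain ⟨C, hC⟩ := h.exists_bound_regular_sandwich
  set P := rieszProjection (perturbed T A B) with hP
  have hA : IsHardyFamily fun z => (A.comp P).comp (opResolvent T z) :=
    (h.isHardyFamily_projection_free.comp_left A)
  have hB : IsHardyFamily fun z => (B.comp (adjoint P)).comp (starFamily (opResolvent T) z) :=
    (h.isHardyFamily_projection_star_free.comp_left B)
  obtain ⟨ΦA, hΦA⟩ := hA.exists_boundaryOperator
  obtain ⟨ΨB, hΨB⟩ := hB.exists_boundaryOperator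
  obtain ⟨ΦP, hΦP⟩ := h.isHardyFamily_projection_free.exists_boundaryOperator
  obtain ⟨ΨP, hΨP⟩ := h.isHardyFamily_projection_star_free.exists_boundaryOperator
  have hadj : adjoint ((1 : H →L[ℂ] H) - P) = 1 - adjoint P := by
    rw [map_sub, ContinuousLinearMap.one_def, ContinuousLinearMap.adjoint_id]
  have hres : IsResolventFamily (opResolvent T) := fun z w hz hw =>
    opResolvent_sub (h.mem_free hz) (h.mem_free hw)
  have key := waveOperator_comp (R₁ := opResolvent T) (R₂ := regularResolvent (perturbed T A B))
    (R₃ := opResolvent T) (J := 1 - P) (J' := 1 - P) (X := B) (Y := A)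
    (X' := -B) (Y' := A) (C := C) (Φ₁ := Φ₀) (Φ₁' := Φ₀ - ΦA) (Ψ₂ := Ψc) (Φ₂ := Φc) (Ψ₃ := -Ψ₀)
    (Ψ₃' := Ψ₀ - ΨB) (fun z hz => h.intertwine_direct hz) (fun z hz => h.intertwine_inverse hz)
    (isResolventFamily_regularResolvent h.finite fun z hz => h.mem_perturbed hz)
    (fun z hz => (h.differentiableAt_regular (ne_of_lt hz)).continuousAt.continuousWithinAt)
    (fun z hz => hC z hz.ne) hΦ₀
    (hΦ₀.sub hΦA h.smooth_left hA fun z _ => by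
      rw [ContinuousLinearMap.comp_sub, ContinuousLinearMap.sub_comp]
      rfl) hΨc hΦc
    (hΨ₀.neg h.smooth_right fun z _ => ContinuousLinearMap.neg_comp _ _)
    (h.smooth_right.neg.congr fun z _ => ContinuousLinearMap.neg_comp _ _)
    (hΨ₀.sub hΨB h.smooth_right hB fun z _ => by
      rw [hadj, ContinuousLinearMap.comp_sub, ContinuousLinearMap.sub_comp]
      rfl)
  have hcomm := boundary_commutator hres (rieszProjection_idempotent h.finite)
    (fun z hz => h.commutator_free hz)
    (denseRange_opResolvent h.dense (h.mem_free (by simp)))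
    (denseRange_starFamily_opResolvent (h.mem_free (by simp))) hΦ₀ hΦA hΨ₀ hΨB hΦP hΨP
  have h1 : (2 * Real.pi * Complex.I : ℂ)⁻¹ •
      ((adjoint ΨB).comp Φ₀ - (adjoint Ψ₀).comp ΦA) = P := by
    rw [hcomm, smul_smul, inv_mul_cancel₀ Complex.two_pi_I_ne_zero, one_smul]
  rw [key, rieszProjection_compl_idempotent h.finite, ← hP]
  simp only [map_neg, map_sub, ContinuousLinearMap.neg_comp, ContinuousLinearMap.sub_comp,
    ContinuousLinearMap.comp_sub, smul_sub, smul_neg]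
  rw [← h1, smul_sub]
  abel

end IsSmoothPerturbation

/-! ### Kernel and range -/

namespace IsSmoothPerturbation

variable {H : Type*} [NormedAddCommGroup H] [InnerProductSpace ℂ H] [CompleteSpace H]
  {K : Type*} [NormedAddCommGroup K] [InnerProductSpace ℂ K] [CompleteSpace K]
  {T : H →ₗ.[ℂ] H} {A B : H →L[ℂ] K} {W Z : H →L[ℂ] H}

theorem ker_inverse (hZ : IsInverseWaveOperator T A B Z)
    (hWZ : W.comp Z = 1 - rieszProjection (perturbed T A B)) :
    LinearMap.ker (Z : H →ₗ[ℂ] H) = discreteSubspace (perturbed T A B) := by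
  refine le_antisymm (fun x hx => ?_) fun x hx => ?_
  · have h1 := congrArg (fun X : H →L[ℂ] H => X x) hWZ
    have h2 : Z x = 0 := hx
    simp only [ContinuousLinearMap.comp_apply, h2, map_zero, sub_apply, one_apply_eq_self] at h1
    exact ⟨x, (sub_eq_zero.1 h1.symm).symm⟩
  · exact ext_inner_left ℂ fun ψ => (hZ.2 x hx ψ).trans (inner_zero_right ψ).symm

/-- The form of W vanishes on the range of P*, so PW = 0; conversely WZ = 1 − P exhibits every
vector of the continuous subspace as a value of W. -/
theorem range_direct (h : IsSmoothPerturbation T A B) (hW : IsDirectWaveOperator T A B W)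
    (hWZ : W.comp Z = 1 - rieszProjection (perturbed T A B)) :
    LinearMap.range (W : H →ₗ[ℂ] H) = continuousSubspace (perturbed T A B) := by
  refine le_antisymm ?_ ?_
  · rintro _ ⟨x, rfl⟩
    have h1 : rieszProjection (perturbed T A B) (W x) = 0 := by
      refine ext_inner_left ℂ fun ψ => ?_
      rw [inner_zero_right, ← ContinuousLinearMap.adjoint_inner_left,
        ← h.rieszProjection_perturbed_adjoint]
      exact hW.2 x _ ⟨ψ, rfl⟩
    exact ⟨W x, by simp [h1]⟩
  · rintro _ ⟨x, rfl⟩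
    exact ⟨Z x, congrArg (fun X : H →L[ℂ] H => X x) hWZ⟩

end IsSmoothPerturbation

end KatoModel

end

/-! ### The main theorem -/

theorem theorem1
    {H : Type*} [NormedAddCommGroup H] [InnerProductSpace ℂ H] [CompleteSpace H]
    {K : Type*} [NormedAddCommGroup K] [InnerProductSpace ℂ K] [CompleteSpace K]
    (T : H →ₗ.[ℂ] H) (A B : H →L[ℂ] K)
    (hT_closed : T.IsClosed) (hT_dense : Dense (T.domain : Set H))
    (hT_real : ∀ z ∈ KatoModel.opSpectrum T, z.im = 0)
    (hT_cont : KatoModel.opSpectrum T = KatoModel.continuousSpectrum T)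
    (hA : KatoModel.IsSmoothRel A T)
    (hB : KatoModel.IsSmoothRel B T.adjoint)
    (hQ₀ : ∃ C : ℝ, ∀ z : ℂ, z.im ≠ 0 → ‖KatoModel.sandwich T A B z‖ ≤ C)
    (h_i : KatoModel.MeromorphicResolvent T (KatoModel.perturbed T A B))
    (h_ii : KatoModel.FiniteDiscreteSpectrum T (KatoModel.perturbed T A B))
    (h_iii : KatoModel.BoundedAwayFromDiscrete (KatoModel.perturbed T A B) A B) :
    KatoModel.DirectFormWellDefined T A B ∧
    KatoModel.InverseFormWellDefined T A B ∧
    ∃ W Z : H →L[ℂ] H,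
      (KatoModel.IsDirectWaveOperator T A B W ∧
        ∀ W' : H →L[ℂ] H, KatoModel.IsDirectWaveOperator T A B W' → W' = W) ∧
      (KatoModel.IsInverseWaveOperator T A B Z ∧
        ∀ Z' : H →L[ℂ] H, KatoModel.IsInverseWaveOperator T A B Z' → Z' = Z) ∧
      Z.comp W = 1 ∧
      W.comp Z = 1 - KatoModel.rieszProjection (KatoModel.perturbed T A B) ∧
      IsIdempotentElem (KatoModel.rieszProjection (KatoModel.perturbed T A B)) ∧
      LinearMap.ker (Z : H →ₗ[ℂ] H) =
        KatoModel.discreteSubspace (KatoModel.perturbed T A B) ∧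
      LinearMap.range (W : H →ₗ[ℂ] H) =
        KatoModel.continuousSubspace (KatoModel.perturbed T A B) := by
  have h : KatoModel.IsSmoothPerturbation T A B :=
    { isClosed := hT_closed
      dense := hT_dense
      real := hT_real
      smooth_left := fun φ => (hA φ).1
      smooth_right := fun ψ => by
        have := (hB ψ).1
        rwa [KatoModel.opResolvent_adjoint hT_dense hT_closed] at this
      bounded_free := hQ₀
      finite := h_ii.1
      complementary := h_ii.2
      bounded := h_iii }
  obtain ⟨Φ₀, hΦ₀⟩ := h.smooth_left.exists_boundaryOperator
  obtain ⟨Φc, hΦc⟩ := h.isHardyFamily_regular.exists_boundaryOperator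
  obtain ⟨Ψ₀, hΨ₀⟩ := h.smooth_right.exists_boundaryOperator
  obtain ⟨Ψc, hΨc⟩ := h.isHardyFamily_star_regular.exists_boundaryOperator
  have hW := h.isDirectWaveOperator hΦ₀ hΨc
  have hZ := h.isInverseWaveOperator hΦc hΨ₀
  have hWZ := h.direct_comp_inverse hΦ₀ hΦc hΨ₀ hΨc
  have hZW := h.inverse_comp_direct hΦ₀ hΦc hΨ₀ hΨc
  have hP := KatoModel.rieszProjection_idempotent h.finite
  refine ⟨h.directFormWellDefined, h.inverseFormWellDefined, _, _,
    ⟨hW, fun W' hW' => hW.unique hW'⟩, ⟨hZ, fun Z' hZ' => hZ.unique hZ'⟩, hZW, hWZ, hP, ?_, ?_⟩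
  · exact KatoModel.IsSmoothPerturbation.ker_inverse hZ hWZ
  · exact h.range_direct hW hWZ
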